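/- Let $K$ be a field of characteristic $0$. A $K$-variety is a nonempty reduced separated scheme of finite type over $K$ (not necessarily irreducible), and an algebraic $K$-group is a group object $G$ in $K$-schemes whose underlying scheme is a $K$-variety (not necessarily affine). For $K$-morphisms $\varphi:X\to G$ and $\psi:Y\to G$ the convolution $\varphi*\psi:X\times Y\to G$ is $(x,y)\mapsto\varphi(x)\cdot\psi(y)$; iterating, $\varphi_1*\dots*\varphi_m:X_1\times\dots\times X_m\to G$ is $(x_1,\dots,x_m)\mapsto\varphi_1(x_1)\cdots\varphi_m(x_m)$ (for $m=0$ it is the unit section), and $\varphi^{*m}$ is the $m$-fold convolution of $\varphi$ with itself. A $K$-morphism $\varphi:X\to Y$ is strongly dominant if its base change to an algebraic closure $\overline K$ of $K$ is dominant on every irreducible component of $X_{\overline K}$. Fibers are scheme-theoretic fibers over arbitrary points of the scheme $G$. A morphism is normal if it is flat and all its fibers are geometrically normal. A scheme is regular in codimension $k$ if each of its local rings of dimension at most $k$ is regular. (A) Let $m\in\mathbb N$, let $X_1,\dots,X_m$ be smooth $K$-varieties, let $G$ be a connected algebraic $K$-group, and let $\varphi_i:X_i\to G$, $1\le i\le m$,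 be strongly dominant morphisms. Then: 1. For all $1\le i,j\le m$ the morphism $\varphi_i*\varphi_j$ is surjective. 2. If $m\ge\dim G$, then $\varphi_1*\dots*\varphi_m$ is flat. 3. If $m\ge\dim G+1$, then $\varphi_1*\dots*\varphi_m$ is flat with reduced fibers. 4. If $m\ge\dim G+2$, then $\varphi_1*\dots*\varphi_m$ is flat with (geometrically) normal fibers, i.e. it is a normal morphism. 5. If $m\ge\dim G+k$ with $k>2$, then $\varphi_1*\dots*\varphi_m$ is flat with (geometrically) normal fibers, and its fibers are regular in codimension $k-1$. (B) The bounds in 2--5 are tight in every positive dimension: for every $n\ge1$ there are a connected algebraic $K$-group $G$ of dimension $n$, a smooth $K$-variety $X$ and a strongly dominant morphism $\varphi:X\to G$ such that $\varphi^{*d}$ is not flat for any $d<n$, $\varphi^{*n}$ has a non-reduced fiber, $\varphi^{*(n+1)}$ has a non-normal fiber, and for every $k\ge0$ the morphism $\varphi^{*(n+k)}$ has a fiber that is not regular in codimension $k$. -/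

import Mathlib

open AlgebraicGeometry CategoryTheory MonoidalCategory CartesianMonoidalCategory MonObj

universe u

noncomputable section

namespace AlgConv

/-- A (not necessarily irreducible) algebraic variety over `K`: a nonempty reduced separated
scheme of finite type over `K`. -/
structure IsVariety {K : Type u} [Field K] (X : Over (Spec (.of K))) : Prop where
  nonempty : Nonempty X.left
  isReduced : IsReduced X.left
  isSeparated : IsSeparated X.hom
  locallyOfFiniteType : LocallyOfFiniteType X.hom
  quasiCompact : QuasiCompact X.hom

/-- A variety that is smooth over `K` (possibly disconnected and of varying dimension). -/
structure IsSmoothVariety {K : Type u} [Field K] (X : Over (Spec (.of K))) : Prop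
    extends IsVariety X where
  smooth : Smooth X.hom

/-- A connected algebraic group over `K`: a group object whose underlying `K`-scheme is a
connected variety. It need not be affine. -/
structure IsConnectedAlgebraicGroup {K : Type u} [Field K] (G : Over (Spec (.of K)))
    [GrpObj G] : Prop extends IsVariety G where
  connected : ConnectedSpace G.left

/-- The structure morphism `Spec K̄ ⟶ Spec K` of an algebraic closure. -/
def specClosure (K : Type u) [Field K] :
    Spec (.of (AlgebraicClosure K)) ⟶ Spec (.of K) :=
  Spec.map (CommRingCat.ofHom (algebraMap K (AlgebraicClosure K)))

/-- `φ : X ⟶ Y` is strongly dominant if it is dominant on every absolutely irreducible component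
of `X`, i.e. if the base change of `φ` to `K̄` maps every irreducible component of `X_K̄` onto a
dense subset of `Y_K̄`. -/
def StronglyDominant {K : Type u} [Field K] {X Y : Over (Spec (.of K))} (φ : X ⟶ Y) : Prop :=
  ∀ Z ∈ irreducibleComponents ((Over.pullback (specClosure K)).obj X).left,
    Dense (((Over.pullback (specClosure K)).map φ).left '' Z)

/-- The convolution `(x, y) ↦ φ x * ψ y` of two morphisms to a group. -/
def conv {K : Type u} [Field K] {G : Over (Spec (.of K))} [GrpObj G]
    {X Y : Over (Spec (.of K))} (φ : X ⟶ G) (ψ : Y ⟶ G) : X ⊗ Y ⟶ G :=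
  (φ ⊗ₘ ψ) ≫ μ[G]

/-- The product `X 0 × (X 1 × (⋯ × Spec K))` over `K`. -/
def prodFam {K : Type u} [Field K] :
    (m : ℕ) → (Fin m → Over (Spec (.of K))) → Over (Spec (.of K))
  | 0, _ => 𝟙_ _
  | m + 1, X => X 0 ⊗ prodFam m (fun i => X i.succ)

/-- The convolution `φ 0 * φ 1 * ⋯ * φ (m - 1)` of a family of morphisms to a group; the empty
convolution is the unit section. -/
def convFam {K : Type u} [Field K] {G : Over (Spec (.of K))} [GrpObj G] :
    (m : ℕ) → {X : Fin m → Over (Spec (.of K))} → ((i : Fin m) → (X i ⟶ G)) →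
      (prodFam m X ⟶ G)
  | 0, _, _ => η[G]
  | m + 1, _, φ => conv (φ 0) (convFam m (fun i => φ i.succ))

/-- The `m`-th convolution power `φ * ⋯ * φ` of a morphism to a group. -/
def convPow {K : Type u} [Field K] {G : Over (Spec (.of K))} [GrpObj G]
    {X : Over (Spec (.of K))} (φ : X ⟶ G) (m : ℕ) : prodFam m (fun _ => X) ⟶ G :=
  convFam m (fun _ => φ)

/-- A scheme is normal if all its local rings are integrally closed domains. -/
def IsNormalScheme (X : Scheme.{u}) : Prop :=
  ∀ x : X, IsDomain (X.presheaf.stalk x) ∧ IsIntegrallyClosed (X.presheaf.stalk x)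

/-- A scheme is regular in codimension `k` (Serre's condition `R_k`) if all its local rings of
dimension at most `k` are regular. -/
def IsRegularInCodim (X : Scheme.{u}) (k : ℕ) : Prop :=
  ∀ x : X, ringKrullDim (X.presheaf.stalk x) ≤ (k : WithBot ℕ∞) →
    IsRegularLocalRing (X.presheaf.stalk x)

/-- A morphism is normal if it is flat and all its scheme-theoretic fibers are geometrically
normal over the respective residue fields. -/
def IsNormalMorphism {X Y : Scheme.{u}} (f : X ⟶ Y) : Prop :=
  Flat f ∧ ∀ y : Y, geometrically IsNormalScheme (f.fiberToSpecResidueField y)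

end AlgConv

end

/-! Part (A) rests on one estimate: the convolution of `m` strongly dominant maps is smooth at every
point `z` of codimension less than `m` (`formallySmooth_stalkMap_convFam`). The codimensions of the
projections of `z` to the factors add up to at most the codimension of `z`
(`ringKrullDim_stalk_add_le`), so some projection is a generic point of its factor. There `φ i` is
smooth, because on stalks it is an extension of fields of characteristic 0. Smoothness of one factor
passes to the convolution: `conv φ ψ` is a base change of `φ` followed by `(g, y) ↦ g * ψ y`, and a
translation identifies the latter with a base change of `Y` over `K`.

Clauses 2-5 are then commutative algebra, for a morphism of smooth `K`-schemes that is smooth in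
codimension less than `m`, with target of dimension at most `n`. If `n ≤ m`, a regular system of
parameters at a point of the target stays a regular sequence on the source: regular rings are
Cohen-Macaulay, so a failure would show at a prime of height less than `n`, where the morphism is
flat. The local criterion gives flatness (`Module.Flat.of_forall_height_lt`). The fibres are now
local complete intersections, and a point of codimension `k` in a fibre has codimension at most `n +
k` in the source, so fibres are regular in codimension `k` once `n + k < m`. Serre's criterion for
complete intersections turns `k = 0` into reducedness and `k = 1` into normality. Fibres are taken
over arbitrary field-valued points, which makes normality geometric.

For clause 1, the images of the smooth loci of the two maps are nonempty open sets `U`, `V` of `G`.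
Since `G` is irreducible over the algebraic closure, every closed point is a product of a point of
`U` and a point of `V`.

For (B), take the additive group of affine `n`-space and `φ x = (x₀², x₀² x₁, …)`. A point of the
`d`-fold product whose projections are generic on `x₀ = 0` can be chosen of codimension at most `d`,
and there the maximal ideal of the origin is pulled back into the square of the maximal ideal.
Flatness would force `n ≤ d`. If `d = n + k`, the local ring of the fibre has the same embedding
dimension as the local ring of the source but smaller dimension, so it is not regular although its
dimension is at most `k`. -/

/-! ### Local criterion of flatness through the vanishing of Tor₁. -/

section LocalCriterion

open TensorProduct IsLocalRing

variable (B : Type u) [CommRing B] (M : Type u) [AddCommGroup M] [Module B M]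

/-- The vanishing of `Tor₁(M, N)`: tensoring with `M` preserves injectivity of every submodule
inclusion with cokernel isomorphic to `N`. -/
def TorOneVanishes (N : Type u) [AddCommGroup N] [Module B N] : Prop :=
  ∀ (L : Type u) [AddCommGroup L] [Module B L] (g : L →ₗ[B] N), Function.Surjective g →
    Function.Injective (g.ker.subtype.lTensor M)

namespace TorOneVanishes

variable {B M}
variable {N N₁ N₂ : Type u} [AddCommGroup N] [Module B N] [AddCommGroup N₁] [Module B N₁]
  [AddCommGroup N₂] [Module B N₂]

lemma lTensor_injective (h : TorOneVanishes B M N) {L' L : Type u} [AddCommGroup L'] [Module B L']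
    [AddCommGroup L] [Module B L] {f : L' →ₗ[B] L} {g : L →ₗ[B] N} (hf : Function.Injective f)
    (hg : Function.Surjective g) (hfg : Function.Exact f g) :
    Function.Injective (f.lTensor M) := by
  have hr : ∀ x, f x ∈ g.ker := fun x ↦ (hfg _).mpr ⟨x, rfl⟩
  let e : L' ≃ₗ[B] g.ker := LinearEquiv.ofBijective (f.codRestrict _ hr)
    ⟨fun x y hxy ↦ hf (congrArg Subtype.val hxy), fun ⟨y, hy⟩ ↦ by
      obtain ⟨x, rfl⟩ := (hfg y).mp hy
      exact ⟨x, rfl⟩⟩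
  have : f = g.ker.subtype ∘ₗ e.toLinearMap := rfl
  rw [this, LinearMap.lTensor_comp]
  exact (h L g hg).comp (e.lTensor M).injective

/-- A sequence ending in a projective module splits, and a retraction of the kernel inclusion
survives tensoring. -/
lemma of_projective [Module.Projective B N] : TorOneVanishes B M N := by
  intro L _ _ g hg
  obtain ⟨s, hs⟩ := Module.projective_lifting_property g LinearMap.id hg
  have hs' : ∀ x, g (s x) = x := fun x ↦ congrArg (fun f : N →ₗ[B] N ↦ f x) hs
  let r : L →ₗ[B] g.ker := (LinearMap.id - s ∘ₗ g).codRestrict _ (fun x ↦ by simp [hs'])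
  have hr : r ∘ₗ g.ker.subtype = LinearMap.id := by
    ext ⟨x, hx⟩
    have : g x = 0 := hx
    simp [r, this]
  have : r.lTensor M ∘ₗ g.ker.subtype.lTensor M = LinearMap.id := by
    rw [← LinearMap.lTensor_comp, hr, LinearMap.lTensor_id]
  exact Function.LeftInverse.injective (g := r.lTensor M)
    (fun x ↦ congrArg (fun f : M ⊗[B] g.ker →ₗ[B] _ ↦ f x) this)

lemma of_subsingleton [Subsingleton N] : TorOneVanishes B M N := .of_projective

lemma of_linearEquiv (h : TorOneVanishes B M N) (e : N ≃ₗ[B] N₁) : TorOneVanishes B M N₁ := by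
  intro L _ _ g hg
  refine h.lTensor_injective (g := e.symm.toLinearMap ∘ₗ g) (Submodule.injective_subtype _)
    (e.symm.surjective.comp hg) fun x ↦ ?_
  simp

/-- The inclusion of `ker p` in `L` factors through `ker (g ∘ p)`; the two steps have cokernels `N₁`
and `N₂`, so each stays injective after tensoring. -/
lemma of_extension {f : N₁ →ₗ[B] N} {g : N →ₗ[B] N₂} (hf : Function.Injective f)
    (hg : Function.Surjective g) (hfg : Function.Exact f g) (h₁ : TorOneVanishes B M N₁)
    (h₂ : TorOneVanishes B M N₂) : TorOneVanishes B M N := by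
  intro L _ _ p hp
  let L₁ : Submodule B L := (g ∘ₗ p).ker
  have h : p.ker ≤ L₁ := fun x hx ↦ by
    have : p x = 0 := hx
    simp [L₁, this]
  have hL₁ : ∀ x : L₁, p x ∈ f.range := fun x ↦ (hfg _).mp x.2
  let e := LinearEquiv.ofInjective f hf
  let q : L₁ →ₗ[B] N₁ := e.symm.toLinearMap ∘ₗ ((p ∘ₗ L₁.subtype).codRestrict f.range hL₁)
  have hq : Function.Surjective q := by
    refine e.symm.surjective.comp ?_
    rintro ⟨_, y, rfl⟩
    obtain ⟨x, hx⟩ := hp (f y)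
    refine ⟨⟨x, ?_⟩, Subtype.ext hx⟩
    simp only [L₁, LinearMap.mem_ker, LinearMap.comp_apply, hx]
    exact (hfg _).mpr ⟨y, rfl⟩
  have hc : p.ker.subtype = L₁.subtype ∘ₗ Submodule.inclusion h := rfl
  rw [hc, LinearMap.lTensor_comp]
  refine (h₂ L (g ∘ₗ p) (hg.comp hp)).comp (h₁.lTensor_injective (g := q)
    (Submodule.inclusion_injective h) hq fun x ↦ ?_)
  have : q x = 0 ↔ p x = 0 := by
    simp only [q, LinearMap.comp_apply, LinearEquiv.coe_coe, EmbeddingLike.map_eq_zero_iff]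
    rw [Subtype.ext_iff]
    rfl
  rw [this]
  exact ⟨fun hx ↦ ⟨⟨x, hx⟩, rfl⟩, by rintro ⟨y, rfl⟩; exact y.2⟩

/-- Symmetry of Tor by hand: the fibre product `E` of `F` and `L` over `N` contains `ker p` with
quotient `F`, and contains the image of `N₁` with quotient `L`. A chase in `E` compares the two
inclusions after tensoring. -/
lemma of_presentation {F : Type u} [AddCommGroup F] [Module B F] {f : N₁ →ₗ[B] F} {g : F →ₗ[B] N}
    (hg : Function.Surjective g) (hfg : Function.Exact f g) (hF : TorOneVanishes B M F)
    (hf : Function.Injective (f.lTensor M)) :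
    TorOneVanishes B M N := by
  intro L _ _ p hp
  let E : Submodule B (F × L) := (g ∘ₗ LinearMap.fst B F L - p ∘ₗ LinearMap.snd B F L).ker
  have hE : ∀ x : E, g x.1.1 = p x.1.2 := fun x ↦ sub_eq_zero.mp x.2
  let i : p.ker →ₗ[B] E := (LinearMap.inr B F L ∘ₗ p.ker.subtype).codRestrict E (fun x ↦ by
    simp [E])
  let j : N₁ →ₗ[B] E := (LinearMap.inl B F L ∘ₗ f).codRestrict E (fun x ↦ by
    have := (hfg _).mpr ⟨x, rfl⟩
    simp [E, this])
  let πF : E →ₗ[B] F := LinearMap.fst B F L ∘ₗ E.subtype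
  let πL : E →ₗ[B] L := LinearMap.snd B F L ∘ₗ E.subtype
  have hπF : Function.Surjective πF := fun x ↦ by
    obtain ⟨y, hy⟩ := hp (g x)
    exact ⟨⟨(x, y), by simp [E, hy]⟩, rfl⟩
  have hπL : Function.Surjective πL := fun y ↦ by
    obtain ⟨x, hx⟩ := hg (p y)
    exact ⟨⟨(x, y), by simp [E, hx]⟩, rfl⟩
  have hi : Function.Injective (i.lTensor M) := by
    refine hF.lTensor_injective (g := πF) (fun x y hxy ↦ ?_) hπF fun x ↦ ?_
    · exact Subtype.ext (congrArg (fun z : E ↦ z.1.2) hxy)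
    · refine ⟨fun hx ↦ ?_, by rintro ⟨y, rfl⟩; rfl⟩
      have hx' : x.1.1 = 0 := hx
      have h0 := hE x
      rw [hx', map_zero] at h0
      exact ⟨⟨x.1.2, h0.symm⟩, Subtype.ext (Prod.ext hx'.symm rfl)⟩
  have hj : Function.Exact (j.lTensor M) (πL.lTensor M) := by
    refine lTensor_exact M (fun x ↦ ⟨fun hx ↦ ?_, by rintro ⟨y, rfl⟩; rfl⟩) hπL
    have hx' : x.1.2 = 0 := hx
    have h0 := hE x
    rw [hx', map_zero] at h0
    obtain ⟨y, hy⟩ := (hfg _).mp h0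
    exact ⟨y, Subtype.ext (Prod.ext hy hx'.symm)⟩
  rw [injective_iff_map_eq_zero]
  intro u hu
  have h1 : πL.lTensor M (i.lTensor M u) = 0 := by
    rw [← LinearMap.comp_apply, ← LinearMap.lTensor_comp]
    exact hu
  obtain ⟨w, hw⟩ := (hj _).mp h1
  have h2 : f.lTensor M w = 0 := by
    have : f = πF ∘ₗ j := rfl
    rw [this, LinearMap.lTensor_comp, LinearMap.comp_apply, hw, ← LinearMap.comp_apply,
      ← LinearMap.lTensor_comp]
    have : πF ∘ₗ i = 0 := rfl
    rw [this]
    simp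
  rw [(injective_iff_map_eq_zero _).mp hf _ h2, map_zero] at hw
  exact (injective_iff_map_eq_zero _).mp hi _ hw.symm

/-- Over a local ring the residue field is the only simple module, so this is induction on length by
`of_extension`. -/
lemma of_isFiniteLength [IsLocalRing B] (h : TorOneVanishes B M (B ⧸ maximalIdeal B))
    (hN : IsFiniteLength B N) : TorOneVanishes B M N := by
  induction hN with
  | of_subsingleton => exact .of_subsingleton
  | @of_simple_quotient N _ _ N' hs _ ih =>
    obtain ⟨I, hI, ⟨e⟩⟩ := isSimpleModule_iff_quot_maximal.mp hs
    obtain rfl := IsLocalRing.eq_maximalIdeal hI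
    exact of_extension (Submodule.injective_subtype N') (Submodule.mkQ_surjective N')
      (LinearMap.exact_subtype_mkQ N') ih (h.of_linearEquiv e.symm)

/-- A sequence that is regular on both `B` and `M` kills `Tor₁(M, B / (b₁, …, bᵣ))`. -/
lemma of_isWeaklyRegular {rs : List B} (hM : RingTheory.Sequence.IsWeaklyRegular M rs) :
    TorOneVanishes B M (B ⧸ Ideal.ofList rs) := by
  induction rs using List.reverseRecOn with
  | nil =>
    have : TorOneVanishes B M B := .of_projective
    refine this.of_linearEquiv ?_
    rw [Ideal.ofList_nil]
    exact (Submodule.quotEquivOfEqBot _ rfl).symm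
  | append_singleton rs r ih =>
    rw [RingTheory.Sequence.isWeaklyRegular_append_iff] at hM
    have ih := ih hM.1
    have hMr := (RingTheory.Sequence.isWeaklyRegular_singleton_iff _ _).mp hM.2
    set I := Ideal.ofList rs with hI
    have hle : I ≤ Ideal.ofList (rs ++ [r]) := by
      rw [Ideal.ofList_append]; exact le_sup_left
    -- Multiplication by `r` on `B ⧸ I` need not be injective. It only has to become so after
    -- tensoring with `M`, which is the regularity of `r` on `M ⧸ I M`.
    refine of_presentation (f := LinearMap.lsmul B (B ⧸ I) r) (g := Submodule.factor hle)
      (Submodule.factor_surjective hle) ?_ ih ?_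
    · intro x
      obtain ⟨x, rfl⟩ := Submodule.Quotient.mk_surjective _ x
      rw [← Submodule.mkQ_apply, Submodule.factor_mk, Submodule.mkQ_apply,
        Submodule.Quotient.mk_eq_zero, Ideal.ofList_append,
        Ideal.ofList_singleton, Submodule.mem_sup]
      constructor
      · rintro ⟨y, hy, z, hz, rfl⟩
        obtain ⟨a, rfl⟩ := Ideal.mem_span_singleton'.mp hz
        refine ⟨Submodule.Quotient.mk a, ?_⟩
        rw [LinearMap.lsmul_apply, ← Submodule.Quotient.mk_smul, Submodule.mkQ_apply,
          Submodule.Quotient.eq]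
        have : r • a - (y + a * r) = -y := by rw [smul_eq_mul]; ring
        rw [this]
        exact I.neg_mem hy
      · rintro ⟨a, ha⟩
        obtain ⟨a, rfl⟩ := Submodule.Quotient.mk_surjective _ a
        rw [LinearMap.lsmul_apply, ← Submodule.Quotient.mk_smul, Submodule.mkQ_apply,
          Submodule.Quotient.eq] at ha
        refine ⟨x - r • a, ?_, r • a, Ideal.mem_span_singleton'.mpr ⟨a, mul_comm _ _⟩, by ring⟩
        rw [← neg_sub]
        exact I.neg_mem ha
    · let e : (M ⊗[B] (B ⧸ I)) ≃ₗ[B] (M ⧸ (I • ⊤ : Submodule B M)) :=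
        TensorProduct.tensorQuotEquivQuotSMul M I
      have he : ∀ x, e ((LinearMap.lsmul B (B ⧸ I) r).lTensor M x) = r • e x := by
        intro x
        rw [← map_smul]
        congr 1
        have : (LinearMap.lsmul B (B ⧸ I) r).lTensor M = LinearMap.lsmul B _ r := by
          ext; simp
        rw [this]; rfl
      intro x y hxy
      apply e.injective
      apply hMr
      simp only [← he, hxy]

end TorOneVanishes

variable {B}

/-- The local criterion of flatness. -/
theorem Module.Flat.of_torOneVanishes [IsNoetherianRing B] [IsLocalRing B] {A : Type u} [CommRing A]
    [IsNoetherianRing A] [IsLocalRing A] [Algebra B A] [IsLocalHom (algebraMap B A)]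
    (h : TorOneVanishes B A (B ⧸ maximalIdeal B)) : Module.Flat B A := by
  rw [Module.Flat.iff_lTensor_injective]
  intro I _
  rw [injective_iff_map_eq_zero]
  intro u hu
  set 𝔪 := maximalIdeal B
  set 𝔫 := 𝔪.map (algebraMap B A)
  have h𝔫 : 𝔫 ≠ ⊤ := fun hn ↦ by
    have : 𝔫 ≤ maximalIdeal A := ((local_hom_TFAE (algebraMap B A)).out 0 2).mp
      ‹IsLocalHom (algebraMap B A)›
    exact (maximalIdeal.isMaximal A).ne_top (top_le_iff.mp (hn ▸ this))
  -- Krull's intersection theorem for the finite `A`-module `A ⊗ I`: it suffices to place `u` in `𝔫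
  -- ^ j` times this module for every `j`.
  have hkrull := Ideal.iInf_pow_smul_eq_bot_of_isLocalRing (M := A ⊗[B] I) 𝔫 h𝔫
  suffices hmem : ∀ j, u ∈ (𝔫 ^ j • ⊤ : Submodule A (A ⊗[B] I)) by
    have : u ∈ (⨅ j, 𝔫 ^ j • ⊤ : Submodule A (A ⊗[B] I)) := by simpa using hmem
    rw [hkrull] at this
    exact this
  intro j
  -- Artin-Ree: `I ∩ 𝔪 ^ (j + k)` lies in `𝔪 ^ j I`.
  obtain ⟨k, hk⟩ := Ideal.exists_pow_inf_eq_pow_smul (M := B) 𝔪 I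
  have hjk := hk (j + k) (Nat.le_add_left k j)
  rw [Nat.add_sub_cancel] at hjk
  set Q : Ideal B := 𝔪 ^ (j + k)
  -- Containing a power of the maximal ideal, `I ⊔ Q` has a quotient of finite length, so the
  -- hypothesis on the residue field applies.
  have hJ : TorOneVanishes B A (B ⧸ (I ⊔ Q)) := by
    by_cases htop : I ⊔ Q = ⊤
    · have := Submodule.Quotient.subsingleton_iff.mpr htop
      exact .of_subsingleton
    refine .of_isFiniteLength h ?_
    have hmin : 𝔪 ∈ (I ⊔ Q).minimalPrimes := by
      refine ⟨⟨(maximalIdeal.isMaximal B).isPrime, le_maximalIdeal htop⟩, fun q ⟨hq, hle⟩ _ ↦ ?_⟩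
      exact hq.le_of_pow_le (le_sup_right.trans hle)
    have := IsLocalRing.quotient_artinian_of_mem_minimalPrimes_of_isLocalRing (I ⊔ Q) hmin
    rw [isFiniteLength_iff_isNoetherian_isArtinian]
    exact ⟨inferInstance, isArtinian_of_surjective_algebraMap
      (Ideal.Quotient.mk_surjective (I := I ⊔ Q))⟩
  have hinj := hJ.lTensor_injective (f := (I ⊔ Q).subtype) (Submodule.injective_subtype _)
    (Submodule.mkQ_surjective _) (LinearMap.exact_subtype_mkQ _)
  have hu' : (Submodule.inclusion (le_sup_left : I ≤ I ⊔ Q)).lTensor A u = 0 := by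
    refine (injective_iff_map_eq_zero _).mp hinj _ ?_
    rw [← LinearMap.comp_apply, ← LinearMap.lTensor_comp]
    exact hu
  -- `C` is `I ∩ Q` inside `I`. As `I ⧸ C` is isomorphic to `(I ⊔ Q) ⧸ Q`, the element `u` dies in
  -- `A ⊗ (I ⧸ C)` and hence comes from `A ⊗ C`.
  set C : Submodule B I := Submodule.comap I.subtype I ⊓ Submodule.comap I.subtype Q
  have hC : C.mkQ.lTensor A u = 0 := by
    let e := LinearMap.quotientInfEquivSupQuotient I Q
    apply (e.lTensor A).injective
    have : e.toLinearMap ∘ₗ C.mkQ =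
      (Submodule.mkQ _) ∘ₗ Submodule.inclusion (le_sup_left : I ≤ I ⊔ Q) := rfl
    have h2 := congrArg (fun f ↦ f.lTensor A u) this
    simp only [LinearMap.lTensor_comp, LinearMap.comp_apply] at h2
    rw [hu', map_zero] at h2
    exact h2.trans (map_zero _).symm
  obtain ⟨v, rfl⟩ := (_root_.lTensor_exact A (LinearMap.exact_subtype_mkQ C)
    (Submodule.mkQ_surjective C) u).mp hC
  have hCle : ∀ c : C, (c : I) ∈ (𝔪 ^ j • ⊤ : Submodule B I) := by
    rintro ⟨c, hc⟩
    have hc1 : (c : B) ∈ I ⊓ Q := hc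
    have hc2 : (c : B) ∈ 𝔪 ^ (j + k) • (⊤ : Submodule B B) ⊓ I := by
      simpa [and_comm] using hc1
    rw [hjk] at hc2
    have hc3 : (c : B) ∈ 𝔪 ^ j • I := smul_mono_right (𝔪 ^ j) (inf_le_right (a := 𝔪 ^ k • (⊤ : Submodule B B))) hc2
    have : 𝔪 ^ j • I = (𝔪 ^ j • ⊤ : Submodule B I).map I.subtype := by
      rw [Submodule.map_smul'', Submodule.map_top, Submodule.range_subtype]
    rw [this] at hc3
    obtain ⟨c', hc', hcc⟩ := hc3
    rwa [Subtype.ext hcc] at hc'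
  have key : ∀ (a : A) (x : I), x ∈ (𝔪 ^ j • ⊤ : Submodule B I) →
      a ⊗ₜ[B] x ∈ (𝔫 ^ j • ⊤ : Submodule A (A ⊗[B] I)) := by
    intro a x hx
    induction hx using Submodule.smul_induction_on' with
    | smul r hr n _ =>
      have : a ⊗ₜ[B] (r • n) = algebraMap B A r • (a ⊗ₜ[B] n) := by
        rw [TensorProduct.tmul_smul, algebraMap_smul]
      rw [this]
      refine Submodule.smul_mem_smul ?_ trivial
      rw [← Ideal.map_pow]
      exact Ideal.mem_map_of_mem _ hr
    | add x _ y _ hx hy => rw [TensorProduct.tmul_add]; exact add_mem hx hy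
  clear hu hu' hC
  induction v with
  | zero => simp
  | tmul a c => exact key a c (hCle c)
  | add x y hx hy => rw [map_add]; exact add_mem hx hy

/-- If the maximal ideal of `B` is generated by an `A`-regular sequence, then `A` is flat. -/
theorem Module.Flat.of_isWeaklyRegular [IsNoetherianRing B] [IsLocalRing B] {A : Type u}
    [CommRing A] [IsNoetherianRing A] [IsLocalRing A] [Algebra B A] [IsLocalHom (algebraMap B A)]
    {rs : List B} (h : RingTheory.Sequence.IsWeaklyRegular A rs)
    (hrs : Ideal.ofList rs = maximalIdeal B) : Module.Flat B A :=
  .of_torOneVanishes (hrs ▸ .of_isWeaklyRegular h)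

end LocalCriterion

/-! ### Regular local rings: domains, regular parameters, Cohen-Macaulayness. -/

section RegularLocalRing

open IsLocalRing RingTheory.Sequence

/-- Modulo an element outside the square of the maximal ideal, one generator can be dropped. -/
lemma exists_generators_quotient_span_singleton {A : Type*} [CommRing A] [IsLocalRing A] {d : ℕ}
    (v : Fin (d + 1) → A) (hv : Ideal.span (Set.range v) = maximalIdeal A) {x : A}
    (hx : x ∈ maximalIdeal A) (hx2 : x ∉ maximalIdeal A ^ 2) :
    ∃ w : Fin d → A ⧸ Ideal.span {x},
      Ideal.span (Set.range w) = (maximalIdeal A).map (Ideal.Quotient.mk (Ideal.span {x})) := by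
  have hvm : ∀ i, v i ∈ maximalIdeal A := fun i ↦ hv ▸ Ideal.subset_span ⟨i, rfl⟩
  rw [← hv, Ideal.mem_span_range_iff_exists_fun] at hx
  obtain ⟨a, ha⟩ := hx
  -- As `x` is not in the square of the maximal ideal, some coefficient is a unit, and that
  -- generator becomes redundant modulo `x`.
  obtain ⟨i, hi⟩ : ∃ i, IsUnit (a i) := by
    by_contra! h
    refine hx2 (ha ▸ Ideal.sum_mem _ fun i _ ↦ ?_)
    rw [pow_two]
    exact Ideal.mul_mem_mul ((mem_maximalIdeal _).mpr (h i)) (hvm i)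
  let π := Ideal.Quotient.mk (Ideal.span {x})
  refine ⟨fun j ↦ π (v (i.succAbove j)), ?_⟩
  rw [← hv, Ideal.map_span]
  apply le_antisymm
  · refine Ideal.span_mono ?_
    rintro _ ⟨j, rfl⟩
    exact ⟨_, ⟨_, rfl⟩, rfl⟩
  · rw [Ideal.span_le]
    rintro _ ⟨_, ⟨j, rfl⟩, rfl⟩
    by_cases hj : j = i
    · subst hj
      have h0 : π (a j) * π (v j) + ∑ k, π (a (j.succAbove k)) * π (v (j.succAbove k)) = 0 := by
        have := congrArg π ha
        rw [Fin.sum_univ_succAbove _ j, map_add, map_sum, map_mul] at this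
        simp only [map_mul] at this
        rw [this]
        exact Ideal.Quotient.eq_zero_iff_mem.mpr (Ideal.mem_span_singleton_self x)
      have h1 : π (a j) * π (v j) ∈ Ideal.span (Set.range fun k ↦ π (v (j.succAbove k))) := by
        rw [eq_neg_of_add_eq_zero_left h0]
        refine neg_mem (Ideal.sum_mem _ fun k _ ↦ Ideal.mul_mem_left _ _ ?_)
        exact Ideal.subset_span ⟨k, rfl⟩
      exact (Ideal.unit_mul_mem_iff_mem _ (hi.map π)).mp h1
    · obtain ⟨k, rfl⟩ := Fin.exists_succAbove_eq hj
      exact Ideal.subset_span ⟨k, rfl⟩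

/-- Induction on `d`: prime avoidance gives `x` in the maximal ideal, outside its square and outside
all minimal primes. The quotient by `x` needs one generator less and loses at most one dimension.
Domain and regular sequence are proved together, since the quotient being a domain makes `x` prime,
which gives that `A` is a domain and `x` is regular. -/
lemma isDomain_and_exists_isWeaklyRegular (d : ℕ) : ∀ (A : Type u) [CommRing A] [IsLocalRing A]
    [IsNoetherianRing A] (v : Fin d → A), Ideal.span (Set.range v) = maximalIdeal A →
    (d : WithBot ℕ∞) ≤ ringKrullDim A →
    IsDomain A ∧ ∃ rs : List A, rs.length = d ∧ Ideal.ofList rs = maximalIdeal A ∧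
      IsWeaklyRegular A rs := by
  induction d with
  | zero =>
    intro A _ _ _ v hv _
    have hm : maximalIdeal A = ⊥ := by rw [← hv]; simp
    refine ⟨(isField_iff_maximalIdeal_eq.mpr hm).isDomain, [], rfl, ?_, .nil A A⟩
    rw [hm, Ideal.ofList_nil]
  | succ d ih =>
    intro A _ _ _ v hv hd
    have hpos : (0 : WithBot ℕ∞) < ringKrullDim A := by
      refine lt_of_lt_of_le ?_ hd
      exact_mod_cast Nat.succ_pos d
    have hnotmin : maximalIdeal A ∉ minimalPrimes A := by
      intro h
      have h1 : (maximalIdeal A).height = 0 := by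
        exact Ideal.height_eq_zero_iff.mpr h
      have h2 := maximalIdeal_height_eq_ringKrullDim (R := A)
      rw [h1] at h2
      rw [← h2] at hpos
      exact lt_irrefl _ hpos
    obtain ⟨x, hxm, hx2, hxmin⟩ : ∃ x ∈ maximalIdeal A, x ∉ maximalIdeal A ^ 2 ∧
        ∀ p ∈ minimalPrimes A, x ∉ p := by
      have hfin := minimalPrimes.finite_of_isNoetherianRing A
      by_contra! h
      have hsub : (maximalIdeal A : Set A) ⊆
          ⋃ I ∈ (↑(insert (maximalIdeal A ^ 2) hfin.toFinset) : Set (Ideal A)), (I : Set A) := by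
        intro x hx
        simp only [Set.mem_iUnion]
        by_cases hx2 : x ∈ maximalIdeal A ^ 2
        · exact ⟨_, Finset.mem_coe.mpr (Finset.mem_insert_self _ _), hx2⟩
        · obtain ⟨p, hp, hxp⟩ := h x hx hx2
          exact ⟨p, Finset.mem_coe.mpr (Finset.mem_insert_of_mem (hfin.mem_toFinset.mpr hp)), hxp⟩
      -- The square of the maximal ideal is the only member that may fail to be prime, which prime
      -- avoidance tolerates.
      have hex := (Ideal.subset_union_prime (f := fun I : Ideal A ↦ I) (maximalIdeal A ^ 2)
        (maximalIdeal A ^ 2) ?_).mp hsub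
      · obtain ⟨I, hI, hle⟩ := hex
        rw [Finset.mem_insert, hfin.mem_toFinset] at hI
        rcases hI with rfl | hI
        · have : maximalIdeal A = ⊥ := by
            refine Submodule.eq_bot_of_le_smul_of_le_jacobson_bot (maximalIdeal A) _
              (IsNoetherian.noetherian _) ?_ (IsLocalRing.maximalIdeal_le_jacobson _)
            rwa [smul_eq_mul, ← pow_two]
          have hF := isField_iff_maximalIdeal_eq.mpr this
          rw [ringKrullDim_eq_zero_of_isField hF] at hpos
          exact lt_irrefl _ hpos
        · have hp := hI.1.1
          have : I = maximalIdeal A := le_antisymm (le_maximalIdeal hp.ne_top) hle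
          exact hnotmin (this ▸ hI)
      · intro I hI hne _
        rw [Finset.mem_insert, hfin.mem_toFinset] at hI
        exact (hI.resolve_left hne).1.1
    let A' := A ⧸ Ideal.span {x}
    have hle : Ideal.span {x} ≤ maximalIdeal A := (Ideal.span_singleton_le_iff_mem _).mpr hxm
    have hne : Ideal.span {x} ≠ ⊤ := fun h ↦ (maximalIdeal.isMaximal A).ne_top
      (top_le_iff.mp (h ▸ hle))
    have : Nontrivial A' := Ideal.Quotient.nontrivial_iff.mpr hne
    have : IsLocalRing A' := .of_surjective' (Ideal.Quotient.mk _) Ideal.Quotient.mk_surjective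
    have hmax : (maximalIdeal A).map (Ideal.Quotient.mk (Ideal.span {x})) = maximalIdeal A' :=
      IsLocalRing.map_maximalIdeal_of_surjective _ Ideal.Quotient.mk_surjective
    obtain ⟨w, hw⟩ := exists_generators_quotient_span_singleton v hv hxm hx2
    have hd' : (d : WithBot ℕ∞) ≤ ringKrullDim A' := by
      have h1 := Ideal.height_le_ringKrullDim_quotient_add_one (p := maximalIdeal A) hxm
      rw [maximalIdeal_height_eq_ringKrullDim] at h1
      have h2 := hd.trans h1
      rw [Nat.cast_add, Nat.cast_one] at h2
      exact ENat.WithBot.add_le_add_one_right_iff.mp h2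
    obtain ⟨hdom, rs, hlen, hrs, hreg⟩ := ih A' w (hw.trans hmax) hd'
    have hprime : (Ideal.span {x}).IsPrime := (Ideal.Quotient.isDomain_iff_prime _).mp hdom
    obtain ⟨p, hp, hpx⟩ := Ideal.exists_minimalPrimes_le (bot_le : ⊥ ≤ Ideal.span {x})
    have hpp := hp.1.1
    -- From `p ⊆ (x)` with `x ∉ p` follows `p = x p`, so `p = 0` by Nakayama.
    have hpbot : p = ⊥ := by
      refine Submodule.eq_bot_of_le_smul_of_le_jacobson_bot (maximalIdeal A) _
        (IsNoetherian.noetherian _) (fun y hy ↦ ?_) (IsLocalRing.maximalIdeal_le_jacobson _)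
      obtain ⟨a, rfl⟩ := Ideal.mem_span_singleton'.mp (hpx hy)
      rw [mul_comm]
      exact Submodule.smul_mem_smul hxm ((hpp.mem_or_mem hy).resolve_right (hxmin p hp))
    have hA : IsDomain A := by
      rw [hpbot] at hpp
      exact IsDomain.of_bot_isPrime A
    have hx0 : x ≠ 0 := fun h ↦ hx2 (h ▸ zero_mem _)
    have hout : (rs.map Quotient.out).map (algebraMap A A') = rs := by
      rw [List.map_map]
      exact (List.map_congr_left fun y _ ↦ Quotient.out_eq' y).trans (List.map_id rs)
    refine ⟨hA, x :: rs.map Quotient.out, by simp [hlen], ?_, ?_⟩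
    · have h1 : (Ideal.ofList (x :: rs.map Quotient.out)).map (algebraMap A A') =
          (maximalIdeal A).map (algebraMap A A') := by
        have hx' : Ideal.span {algebraMap A A' x} = ⊥ :=
          Ideal.span_singleton_eq_bot.mpr
            (Ideal.Quotient.eq_zero_iff_mem.mpr (Ideal.mem_span_singleton_self x))
        rw [Ideal.map_ofList, List.map_cons, hout, Ideal.ofList_cons, hrs, hx', bot_sup_eq]
        exact hmax.symm
      have h2 := congrArg (Ideal.comap (algebraMap A A')) h1
      rw [Ideal.comap_map_of_surjective (algebraMap A A') Ideal.Quotient.mk_surjective,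
        Ideal.comap_map_of_surjective (algebraMap A A') Ideal.Quotient.mk_surjective] at h2
      have hk : Ideal.comap (algebraMap A A') ⊥ = Ideal.span {x} := Ideal.mk_ker
      rwa [hk, sup_eq_left.mpr hle, sup_eq_left.mpr] at h2
      rw [Ideal.ofList_cons]
      exact le_sup_left
    · rw [isWeaklyRegular_cons_iff]
      refine ⟨IsSMulRegular.of_ne_zero hx0, ?_⟩
      have e : QuotSMulTop x A ≃ₗ[A] A' := Submodule.quotEquivOfEq _ _ (by
        rw [← Submodule.ideal_span_singleton_smul, smul_eq_mul, Ideal.mul_top])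
      rw [e.isWeaklyRegular_congr, ← isWeaklyRegular_map_algebraMap_iff A', hout]
      exact hreg

namespace IsRegularLocalRing

lemma exists_fin_generators (A : Type u) [CommRing A] [IsRegularLocalRing A] :
    ∃ (d : ℕ) (v : Fin d → A), Ideal.span (Set.range v) = maximalIdeal A ∧
      (d : WithBot ℕ∞) = ringKrullDim A := by
  have hfg : (maximalIdeal A).FG := IsNoetherian.noetherian _
  have hfin := Submodule.FG.finite_generators hfg
  have hcard := Submodule.FG.generators_ncard hfg
  have := hfin.fintype
  let e := Finite.equivFin (maximalIdeal A).generators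
  have hc : (maximalIdeal A).spanFinrank = Nat.card (maximalIdeal A).generators := by
    rw [← hcard, Nat.card_coe_set_eq]
  refine ⟨(maximalIdeal A).spanFinrank, fun i ↦ e.symm (finCongr hc i), ?_,
    ‹IsRegularLocalRing A›.spanFinrank_maximalIdeal⟩
  have : Set.range (fun i ↦ ((e.symm (finCongr hc i)) : A)) = (maximalIdeal A).generators := by
    ext y
    constructor
    · rintro ⟨i, rfl⟩
      exact (e.symm _).2
    · intro hy
      exact ⟨(finCongr hc).symm (e ⟨y, hy⟩), by dsimp only; rw [Equiv.apply_symm_apply, Equiv.symm_apply_apply]⟩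
  rw [this]
  exact Submodule.span_generators _

lemma isDomain (A : Type u) [CommRing A] [IsRegularLocalRing A] : IsDomain A := by
  obtain ⟨d, v, hv, hd⟩ := exists_fin_generators A
  exact (isDomain_and_exists_isWeaklyRegular d A v hv hd.le).1

/-- The maximal ideal of a regular local ring is generated by a regular sequence. -/
lemma exists_isWeaklyRegular (A : Type u) [CommRing A] [IsRegularLocalRing A] :
    ∃ rs : List A, (rs.length : WithBot ℕ∞) = ringKrullDim A ∧
      Ideal.ofList rs = maximalIdeal A ∧ IsWeaklyRegular A rs := by
  obtain ⟨d, v, hv, hd⟩ := exists_fin_generators A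
  obtain ⟨-, rs, hlen, h⟩ := isDomain_and_exists_isWeaklyRegular d A v hv hd.le
  exact ⟨rs, by rw [hlen, hd], h⟩

end IsRegularLocalRing

section Depth

open Abelian

variable {A : Type u} [CommRing A] [IsNoetherianRing A] [IsLocalRing A]

omit [IsNoetherianRing A] in
lemma smul_top_lt_top_of_le_maximalIdeal (M : Type u) [AddCommGroup M] [Module A M]
    [Module.Finite A M] [Nontrivial M] :
    maximalIdeal A • (⊤ : Submodule A M) < ⊤ := by
  rw [lt_top_iff_ne_top]
  exact Submodule.top_ne_ideal_smul_of_le_jacobson_annihilator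
    (IsLocalRing.maximalIdeal_le_jacobson _) |>.symm

/-- Dividing by a regular element lowers the depth by at most one. -/
lemma exists_isRegular_quotSMulTop {M : Type u} [AddCommGroup M] [Module A M] [Module.Finite A M]
    [Nontrivial M] {x : A} (hx : x ∈ maximalIdeal A) (hreg : IsSMulRegular M x) {n : ℕ}
    (h : ∃ rs : List A, rs.length = n + 1 ∧ (∀ r ∈ rs, r ∈ maximalIdeal A) ∧ IsRegular M rs) :
    ∃ rs : List A, rs.length = n ∧ (∀ r ∈ rs, r ∈ maximalIdeal A) ∧
      IsRegular (QuotSMulTop x M) rs := by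
  have : Nontrivial (QuotSMulTop x M) := nontrivial_quotSMulTop_of_mem_maximalIdeal M hx
  have h1 := ((ModuleCat.exists_isRegular_tfae (maximalIdeal A) (n + 1) (ModuleCat.of A M)
    (smul_top_lt_top_of_le_maximalIdeal M)).out 3 1).mp h
  refine ((ModuleCat.exists_isRegular_tfae (maximalIdeal A) n (ModuleCat.of A (QuotSMulTop x M))
    (smul_top_lt_top_of_le_maximalIdeal _)).out 1 3).mp fun i hi ↦ ?_
  -- The Ext groups from the residue field to the quotient in degree `i` sit between those to `M` in
  -- degrees `i` and `i + 1`.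
  have zero1 := AddCommGrpCat.isZero_of_iff_subsingleton.mpr (h1 i (by omega))
  have zero2 := AddCommGrpCat.isZero_of_iff_subsingleton.mpr (h1 (i + 1) (by omega))
  exact AddCommGrpCat.subsingleton_of_isZero <| ShortComplex.Exact.isZero_of_both_zeros
    ((Ext.covariant_sequence_exact₃' _
      (IsSMulRegular.smulShortComplex_shortExact (M := ModuleCat.of A M) hreg)) i (i + 1) rfl)
    (zero1.eq_zero_of_src _) (zero2.eq_zero_of_tgt _)

lemma exists_isRegular_quotient_ofList {fs : List A} (hfs : ∀ f ∈ fs, f ∈ maximalIdeal A) {n : ℕ}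
    {M : Type u} [AddCommGroup M] [Module A M] [Module.Finite A M] [Nontrivial M]
    (hreg : IsWeaklyRegular M fs)
    (h : ∃ rs : List A, rs.length = fs.length + n ∧ (∀ r ∈ rs, r ∈ maximalIdeal A) ∧
      IsRegular M rs) :
    ∃ rs : List A, rs.length = n ∧ (∀ r ∈ rs, r ∈ maximalIdeal A) ∧
      IsRegular (M ⧸ (Ideal.ofList fs • ⊤ : Submodule A M)) rs := by
  induction fs generalizing M with
  | nil =>
    obtain ⟨rs, hl, hm, hr⟩ := h
    refine ⟨rs, by simpa using hl, hm, ?_⟩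
    have e : M ≃ₗ[A] (M ⧸ (Ideal.ofList ([] : List A) • ⊤ : Submodule A M)) :=
      (Submodule.quotEquivOfEqBot _ (by simp)).symm
    exact (e.isRegular_congr rs).mp hr
  | cons f fs ih =>
    rw [isWeaklyRegular_cons_iff] at hreg
    have hf := hfs f List.mem_cons_self
    have : Nontrivial (QuotSMulTop f M) := nontrivial_quotSMulTop_of_mem_maximalIdeal M hf
    have h' := exists_isRegular_quotSMulTop hf hreg.1 (n := fs.length + n) (by
      obtain ⟨rs, hl, h⟩ := h
      exact ⟨rs, by rw [hl, List.length_cons]; omega, h⟩)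
    obtain ⟨rs, hl, hm, hr⟩ := ih (fun f hf ↦ hfs f (List.mem_cons_of_mem _ hf)) hreg.2 h'
    exact ⟨rs, hl, hm,
      ((Submodule.quotOfListConsSMulTopEquivQuotSMulTopInner M f fs).isRegular_congr rs).mpr hr⟩

/-- Regular local rings are Cohen-Macaulay. -/
theorem IsRegularLocalRing.ringKrullDim_le_length_of_mem_associatedPrimes {A : Type u} [CommRing A]
    [IsRegularLocalRing A] {fs : List A} (hfs : ∀ f ∈ fs, f ∈ maximalIdeal A)
    (hreg : IsWeaklyRegular A fs)
    (hass : maximalIdeal A ∈ associatedPrimes A (A ⧸ Ideal.ofList fs)) :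
    ringKrullDim A ≤ fs.length := by
  by_contra! hlt
  obtain ⟨xs, hlen, hmax, hxs⟩ := exists_isWeaklyRegular A
  rw [← hlen] at hlt
  have hlt' : fs.length < xs.length := by exact_mod_cast hlt
  have hxm : ∀ r ∈ xs, r ∈ maximalIdeal A := fun r hr ↦ hmax ▸ Ideal.subset_span hr
  obtain ⟨n, hn⟩ := Nat.exists_eq_add_of_lt hlt'
  -- Were `fs` shorter than the dimension, the quotient by `fs` would have positive depth, which is
  -- impossible when the maximal ideal is associated to it.
  obtain ⟨rs, hl, hm, hr⟩ := exists_isRegular_quotient_ofList hfs (n := n + 1) hreg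
    ⟨xs, by omega, hxm, .of_isWeaklyRegular_of_mem_maximalIdeal A hxm hxs⟩
  obtain ⟨r, rs, rfl⟩ := List.exists_cons_of_length_eq_add_one hl
  rw [isRegular_cons_iff] at hr
  obtain ⟨hp, z, hz⟩ := isAssociatedPrime_iff.mp hass
  have hr' : IsSMulRegular (A ⧸ Ideal.ofList fs) r := by
    have e : (A ⧸ (Ideal.ofList fs • ⊤ : Submodule A A)) ≃ₗ[A] A ⧸ Ideal.ofList fs :=
      Submodule.quotEquivOfEq _ _ (by rw [smul_eq_mul, Ideal.mul_top])
    exact (e.isSMulRegular_congr r).mp hr.1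
  have hrz : r • z = 0 := by
    have := hm r List.mem_cons_self
    rwa [hz, Submodule.mem_colon_singleton, Submodule.mem_bot] at this
  have hz0 : z = 0 := hr' (by simpa using hrz)
  refine hp.ne_top (hz.trans ?_)
  simp [hz0, Ideal.eq_top_iff_one, Submodule.mem_colon_singleton]

end Depth

end RegularLocalRing

/-! ### Smooth algebras over a field are regular. -/

section SmoothRegular

open IsLocalRing

/-- Regularity ascends along flat local homomorphisms whose closed fibre is a field. -/
lemma IsRegularLocalRing.of_flat_of_map_maximalIdeal_eq {B A : Type*} [CommRing B]
    [IsRegularLocalRing B] [CommRing A] [IsLocalRing A] [IsNoetherianRing A] [Algebra B A]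
    [Module.Flat B A] (h : (maximalIdeal B).map (algebraMap B A) = maximalIdeal A) :
    IsRegularLocalRing A := by
  have : IsLocalHom (algebraMap B A) := ((local_hom_TFAE (algebraMap B A)).out 0 2).mpr h.le
  apply IsRegularLocalRing.of_spanFinrank_maximalIdeal_le
  have : (maximalIdeal A).LiesOver (maximalIdeal B) := ⟨(maximalIdeal_comap (algebraMap B A)).symm⟩
  have h1 := Ideal.height_eq_height_add_of_liesOver_of_hasGoingDown (maximalIdeal B)
    (maximalIdeal A)
  have h2 : ringKrullDim B ≤ ringKrullDim A := by
    rw [← maximalIdeal_height_eq_ringKrullDim, ← maximalIdeal_height_eq_ringKrullDim, h1]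
    exact_mod_cast le_self_add
  refine le_trans ?_ h2
  -- The images of a minimal set of generators for `B` generate the maximal ideal of `A`, and
  -- flatness makes `dim B ≤ dim A`.
  rw [← (isRegularLocalRing_iff B).mp ‹_›, Nat.cast_le, ← h]
  have fg' := (maximalIdeal B).fg_of_isNoetherianRing
  have fg := Submodule.FG.finite_generators fg'
  conv_lhs => rw [← (maximalIdeal B).span_generators, ← Ideal.span, Ideal.map_span]
  rw [← Submodule.FG.generators_ncard fg']
  exact (Submodule.spanFinrank_span_le_ncard_of_finite (fg.image _)).trans (Set.ncard_image_le fg)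

/-- Étale local homomorphisms are flat, and being unramified they carry the maximal ideal of the
base to generators of the maximal ideal above. -/
lemma Algebra.Etale.isRegularRing (R S : Type*) [CommRing R] [CommRing S] [Algebra R S]
    [Algebra.Etale R S] [IsRegularRing R] : IsRegularRing S := by
  have : IsNoetherianRing S := Algebra.FiniteType.isNoetherianRing R S
  refine isRegularRing_iff.mpr fun p hp ↦ ?_
  let q := p.under R
  let := Localization.AtPrime.algebraOfLiesOver q p
  refine IsRegularLocalRing.of_flat_of_map_maximalIdeal_eq (B := Localization.AtPrime q) ?_
  have : EssFiniteType (Localization.AtPrime q) (Localization.AtPrime p) := .of_comp R _ _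
  have : IsLocalHom (algebraMap (Localization.AtPrime q) (Localization.AtPrime p)) := by
    rw [Localization.AtPrime.IsLiesOverAlgebra.algebraMap_eq]
    infer_instance
  exact FormallyUnramified.map_maximalIdeal

/-- Near `p` the algebra is étale over a polynomial ring over `K`, which is regular. -/
lemma Algebra.IsSmoothAt.isRegularLocalRing (K : Type*) {S : Type*} [Field K] [CommRing S]
    [Algebra K S] [Algebra.FinitePresentation K S] (p : Ideal S) [p.IsPrime]
    [Algebra.IsSmoothAt K p] : IsRegularLocalRing (Localization.AtPrime p) := by
  obtain ⟨f, hfp, n, _, _, _⟩ :=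
    Algebra.IsSmoothAt.exists_isStandardEtale_mvPolynomial (R := K) (p := p)
  have := Algebra.Etale.isRegularRing (MvPolynomial (Fin n) K) (Localization.Away f)
  have hd : Disjoint (Submonoid.powers f : Set S) (p : Set S) :=
    (Ideal.disjoint_powers_iff_notMem_of_isPrime _).mpr hfp
  let p' := p.map (algebraMap S (Localization.Away f))
  have : p'.IsPrime := IsLocalization.isPrime_of_isPrime_disjoint (.powers f) _ _ ‹_› hd
  have hcomap : p'.comap (algebraMap S (Localization.Away f)) = p :=
    IsLocalization.under_map_of_isPrime_disjoint (.powers f) _ ‹_› hd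
  have : IsLocalization.AtPrime (Localization.AtPrime p') p := by
    have h := IsLocalization.isLocalization_isLocalization_atPrime_isLocalization (.powers f)
      (Localization.AtPrime p') p'
    simpa only [hcomap] using h
  exact IsRegularLocalRing.of_ringEquiv
    (IsLocalization.algEquiv p.primeCompl (Localization.AtPrime p') _).toRingEquiv

lemma Algebra.Smooth.isRegularRing (K S : Type*) [Field K] [CommRing S] [Algebra K S]
    [Algebra.Smooth K S] : IsRegularRing S := by
  have : IsNoetherianRing S := Algebra.FiniteType.isNoetherianRing K S
  refine isRegularRing_iff.mpr fun p hp ↦ ?_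
  exact Algebra.IsSmoothAt.isRegularLocalRing K p

end SmoothRegular

/-! ### Flatness between regular rings, tested in small codimension. -/

section FlatCriterion

open IsLocalRing RingTheory.Sequence

lemma maximalIdeal_mem_associatedPrimes_quotient_map {A : Type*} [CommRing A] {I Q : Ideal A}
    [Q.IsPrime] (h : Q ∈ associatedPrimes A (A ⧸ I)) :
    maximalIdeal (Localization.AtPrime Q) ∈ associatedPrimes (Localization.AtPrime Q)
      (Localization.AtPrime Q ⧸ I.map (algebraMap A (Localization.AtPrime Q))) := by
  have e := Ideal.localized'_eq_map (Localization.AtPrime Q) Q.primeCompl I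
  rw [← e]
  refine Module.associatedPrimes.mem_associatedPrimes_of_comap_mem_associatedPrimes_of_isLocalizedModule
    Q.primeCompl (I.toLocalizedQuotient' (Localization.AtPrime Q) Q.primeCompl
      (Algebra.linearMap A (Localization.AtPrime Q))) _ ?_
  have h1 : (maximalIdeal (Localization.AtPrime Q)).comap (algebraMap A _) = Q :=
    Localization.AtPrime.under_maximalIdeal
  rwa [h1]

lemma not_isSMulRegular_of_mem_associatedPrimes {A M : Type*} [CommRing A] [IsNoetherianRing A]
    [AddCommGroup M] [Module A M] {Q : Ideal A} (h : Q ∈ associatedPrimes A M) {g : A}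
    (hg : g ∈ Q) : ¬ IsSMulRegular M g := by
  intro hr
  obtain ⟨hp, z, hz⟩ := isAssociatedPrime_iff.mp h
  have hgz : g • z = 0 := by
    rwa [hz, Submodule.mem_colon_singleton, Submodule.mem_bot] at hg
  have hz0 : z = 0 := hr (by simpa using hgz)
  refine hp.ne_top (hz.trans ?_)
  simp [hz0, Ideal.eq_top_iff_one, Submodule.mem_colon_singleton]

/-- On a regular ring, weak regularity of a sequence of length `r` can be tested at the primes of
height less than `r`. -/
lemma IsRegularRing.isWeaklyRegular_of_forall_localization {A : Type u} [CommRing A]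
    [IsRegularRing A] (rs : List A)
    (H : ∀ (Q : Ideal A) [Q.IsPrime], Q.height < rs.length →
      IsWeaklyRegular (Localization.AtPrime Q) rs) : IsWeaklyRegular A rs := by
  induction rs using List.reverseRecOn with
  | nil => exact .nil A A
  | append_singleton fs g ih =>
    have ih' : IsWeaklyRegular A fs := ih fun Q _ hQ ↦
      ((isWeaklyRegular_append_iff _ fs [g]).mp (H Q (hQ.trans (by simp; norm_cast; omega)))).1
    rw [isWeaklyRegular_append_iff]
    refine ⟨ih', ?_⟩
    rw [isWeaklyRegular_singleton_iff]
    let e : (A ⧸ (Ideal.ofList fs • ⊤ : Submodule A A)) ≃ₗ[A] A ⧸ Ideal.ofList fs :=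
      Submodule.quotEquivOfEq _ _ (by rw [smul_eq_mul, Ideal.mul_top])
    rw [e.isSMulRegular_congr]
    by_contra hg
    obtain ⟨z, hz, hgz⟩ : ∃ z : A ⧸ Ideal.ofList fs, z ≠ 0 ∧ g • z = 0 := by
      simpa [isSMulRegular_iff_right_eq_zero_of_smul, and_comm] using hg
    have hmem : g ∈ ⋃ p ∈ associatedPrimes A (A ⧸ Ideal.ofList fs), (p : Set A) := by
      rw [biUnion_associatedPrimes_eq_zero_divisors]
      exact ⟨z, hz, hgz⟩
    simp only [Set.mem_iUnion] at hmem
    obtain ⟨Q, hQ, hgQ⟩ := hmem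
    have hQp : Q.IsPrime := hQ.1
    have hass := maximalIdeal_mem_associatedPrimes_quotient_map hQ
    have hfs : Ideal.ofList fs ≤ Q := by
      have := IsAssociatedPrime.annihilator_le hQ
      rwa [Submodule.annihilator_top, Ideal.annihilator_quotient] at this
    have hass' := hass
    rw [Ideal.map_ofList] at hass'
    -- Cohen-Macaulayness bounds the height of the associated prime `Q` by the length of `fs`, so
    -- `H` applies at `Q` and contradicts `g ∈ Q`.
    have hle := IsRegularLocalRing.ringKrullDim_le_length_of_mem_associatedPrimes
      (fs := fs.map (algebraMap A (Localization.AtPrime Q))) (by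
        intro f hf
        obtain ⟨f, hf', rfl⟩ := List.mem_map.mp hf
        exact (IsLocalization.AtPrime.to_map_mem_maximal_iff _ Q f).mpr
          (hfs (Ideal.subset_span hf')))
      (ih'.of_isLocalization _ Q.primeCompl) hass'
    rw [IsLocalization.AtPrime.ringKrullDim_eq_height Q, List.length_map] at hle
    have hlt : Q.height < (fs ++ [g]).length := by
      have : Q.height ≤ fs.length := by exact_mod_cast hle
      refine this.trans_lt ?_
      rw [List.length_append, List.length_singleton]
      exact_mod_cast Nat.lt_succ_self _
    have hQreg := H Q hlt
    rw [← isWeaklyRegular_map_algebraMap_iff (Localization.AtPrime Q), List.map_append,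
      isWeaklyRegular_append_iff, List.map_singleton, isWeaklyRegular_singleton_iff] at hQreg
    refine not_isSMulRegular_of_mem_associatedPrimes hass'
      ((IsLocalization.AtPrime.to_map_mem_maximal_iff _ Q g).mpr hgQ) ?_
    let e : (Localization.AtPrime Q ⧸ (Ideal.ofList (fs.map (algebraMap A (Localization.AtPrime Q)))
      • ⊤ : Submodule (Localization.AtPrime Q) (Localization.AtPrime Q)))
        ≃ₗ[Localization.AtPrime Q] _ := Submodule.quotEquivOfEq _
          (Ideal.ofList (fs.map (algebraMap A (Localization.AtPrime Q))))
          (by rw [smul_eq_mul, Ideal.mul_top])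
    exact (e.isSMulRegular_congr _).mp hQreg.2

lemma IsRegularRing.of_isLocalization {S : Type*} [CommRing S] [IsRegularRing S] (M : Submonoid S)
    (A : Type*) [CommRing A] [Algebra S A] [IsLocalization M A] : IsRegularRing A := by
  have : IsNoetherianRing A := IsLocalization.isNoetherianRing M A inferInstance
  refine isRegularRing_iff.mpr fun Q _ ↦ ?_
  have := IsLocalization.isLocalization_isLocalization_atPrime_isLocalization M
    (Localization.AtPrime Q) Q
  exact IsRegularLocalRing.of_ringEquiv (IsLocalization.algEquiv
    (Q.comap (algebraMap S A)).primeCompl (Localization.AtPrime (Q.comap (algebraMap S A)))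
    (Localization.AtPrime Q)).toRingEquiv

/-- A morphism between regular rings is flat as soon as it is flat in codimension less than the
dimension of the base. -/
theorem Module.Flat.of_forall_height_lt {R S : Type u} [CommRing R] [CommRing S] [Algebra R S]
    [IsRegularRing R] [IsRegularRing S] {m : ℕ} (hR : ∀ (p : Ideal R) [p.IsPrime], p.height ≤ m)
    (H : ∀ (q : Ideal S) [q.IsPrime], q.height < m → Module.Flat R (Localization.AtPrime q)) :
    Module.Flat R S := by
  refine Module.flat_of_isLocalized_maximal (S := S) S (fun q _ ↦ Localization.AtPrime q)
    (fun q _ ↦ Algebra.linearMap S (Localization.AtPrime q)) fun q hq ↦ ?_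
  let p := q.under R
  let := Localization.AtPrime.algebraOfLiesOver p q
  let B := Localization.AtPrime p
  let A := Localization.AtPrime q
  have hloc : IsLocalHom (algebraMap B A) := by
    rw [Localization.AtPrime.IsLiesOverAlgebra.algebraMap_eq]
    infer_instance
  suffices Module.Flat B A from Module.Flat.trans R B A
  obtain ⟨rs, hlen, hrs, hreg⟩ := IsRegularLocalRing.exists_isWeaklyRegular B
  rw [IsLocalization.AtPrime.ringKrullDim_eq_height p] at hlen
  have hlen' : (rs.length : ℕ∞) ≤ m := (by exact_mod_cast hlen : (rs.length : ℕ∞) = p.height) ▸ hR p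
  refine Module.Flat.of_isWeaklyRegular ?_ hrs
  have : IsRegularRing A := .of_isLocalization q.primeCompl A
  rw [← isWeaklyRegular_map_algebraMap_iff A]
  refine IsRegularRing.isWeaklyRegular_of_forall_localization _ fun Q hQ hlt ↦ ?_
  rw [List.length_map] at hlt
  -- The localization of `A` at `Q` is a localization of `S` at a prime of height less than `m`. It
  -- is therefore flat over `B`, and the parameters of `B` stay regular on it.
  have hflat := H (Q.under S) (by
    rw [IsLocalization.height_under q.primeCompl]
    exact hlt.trans_le hlen')
  have : IsLocalization.AtPrime (Localization.AtPrime Q) (Q.under S) :=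
    IsLocalization.isLocalization_isLocalization_atPrime_isLocalization q.primeCompl
      (Localization.AtPrime Q) Q
  let e := IsLocalization.algEquiv (Q.under S).primeCompl (Localization.AtPrime (Q.under S))
    (Localization.AtPrime Q)
  have : Module.Flat R (Localization.AtPrime Q) :=
    Module.Flat.of_linearEquiv (e.restrictScalars R).symm.toLinearEquiv
  have : Module.Flat B (Localization.AtPrime Q) :=
    (Module.flat_iff_of_isLocalization B p.primeCompl _).mpr this
  have h := IsWeaklyRegular.of_flat (S := Localization.AtPrime Q) hreg
  rw [isWeaklyRegular_map_algebraMap_iff] at h ⊢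
  exact h

end FlatCriterion

/-! ### Reducedness and normality from localizations at associated primes. -/

section SerreCriterion

open IsLocalRing nonZeroDivisors

/-- The annihilator of a nonzero nilpotent lies in an associated prime `P`, so the nilpotent would
survive in the localization at `P`. -/
lemma isReduced_of_forall_mem_associatedPrimes {T : Type*} [CommRing T] [IsNoetherianRing T]
    (H : ∀ (P : Ideal T) [P.IsPrime], P ∈ associatedPrimes T T →
      IsReduced (Localization.AtPrime P)) : IsReduced T := by
  refine ⟨fun t ht ↦ ?_⟩
  by_contra ht0
  obtain ⟨P, hP, hle⟩ := exists_le_isAssociatedPrime_of_isNoetherianRing T t ht0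
  have := hP.1
  have := H P hP
  have h0 : algebraMap T (Localization.AtPrime P) t = 0 := (ht.map (algebraMap T _)).eq_zero
  obtain ⟨s, hs⟩ := (IsLocalization.map_eq_zero_iff P.primeCompl _ t).mp h0
  exact s.2 (hle (Submodule.mem_colon_singleton.mpr hs))

/-- Under Serre's condition `S₂`, a ring whose localizations at the associated primes of principal
ideals are normal is integrally closed in its total ring of fractions. -/
lemma dvd_of_isIntegral_of_forall_mem_associatedPrimes {T : Type*} [CommRing T]
    [IsNoetherianRing T]
    (H : ∀ (P : Ideal T) [P.IsPrime], ∀ s ∈ T⁰, P ∈ associatedPrimes T (T ⧸ Ideal.span {s}) →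
      IsDomain (Localization.AtPrime P) ∧ IsIntegrallyClosed (Localization.AtPrime P))
    {a : T} {s : T⁰} (h : IsIntegral T (IsLocalization.mk' (FractionRing T) a s)) :
    (s : T) ∣ a := by
  by_contra hdvd
  have hne : Ideal.Quotient.mk (Ideal.span {(s : T)}) a ≠ 0 := fun h0 ↦
    hdvd (Ideal.mem_span_singleton.mp (Ideal.Quotient.eq_zero_iff_mem.mp h0))
  -- `P` contains every `r` with `s ∣ r a`. Integral closedness at `P` puts `a / s` in the
  -- localization, producing such an `r` outside `P`.
  obtain ⟨P, hP, hle⟩ := exists_le_isAssociatedPrime_of_isNoetherianRing T _ hne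
  have := hP.1
  obtain ⟨_, _⟩ := H P s s.2 hP
  let TP := Localization.AtPrime P
  let F := FractionRing TP
  have hu : ∀ y : T⁰, IsUnit (algebraMap T F y) := fun y ↦ by
    rw [IsScalarTower.algebraMap_apply T TP F, isUnit_iff_ne_zero]
    refine (map_ne_zero_iff _ (IsFractionRing.injective TP F)).mpr fun h0 ↦ ?_
    obtain ⟨v, hv⟩ := (IsLocalization.map_eq_zero_iff P.primeCompl _ _).mp h0
    have : (v : T) = 0 := mul_right_mem_nonZeroDivisors_eq_zero_iff y.2 |>.mp hv
    exact v.2 (this ▸ zero_mem P)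
  let g : FractionRing T →ₐ[T] F :=
    { IsLocalization.lift hu with commutes' := fun t ↦ IsLocalization.lift_eq hu t }
  have hx : IsIntegral TP (g (IsLocalization.mk' (FractionRing T) a s)) := (h.map g).tower_top
  obtain ⟨c, hc⟩ := IsIntegrallyClosed.isIntegral_iff.mp hx
  have hcs : algebraMap T TP s * c = algebraMap T TP a := by
    refine IsFractionRing.injective TP F ?_
    rw [map_mul, hc, ← IsScalarTower.algebraMap_apply, ← IsScalarTower.algebraMap_apply,
      ← g.commutes, ← map_mul, IsLocalization.mk'_spec', g.commutes]
  obtain ⟨⟨d, u⟩, hd⟩ := IsLocalization.surj P.primeCompl c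
  have h1 : algebraMap T TP (u * a) = algebraMap T TP (s * d) := by
    rw [map_mul, map_mul, ← hd, ← hcs]; ring
  obtain ⟨v, hv⟩ := (IsLocalization.eq_iff_exists P.primeCompl TP).mp h1
  have hmem : (v * u : T) ∈ P := by
    refine hle (Submodule.mem_colon_singleton.mpr ?_)
    rw [Submodule.mem_bot, Algebra.smul_def, Ideal.Quotient.algebraMap_eq, ← map_mul,
      Ideal.Quotient.eq_zero_iff_mem, Ideal.mem_span_singleton]
    exact ⟨v * d, by rw [_root_.mul_assoc, hv]; ring⟩
  exact (hP.1.mem_or_mem hmem).elim v.2 u.2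

lemma mem_nonZeroDivisors_of_forall_notMem_minimalPrimes {T : Type*} [CommRing T] [IsReduced T]
    {s : T} (h : ∀ p ∈ minimalPrimes T, s ∉ p) : s ∈ T⁰ := by
  rw [mem_nonZeroDivisors_iff_right]
  intro x hx
  have : x ∈ nilradical T := by
    rw [nilradical, ← Ideal.sInf_minimalPrimes, Ideal.mem_sInf]
    intro p hp
    exact (hp.1.1.mem_or_mem (hx ▸ zero_mem p)).resolve_right (h p hp)
  rwa [nilradical_eq_zero, Ideal.zero_eq_bot, Ideal.mem_bot] at this

/-- A ring integrally closed in its total ring of fractions contains the idempotents of the latter,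
and a local ring has only the trivial ones. A zero divisor `a` would give a nontrivial idempotent `a
/ (a + b)`, with `a b = 0` and `a + b` regular. -/
lemma isDomain_and_isIntegrallyClosed_of_forall_mem_associatedPrimes {T : Type*} [CommRing T]
    [IsNoetherianRing T] [IsLocalRing T] [IsReduced T]
    (H : ∀ (P : Ideal T) [P.IsPrime], ∀ s ∈ T⁰, P ∈ associatedPrimes T (T ⧸ Ideal.span {s}) →
      IsDomain (Localization.AtPrime P) ∧ IsIntegrallyClosed (Localization.AtPrime P)) :
    IsDomain T ∧ IsIntegrallyClosed T := by
  classical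
  have hdom : IsDomain T := by
    refine @NoZeroDivisors.to_isDomain T _ _ ⟨fun {a c} hac ↦ ?_⟩
    by_contra! hne
    obtain ⟨ha, hc⟩ := hne
    have hfin := minimalPrimes.finite_of_isNoetherianRing T
    let J : Ideal T := (⊥ : Ideal T).colon {a}
    have hJ : ∀ {b}, b ∈ J ↔ b * a = 0 := by
      intro b
      rw [Submodule.mem_colon_singleton, Submodule.mem_bot, smul_eq_mul]
    -- At a minimal prime `p` containing `a` the localization is a field in which `a` vanishes, so
    -- the annihilator `J` of `a` is not inside `p`; prime avoidance then finds `b`.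
    obtain ⟨b, hb, hbp⟩ : ∃ b ∈ J, ∀ p ∈ minimalPrimes T, a ∈ p → b ∉ p := by
      by_contra! h
      have hsub : (J : Set T) ⊆ ⋃ I ∈ (↑{p ∈ hfin.toFinset | a ∈ p} : Set (Ideal T)), (I : Set T) := by
        intro b hb
        obtain ⟨p, hp, hap, hbp⟩ := h b hb
        simp only [Set.mem_iUnion]
        exact ⟨p, by simpa using ⟨hp, hap⟩, hbp⟩
      have hmem : ∀ {p}, p ∈ hfin.toFinset.filter (a ∈ ·) ↔ p ∈ minimalPrimes T ∧ a ∈ p := by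
        simp
      obtain ⟨p, hp, hJp⟩ := (Ideal.subset_union_prime (f := fun I : Ideal T ↦ I) ⊥ ⊥
        fun p hp _ _ ↦ (hmem.mp hp).1.1.1).mp hsub
      rw [hmem] at hp
      have := hp.1.1.1
      have hdim : Ring.KrullDimLE 0 (Localization.AtPrime p) := by
        rw [Ring.krullDimLE_iff, IsLocalization.AtPrime.ringKrullDim_eq_height p,
          Ideal.height_eq_zero_iff.mpr hp.1]
        rfl
      have hbot := isField_iff_maximalIdeal_eq.mp
        (Ring.KrullDimLE.isField_of_isReduced (R := Localization.AtPrime p))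
      have h0 : algebraMap T (Localization.AtPrime p) a ∈ maximalIdeal _ :=
        (IsLocalization.AtPrime.to_map_mem_maximal_iff _ p a).mpr hp.2
      rw [hbot, Ideal.mem_bot] at h0
      obtain ⟨v, hv⟩ := (IsLocalization.map_eq_zero_iff p.primeCompl _ a).mp h0
      exact v.2 (hJp (hJ.mpr hv))
    have hs : a + b ∈ T⁰ := by
      refine mem_nonZeroDivisors_of_forall_notMem_minimalPrimes fun p hp hab ↦ ?_
      by_cases hap : a ∈ p
      · exact hbp p hp hap ((Ideal.add_mem_iff_right p hap).mp hab)
      · have hbp := (hp.1.1.mem_or_mem (hJ.mp hb ▸ zero_mem p)).resolve_right hap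
        exact hap ((Ideal.add_mem_iff_left p hbp).mp hab)
    have hab_int : IsIntegral T (IsLocalization.mk' (FractionRing T) a ⟨a + b, hs⟩) := by
      refine ⟨Polynomial.X ^ 2 - Polynomial.X, Polynomial.monic_X_pow_sub (by simp), ?_⟩
      rw [Polynomial.eval₂_sub, Polynomial.eval₂_pow, Polynomial.eval₂_X, sub_eq_zero, pow_two,
        ← IsLocalization.mk'_mul, IsLocalization.mk'_eq_iff_eq]
      congr 1
      have := hJ.mp hb
      simp only [Submonoid.coe_mul]
      linear_combination (-(a + b)) * this
    obtain ⟨e, he⟩ := dvd_of_isIntegral_of_forall_mem_associatedPrimes H hab_int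
    have hee : e * (1 - e) = 0 := by
      rw [← mul_right_mem_nonZeroDivisors_eq_zero_iff (mul_mem hs hs)]
      linear_combination (-(a + b) + a + (a + b) * e) * he + hJ.mp hb
    rcases IsLocalRing.isUnit_or_isUnit_one_sub_self e with hu | hu
    · have h1 : e = 1 := (sub_eq_zero.mp (hu.mul_right_eq_zero.mp hee)).symm
      have hb0 : b = 0 := by
        rw [h1, _root_.mul_one] at he
        simpa using he.symm
      rw [hb0, add_zero] at hs
      exact hc ((mul_left_mem_nonZeroDivisors_eq_zero_iff hs).mp hac)
    · rw [hu.mul_left_eq_zero.mp hee, mul_zero] at he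
      exact ha he
  refine ⟨hdom, (isIntegrallyClosed_iff (FractionRing T)).mpr fun {x} hx ↦ ?_⟩
  obtain ⟨a, s, rfl⟩ := IsLocalization.exists_mk'_eq T⁰ x
  obtain ⟨c, hc⟩ := dvd_of_isIntegral_of_forall_mem_associatedPrimes H hx
  exact ⟨c, by rw [IsLocalization.eq_mk'_iff_mul_eq, ← map_mul, hc, mul_comm]⟩

end SerreCriterion

/-! ### Complete intersections: Cohen-Macaulayness and Serre's criterion. -/

section CompleteIntersection

open IsLocalRing nonZeroDivisors RingTheory.Sequence

/-- A ring is a (local) complete intersection if it is the quotient of a regular local ring by a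
regular sequence. -/
def IsLocalCompleteIntersection (T : Type u) [CommRing T] : Prop :=
  ∃ (A : Type u) (_ : CommRing A) (_ : IsRegularLocalRing A) (_ : Algebra A T) (fs : List A),
    (∀ f ∈ fs, f ∈ maximalIdeal A) ∧ IsWeaklyRegular A fs ∧
    Function.Surjective (algebraMap A T) ∧ RingHom.ker (algebraMap A T) = Ideal.ofList fs

namespace IsLocalCompleteIntersection

lemma of_ringEquiv {T T' : Type u} [CommRing T] [CommRing T'] (e : T ≃+* T')
    (h : IsLocalCompleteIntersection T) : IsLocalCompleteIntersection T' := by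
  obtain ⟨A, _, _, _, fs, hfs, hreg, hsurj, hker⟩ := h
  refine ⟨A, _, ‹_›, (e.toRingHom.comp (algebraMap A T)).toAlgebra, fs, hfs, hreg,
    e.surjective.comp hsurj, ?_⟩
  rw [RingHom.algebraMap_toAlgebra, ← hker]
  ext x
  simp [RingHom.mem_ker]

/-- Complete intersections are Cohen-Macaulay. -/
lemma ringKrullDim_le_length {T : Type u} [CommRing T] [IsLocalRing T] [IsNoetherianRing T]
    (h : IsLocalCompleteIntersection T) {gs : List T} (hgs : ∀ g ∈ gs, g ∈ maximalIdeal T)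
    (hreg : IsWeaklyRegular T gs)
    (hass : maximalIdeal T ∈ associatedPrimes T (T ⧸ Ideal.ofList gs)) :
    ringKrullDim T ≤ gs.length := by
  obtain ⟨A, _, _, _, fs, hfs, hfsreg, hsurj, hker⟩ := h
  have hloc : IsLocalHom (algebraMap A T) := hsurj.isLocalHom _
  have hsurj' := hsurj
  choose σ hσ using hsurj'
  have hout : (gs.map σ).map (algebraMap A T) = gs := by
    rw [List.map_map]
    exact (List.map_congr_left fun y _ ↦ hσ y).trans (List.map_id gs)
  let hs := gs.map σ
  -- Lifting `gs` to `A` and appending it to the defining sequence `fs` reduces the claim to the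
  -- regular local ring `A`.
  have hcomap : Ideal.ofList (fs ++ hs) = (Ideal.ofList gs).comap (algebraMap A T) := by
    rw [← hout, ← Ideal.map_ofList, Ideal.comap_map_of_surjective' _ hsurj, hker,
      Ideal.ofList_append, sup_comm]
  have hmem : ∀ f ∈ fs ++ hs, f ∈ maximalIdeal A := by
    intro f hf
    rcases List.mem_append.mp hf with hf | hf
    · exact hfs f hf
    · obtain ⟨g, hg, rfl⟩ := List.mem_map.mp hf
      have : algebraMap A T (σ g) ∈ maximalIdeal T := (hσ g).symm ▸ hgs g hg
      rwa [← Ideal.mem_comap, maximalIdeal_comap] at this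
  have hregA : IsWeaklyRegular A (fs ++ hs) := by
    rw [isWeaklyRegular_append_iff]
    refine ⟨hfsreg, ?_⟩
    have hT : IsWeaklyRegular T hs := by
      rwa [← isWeaklyRegular_map_algebraMap_iff T, hout]
    let e : (A ⧸ (Ideal.ofList fs • ⊤ : Submodule A A)) ≃ₗ[A] T :=
      (Submodule.quotEquivOfEq _ (LinearMap.ker (Algebra.linearMap A T))
        (by rw [smul_eq_mul, Ideal.mul_top, ← hker]; rfl)).trans
        (LinearMap.quotKerEquivOfSurjective (Algebra.linearMap A T) hsurj)
    exact (e.isWeaklyRegular_congr hs).mpr hT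
  have hassA : maximalIdeal A ∈ associatedPrimes A (A ⧸ Ideal.ofList (fs ++ hs)) := by
    obtain ⟨-, z, hz⟩ := isAssociatedPrime_iff.mp hass
    obtain ⟨t, rfl⟩ := Ideal.Quotient.mk_surjective z
    obtain ⟨a, rfl⟩ := hsurj t
    refine isAssociatedPrime_iff.mpr ⟨inferInstance, Ideal.Quotient.mk _ a, ?_⟩
    ext r
    rw [← maximalIdeal_comap (algebraMap A T), Ideal.mem_comap, hz,
      Submodule.mem_colon_singleton, Submodule.mem_colon_singleton, Submodule.mem_bot,
      Submodule.mem_bot, Algebra.smul_def, Algebra.smul_def, Ideal.Quotient.algebraMap_eq,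
      Ideal.Quotient.algebraMap_eq, ← map_mul, ← map_mul, ← map_mul,
      Ideal.Quotient.eq_zero_iff_mem, Ideal.Quotient.eq_zero_iff_mem, hcomap, Ideal.mem_comap]
  have hle := IsRegularLocalRing.ringKrullDim_le_length_of_mem_associatedPrimes hmem hregA hassA
  have hdim := ringKrullDim_add_length_eq_ringKrullDim_of_isRegular fs
    (.of_isWeaklyRegular_of_mem_maximalIdeal A hfs hfsreg)
  rw [ringKrullDim_eq_of_ringEquiv ((Ideal.quotEquivOfEq hker.symm).trans
    (RingHom.quotientKerEquivOfSurjective hsurj))] at hdim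
  rw [← hdim, List.length_append, List.length_map, Nat.cast_add, add_comm] at hle
  exact (ENat.WithBot.add_le_add_natCast_left_iff).mp hle

end IsLocalCompleteIntersection

/-- The cotangent space has dimension at most one, so the ring is a principal ideal domain. -/
lemma IsRegularLocalRing.isDomain_and_isIntegrallyClosed_of_ringKrullDim_le_one {T : Type u}
    [CommRing T] [IsRegularLocalRing T] (h : ringKrullDim T ≤ 1) :
    IsDomain T ∧ IsIntegrallyClosed T := by
  have hd := IsRegularLocalRing.isDomain T
  refine ⟨hd, ?_⟩
  have hfin := (IsRegularLocalRing.iff_finrank_cotangentSpace T).mp ‹_›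
  rw [← hfin] at h
  have h1 : Module.finrank (ResidueField T) (CotangentSpace T) ≤ 1 := by exact_mod_cast h
  have : IsPrincipalIdealRing T :=
    ((tfae_of_isNoetherianRing_of_isLocalRing_of_isDomain T).out 5 0).mp h1
  infer_instance

section

variable {T : Type u} [CommRing T] [IsNoetherianRing T]
  (hci : ∀ (P : Ideal T) [P.IsPrime], IsLocalCompleteIntersection (Localization.AtPrime P))

include hci

/-- This supplies the depth conditions in Serre's criterion: the empty sequence serves for
reducedness, a single nonzerodivisor for normality. -/
lemma ringKrullDim_localization_le_of_mem_associatedPrimes {P : Ideal T} [P.IsPrime] {gs : List T}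
    (hreg : IsWeaklyRegular T gs) (hass : P ∈ associatedPrimes T (T ⧸ Ideal.ofList gs)) :
    ringKrullDim (Localization.AtPrime P) ≤ gs.length := by
  have hassP := maximalIdeal_mem_associatedPrimes_quotient_map hass
  rw [Ideal.map_ofList] at hassP
  have hle : Ideal.ofList gs ≤ P := by
    have := IsAssociatedPrime.annihilator_le hass
    rwa [Submodule.annihilator_top, Ideal.annihilator_quotient] at this
  have := (hci P).ringKrullDim_le_length (gs := gs.map (algebraMap T (Localization.AtPrime P))) (by
    intro g hg
    obtain ⟨g, hg', rfl⟩ := List.mem_map.mp hg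
    exact (IsLocalization.AtPrime.to_map_mem_maximal_iff _ P g).mpr (hle (Ideal.subset_span hg')))
    (hreg.of_isLocalization _ P.primeCompl) hassP
  rwa [List.length_map] at this

/-- Serre's criterion for reducedness of complete intersections. -/
theorem isReduced_of_regular_codim_zero
    (hR : ∀ (P : Ideal T) [P.IsPrime], ringKrullDim (Localization.AtPrime P) ≤ 0 →
      IsRegularLocalRing (Localization.AtPrime P)) : _root_.IsReduced T := by
  refine isReduced_of_forall_mem_associatedPrimes fun P _ hP ↦ ?_
  have hP' : P ∈ associatedPrimes T (T ⧸ Ideal.ofList ([] : List T)) := by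
    refine (LinearEquiv.isAssociatedPrime_iff ?_).mp hP
    exact (Submodule.quotEquivOfEqBot _ (by simp)).symm
  have := hR P (by simpa using ringKrullDim_localization_le_of_mem_associatedPrimes hci (.nil T T) hP')
  have := IsRegularLocalRing.isDomain (Localization.AtPrime P)
  infer_instance

/-- Serre's criterion for normality of complete intersections. -/
theorem isDomain_and_isIntegrallyClosed_of_regular_codim_one [IsLocalRing T]
    (hR : ∀ (P : Ideal T) [P.IsPrime], ringKrullDim (Localization.AtPrime P) ≤ 1 →
      IsRegularLocalRing (Localization.AtPrime P)) : IsDomain T ∧ IsIntegrallyClosed T := by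
  have := isReduced_of_regular_codim_zero hci fun P _ h ↦ hR P (h.trans zero_le_one)
  refine isDomain_and_isIntegrallyClosed_of_forall_mem_associatedPrimes fun P _ s hs hP ↦ ?_
  rw [← Ideal.ofList_singleton] at hP
  have h1 : ringKrullDim (Localization.AtPrime P) ≤ 1 := by
    refine (ringKrullDim_localization_le_of_mem_associatedPrimes hci ?_ hP).trans (by simp)
    rw [isWeaklyRegular_singleton_iff]
    exact (isRegular_iff_mem_nonZeroDivisors.mpr hs).left.isSMulRegular
  have := hR P h1
  exact IsRegularLocalRing.isDomain_and_isIntegrallyClosed_of_ringKrullDim_le_one h1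

end

/-- The fibre of a flat morphism of regular rings over a rational point is locally a complete
intersection. -/
lemma isLocalCompleteIntersection_localization {R S T : Type u} [CommRing R] [CommRing S]
    [CommRing T] [Algebra R S] [Algebra S T] [IsRegularRing R] [IsRegularRing S] [Module.Flat R S]
    (𝔪 : Ideal R) [𝔪.IsMaximal] (hsurj : Function.Surjective (algebraMap S T))
    (hker : RingHom.ker (algebraMap S T) = 𝔪.map (algebraMap R S)) (P : Ideal T) [P.IsPrime] :
    IsLocalCompleteIntersection (Localization.AtPrime P) := by
  let q := P.under S
  have hq : 𝔪.map (algebraMap R S) ≤ q := by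
    rw [← hker]
    intro x hx
    rw [Ideal.mem_comap, RingHom.mem_ker.mp hx]
    exact zero_mem P
  have hover : q.LiesOver 𝔪 := ⟨(Ideal.IsMaximal.eq_of_le ‹_› (Ideal.IsPrime.ne_top inferInstance)
    (Ideal.map_le_iff_le_comap.mp hq))⟩
  let B := Localization.AtPrime 𝔪
  let A := Localization.AtPrime q
  let := Localization.AtPrime.algebraOfLiesOver 𝔪 q
  let := Localization.AtPrime.algebraOfLiesOver q P
  have hlocBA : IsLocalHom (algebraMap B A) := by
    rw [Localization.AtPrime.IsLiesOverAlgebra.algebraMap_eq]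
    infer_instance
  obtain ⟨rs, -, hrs, hreg⟩ := IsRegularLocalRing.exists_isWeaklyRegular B
  -- The fibre is cut out of `A` by the parameters of `B`, which form a regular sequence in `A` by
  -- flatness.
  refine ⟨A, inferInstance, inferInstance, inferInstance, rs.map (algebraMap B A), ?_,
    hreg.of_flat, ?_, ?_⟩
  · intro f hf
    obtain ⟨g, hg, rfl⟩ := List.mem_map.mp hf
    have : g ∈ maximalIdeal B := hrs ▸ Ideal.subset_span hg
    rwa [← maximalIdeal_comap (algebraMap B A)] at this
  · rw [Localization.AtPrime.IsLiesOverAlgebra.algebraMap_eq]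
    exact RingHom.surjective_localRingHom_of_surjective (algebraMap S T) hsurj P
  · have hmap : Ideal.ofList (rs.map (algebraMap B A)) =
        (𝔪.map (algebraMap R S)).map (algebraMap S A) := by
      rw [← Ideal.map_ofList, hrs, ← Localization.AtPrime.map_eq_maximalIdeal, Ideal.map_map,
        Ideal.map_map, ← IsScalarTower.algebraMap_eq, ← IsScalarTower.algebraMap_eq]
    rw [hmap]
    ext x
    obtain ⟨a, u, rfl⟩ := IsLocalization.exists_mk'_eq q.primeCompl x
    rw [IsLocalization.mk'_mem_iff, IsLocalization.mk'_mem_iff, RingHom.mem_ker,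
      ← IsScalarTower.algebraMap_apply, IsScalarTower.algebraMap_apply S T,
      IsLocalization.map_eq_zero_iff P.primeCompl,
      IsLocalization.algebraMap_mem_map_algebraMap_iff q.primeCompl, ← hker]
    constructor
    · rintro ⟨⟨v, hv⟩, h⟩
      obtain ⟨v, rfl⟩ := hsurj v
      exact ⟨v, hv, by rw [RingHom.mem_ker, map_mul, h]⟩
    · rintro ⟨v, hv, h⟩
      exact ⟨⟨algebraMap S T v, hv⟩, by rwa [RingHom.mem_ker, map_mul] at h⟩

end CompleteIntersection

/-! ### Base change to a field: codimension, regularity, complete intersections. -/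

section Fibres

open IsLocalRing
open scoped TensorProduct

variable {R S L : Type u} [CommRing R] [CommRing S] [Field L] [Algebra R S] [Algebra R L]

/-- Let `q` be the contraction of `P` to `S`; it lies over `p`, the kernel of `R → L`. Then `height
q ≤ height p + height (q / pS)`. As `L` is flat over `R ⧸ p` through the fraction field, `L ⊗ S` is
flat over `S ⧸ pS`, and going down bounds the last term by `height P`. -/
lemma height_comap_includeRight_le [IsNoetherianRing R] [IsNoetherianRing S]
    [IsNoetherianRing (L ⊗[R] S)] {n : ℕ∞} (hn : ∀ (p : Ideal R) [p.IsPrime], p.height ≤ n)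
    (P : Ideal (L ⊗[R] S)) [P.IsPrime] :
    (P.comap (Algebra.TensorProduct.includeRight : S →ₐ[R] L ⊗[R] S)).height ≤ n + P.height := by
  let q := P.comap (Algebra.TensorProduct.includeRight : S →ₐ[R] L ⊗[R] S)
  let p := q.under R
  have hp : p = RingHom.ker (algebraMap R L) := by
    have hmax : (P.comap (algebraMap L (L ⊗[R] S))) = ⊥ := by
      rw [← le_bot_iff]
      intro x hx
      by_contra h0
      exact Ideal.IsPrime.ne_top ‹_› (Ideal.eq_top_of_isUnit_mem P hx
        ((isUnit_iff_ne_zero.mpr h0).map _))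
    ext x
    rw [RingHom.mem_ker, ← Ideal.mem_bot, ← hmax, Ideal.mem_comap, Ideal.mem_comap, Ideal.mem_comap]
    have : algebraMap L (L ⊗[R] S) (algebraMap R L x) =
      (Algebra.TensorProduct.includeRight : S →ₐ[R] L ⊗[R] S) (algebraMap R S x) := by
      rw [AlgHom.commutes, ← IsScalarTower.algebraMap_apply]
    rw [this]
  have hle : p.map (algebraMap R S) ≤ q := Ideal.map_comap_le
  let κ : R ⧸ p →ₐ[R] L := Ideal.Quotient.liftₐ p (Algebra.ofId R L) fun x hx ↦ by
    rwa [hp] at hx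
  have hκ : κ.Flat := by
    let : Algebra (R ⧸ p) L := κ.toRingHom.toAlgebra
    have hinj : Function.Injective (algebraMap (R ⧸ p) L) := by
      refine (injective_iff_map_eq_zero _).mpr fun x hx ↦ ?_
      obtain ⟨x, rfl⟩ := Ideal.Quotient.mk_surjective x
      rw [Ideal.Quotient.eq_zero_iff_mem, hp]
      exact hx
    have : FaithfulSMul (R ⧸ p) L := (faithfulSMul_iff_algebraMap_injective _ _).mpr hinj
    let : Algebra (FractionRing (R ⧸ p)) L := FractionRing.liftAlgebra (R ⧸ p) L
    have : IsScalarTower (R ⧸ p) (FractionRing (R ⧸ p)) L := inferInstance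
    exact Module.Flat.trans (R ⧸ p) (FractionRing (R ⧸ p)) L
  let D := S ⧸ p.map (algebraMap R S)
  let j : D →+* L ⊗[R] S :=
    ((Algebra.TensorProduct.comm R S L).toRingEquiv.toRingHom.comp
      (Algebra.TensorProduct.lTensor (S := R) S κ).toRingHom).comp
      (Algebra.TensorProduct.quotIdealMapEquivTensorQuot S p).toRingEquiv.toRingHom
  have hj : j.Flat := by
    refine .comp (.of_bijective (AlgEquiv.bijective _)) (.comp ?_ (.of_bijective (AlgEquiv.bijective _)))
    exact RingHom.Flat.lTensor (S := R) S hκ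
  have hjmk : ∀ s : S, j (Ideal.Quotient.mk _ s) =
      (Algebra.TensorProduct.includeRight : S →ₐ[R] L ⊗[R] S) s := by
    intro s
    have h : Algebra.TensorProduct.quotIdealMapEquivTensorQuot S p (Ideal.Quotient.mk _ s) =
        s ⊗ₜ[R] 1 := Algebra.TensorProduct.quotIdealMapEquivTensorQuot_mk S p s
    change Algebra.TensorProduct.comm R S L (Algebra.TensorProduct.lTensor S κ
      (Algebra.TensorProduct.quotIdealMapEquivTensorQuot S p (Ideal.Quotient.mk _ s))) = _
    rw [h]
    simp
  let := j.toAlgebra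
  have : Module.Flat D (L ⊗[R] S) := hj
  have hqD : q.map (Ideal.Quotient.mk (p.map (algebraMap R S))) = P.under D := by
    ext x
    obtain ⟨x, rfl⟩ := Ideal.Quotient.mk_surjective x
    rw [Ideal.mem_quotient_iff_mem hle, Ideal.mem_comap, Ideal.mem_comap]
    change _ ↔ j _ ∈ P
    rw [hjmk]
  have h1 := Ideal.height_le_height_add_of_liesOver p q
  have h2 := Ideal.height_eq_height_add_of_liesOver_of_hasGoingDown (P.under D) P
  refine h1.trans (add_le_add (hn p) ?_)
  rw [hqD, h2]
  exact le_self_add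

lemma isSmoothAt_baseChange [Algebra.FinitePresentation R S] (P : Ideal (L ⊗[R] S)) [P.IsPrime]
    [Algebra.IsSmoothAt R (P.comap (Algebra.TensorProduct.includeRight : S →ₐ[R] L ⊗[R] S))] :
    Algebra.IsSmoothAt L P := by
  obtain ⟨f, hf, hsm⟩ := Algebra.IsSmoothAt.exists_notMem_smooth (R := R)
    (P.comap (Algebra.TensorProduct.includeRight : S →ₐ[R] L ⊗[R] S))
  let Sf := Localization.Away f
  let φ : L ⊗[R] S →ₐ[L] L ⊗[R] Sf :=
    Algebra.TensorProduct.lTensor (S := L) L (IsScalarTower.toAlgHom R S Sf)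
  let := φ.toRingHom.toAlgebra
  have : IsScalarTower L (L ⊗[R] S) (L ⊗[R] Sf) := .of_algebraMap_eq' φ.comp_algebraMap.symm
  have hloc := IsLocalization.tensorProduct_tensorProduct_right R L (.powers f) Sf (by
    ext s
    change φ (1 ⊗ₜ s) = 1 ⊗ₜ algebraMap S Sf s
    simp [φ])
  rw [Submonoid.map_powers] at hloc
  let g : L ⊗[R] S := 1 ⊗ₜ f
  have hloc' : IsLocalization.Away g (L ⊗[R] Sf) := hloc
  have : Algebra.Smooth L (Localization.Away g) :=
    .of_equiv ((IsLocalization.algEquiv (.powers g) (L ⊗[R] Sf) (Localization.Away g)).restrictScalars L)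
  exact Algebra.basicOpen_subset_smoothLocus_iff_smooth.mpr this
    (show (⟨P, ‹_›⟩ : PrimeSpectrum _) ∈ PrimeSpectrum.basicOpen g from hf)

/-- Base changes of a morphism that is smooth in codimension less than `m` are regular in small
codimension. -/
theorem isRegularLocalRing_localization_tensorProduct [IsNoetherianRing R]
    [Algebra.FinitePresentation R S] {n m : ℕ∞} (hn : ∀ (p : Ideal R) [p.IsPrime], p.height ≤ n)
    (H : ∀ (q : Ideal S) [q.IsPrime], q.height < m → Algebra.IsSmoothAt R q)
    (P : Ideal (L ⊗[R] S)) [P.IsPrime] (hP : n + P.height < m) :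
    IsRegularLocalRing (Localization.AtPrime P) := by
  have : IsNoetherianRing S := Algebra.FiniteType.isNoetherianRing R S
  have : IsNoetherianRing (L ⊗[R] S) := Algebra.FiniteType.isNoetherianRing L _
  have := H _ ((height_comap_includeRight_le hn P).trans_lt hP)
  have := isSmoothAt_baseChange P
  exact Algebra.IsSmoothAt.isRegularLocalRing L P

variable (K : Type u) [Field K] [Algebra K R] [Algebra K S] [Algebra K L] [IsScalarTower K R S]
  [IsScalarTower K R L]

/-- Base changes to fields of flat morphisms between smooth algebras are locally complete
intersections. -/
theorem isLocalCompleteIntersection_localization_tensorProduct [Algebra.Smooth K R]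
    [Algebra.Smooth K S] [Module.Flat R S] (P : Ideal (L ⊗[R] S)) [P.IsPrime] :
    IsLocalCompleteIntersection (Localization.AtPrime P) := by
  -- Extending scalars from `K` to `L` makes the `L`-point rational: `R' → L` is surjective with
  -- maximal kernel, while `R'` and `S'` remain regular, being smooth over `L`.
  let R' := R ⊗[K] L
  let S' := R' ⊗[R] S
  have := Algebra.Smooth.isRegularRing L (L ⊗[K] R)
  have := Algebra.Smooth.isRegularRing L (L ⊗[K] S)
  have : IsRegularRing R' := .of_ringEquiv (Algebra.TensorProduct.comm K L R).toRingEquiv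
  have : IsRegularRing S' := .of_ringEquiv ((Algebra.TensorProduct.comm K L S).toRingEquiv.trans
    ((Algebra.TensorProduct.cancelBaseChange K R R S L).symm.toRingEquiv.trans
      (Algebra.TensorProduct.comm R S R').toRingEquiv))
  let f : R' →ₐ[R] L := Algebra.TensorProduct.lift (Algebra.ofId R L) (AlgHom.id K L)
    fun _ _ ↦ Commute.all _ _
  have hf : Function.Surjective f := fun l ↦ ⟨1 ⊗ₜ l, by
    rw [Algebra.TensorProduct.lift_tmul, map_one, _root_.one_mul, AlgHom.id_apply]⟩
  have : (RingHom.ker f).IsMaximal := RingHom.ker_isMaximal_of_surjective f.toRingHom hf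
  let g : S' →ₐ[R] L ⊗[R] S := Algebra.TensorProduct.map f (AlgHom.id R S)
  let := g.toRingHom.toAlgebra
  refine isLocalCompleteIntersection_localization (R := R') (S := S') (RingHom.ker f) ?_ ?_ P
  · exact Algebra.TensorProduct.map_surjective _ _ hf Function.surjective_id
  · exact Algebra.TensorProduct.rTensor_ker f hf

end Fibres

/-! ### From local algebra to schemes through affine charts. -/

section Charts

open IsLocalRing
open scoped TensorProduct

lemma Algebra.IsSmoothAt.flat_localization (R : Type*) {S : Type*} [CommRing R] [CommRing S]
    [Algebra R S] [Algebra.FinitePresentation R S] (q : Ideal S) [q.IsPrime]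
    [Algebra.IsSmoothAt R q] : Module.Flat R (Localization.AtPrime q) := by
  obtain ⟨f, hf, hsm⟩ := Algebra.IsSmoothAt.exists_notMem_smooth (R := R) q
  have hle : Submonoid.powers f ≤ q.primeCompl := by
    rw [Submonoid.powers_le]
    exact hf
  let := IsLocalization.localizationAlgebraOfSubmonoidLe (Localization.Away f)
    (Localization.AtPrime q) (.powers f) q.primeCompl hle
  have := IsLocalization.localization_isScalarTower_of_submonoid_le (Localization.Away f)
    (Localization.AtPrime q) (.powers f) q.primeCompl hle
  have := IsLocalization.isLocalization_of_submonoid_le (Localization.Away f)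
    (Localization.AtPrime q) (.powers f) q.primeCompl hle
  have : Module.Flat (Localization.Away f) (Localization.AtPrime q) :=
    IsLocalization.flat _ (q.primeCompl.map (algebraMap S (Localization.Away f)))
  have : IsScalarTower R (Localization.Away f) (Localization.AtPrime q) :=
    .of_algebraMap_eq' (by
      rw [IsScalarTower.algebraMap_eq R S (Localization.AtPrime q),
        IsScalarTower.algebraMap_eq S (Localization.Away f) (Localization.AtPrime q),
        RingHom.comp_assoc, ← IsScalarTower.algebraMap_eq])
  exact Module.Flat.trans R (Localization.Away f) (Localization.AtPrime q)

namespace AlgebraicGeometry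

lemma exists_preimage_of_isPullback {P X Y Z : Scheme.{u}} {a : P ⟶ X} {b : P ⟶ Y} {f : X ⟶ Z}
    {g : Y ⟶ Z} (h : IsPullback a b f g) (x : X) (y : Y) (hxy : f x = g y) :
    ∃ p : P, a p = x ∧ b p = y := by
  obtain ⟨z, hz1, hz2⟩ := Scheme.Pullback.exists_preimage_pullback x y hxy
  refine ⟨h.isoPullback.inv z, ?_, ?_⟩
  · rw [← Scheme.Hom.comp_apply, h.isoPullback_inv_fst, hz1]
  · rw [← Scheme.Hom.comp_apply, h.isoPullback_inv_snd, hz2]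

/-- The point of the spectrum given by a prime ideal. -/
def specPoint {R : Type u} [CommRing R] (p : Ideal R) [hp : p.IsPrime] : Spec (.of R) :=
  (⟨p, hp⟩ : PrimeSpectrum R)

lemma exists_eq_specPoint {R : Type u} [CommRing R] (x : Spec (.of R)) :
    ∃ (p : Ideal R) (_ : p.IsPrime), x = specPoint p :=
  ⟨PrimeSpectrum.asIdeal x, PrimeSpectrum.isPrime x, rfl⟩

/-- The stalk of a scheme at a point of an affine chart. -/
noncomputable def stalkEquivLocalization {R : Type u} [CommRing R] {X : Scheme.{u}}
    (j : Spec (.of R) ⟶ X) [IsOpenImmersion j] (p : Ideal R) [p.IsPrime] :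
    X.presheaf.stalk (j (specPoint p)) ≃+* Localization.AtPrime p :=
  ((asIso (j.stalkMap (specPoint p))) ≪≫
    Spec.stalkIso (.of R) (specPoint p)).commRingCatIsoToRingEquiv

lemma ringKrullDim_stalk_eq_height {R : Type u} [CommRing R] {X : Scheme.{u}}
    (j : Spec (.of R) ⟶ X) [IsOpenImmersion j] (p : Ideal R) [p.IsPrime] :
    ringKrullDim (X.presheaf.stalk (j (specPoint p))) = p.height := by
  rw [ringKrullDim_eq_of_ringEquiv (stalkEquivLocalization j p),
    IsLocalization.AtPrime.ringKrullDim_eq_height p]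

/-- A property of ring homomorphisms respecting isomorphisms can be tested for stalk maps on
affine charts. -/
lemma stalkMap_iff_localRingHom {Q : ∀ {R S : Type u} [CommRing R] [CommRing S], (R →+* S) → Prop}
    (hQ : RingHom.RespectsIso Q) {X Y : Scheme.{u}} {f : X ⟶ Y} {R S : Type u} [CommRing R]
    [CommRing S] [Algebra R S] {j : Spec (.of R) ⟶ Y} {i : Spec (.of S) ⟶ X} [IsOpenImmersion j]
    [IsOpenImmersion i] (h : i ≫ f = Spec.map (CommRingCat.ofHom (algebraMap R S)) ≫ j)
    (q : Ideal S) [q.IsPrime] :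
    Q (f.stalkMap (i (specPoint q))).hom ↔
      Q (Localization.localRingHom (q.under R) q (algebraMap R S) rfl) := by
  let φ := CommRingCat.ofHom (algebraMap R S)
  let x : Spec (.of S) := specPoint q
  have h1 : Q (f.stalkMap (i x)).hom ↔ Q ((i ≫ f).stalkMap x).hom := by
    rw [Scheme.Hom.stalkMap_comp]
    exact (hQ.cancel_right_isIso _ (i.stalkMap x)).symm
  have h2 : Q ((Spec.map φ ≫ j).stalkMap x).hom ↔ Q ((Spec.map φ).stalkMap x).hom := by
    rw [Scheme.Hom.stalkMap_comp]
    exact hQ.cancel_left_isIso (j.stalkMap (Spec.map φ x)) _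
  have h3 := hQ.arrow_mk_iso_iff (Scheme.arrowStalkMapSpecIso φ x)
  rw [h1, h, h2]
  exact h3

lemma exists_affine_chart {X Y : Scheme.{u}} (f : X ⟶ Y) (x : X) :
    ∃ (R S : CommRingCat.{u}) (φ : R ⟶ S) (j : Spec R ⟶ Y) (i : Spec S ⟶ X),
      IsOpenImmersion j ∧ IsOpenImmersion i ∧ i ≫ f = Spec.map φ ≫ j ∧ x ∈ Set.range i := by
  obtain ⟨_, ⟨U, hU, rfl⟩, hxU, -⟩ :=
    Y.isBasis_affineOpens.exists_subset_of_mem_open (Set.mem_univ (f x)) isOpen_univ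
  obtain ⟨_, ⟨V, hV, rfl⟩, hxV, hVU⟩ :=
    X.isBasis_affineOpens.exists_subset_of_mem_open hxU (U.2.preimage f.continuous)
  refine ⟨_, _, f.appLE U V hVU, hU.fromSpec, hV.fromSpec, hU.isOpenImmersion_fromSpec,
    hV.isOpenImmersion_fromSpec,
    (IsAffineOpen.SpecMap_appLE_fromSpec f hU hV hVU).symm, ?_⟩
  rw [hV.range_fromSpec]
  exact hxV

/-- Charts of a morphism between smooth schemes over a field. -/
lemma exists_smooth_chart {K : Type u} [Field K] {X Y : Scheme.{u}} (f : X ⟶ Y)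
    (g : Y ⟶ Spec (.of K)) [Smooth g] [Smooth (f ≫ g)] (x : X) :
    ∃ (R S : Type u) (_ : CommRing R) (_ : CommRing S) (_ : Algebra R S) (_ : Algebra K R)
      (_ : Algebra K S) (j : Spec (.of R) ⟶ Y) (i : Spec (.of S) ⟶ X),
      IsScalarTower K R S ∧ Algebra.Smooth K R ∧ Algebra.Smooth K S ∧ IsOpenImmersion j ∧
      IsOpenImmersion i ∧ i ≫ f = Spec.map (CommRingCat.ofHom (algebraMap R S)) ≫ j ∧
      x ∈ Set.range i := by
  obtain ⟨R, S, φ, j, i, hj, hi, h, hx⟩ := exists_affine_chart f x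
  obtain ⟨ρ, hρ⟩ := Spec.map_surjective (j ≫ g)
  have hρS : Spec.map (ρ ≫ φ) = i ≫ f ≫ g := by
    rw [Spec.map_comp, hρ, reassoc_of% h]
  have h1 : ρ.hom.Smooth := by
    have : Smooth (Spec.map ρ) := hρ ▸ inferInstance
    exact (HasRingHomProperty.Spec_iff (P := @Smooth)).mp this
  have h2 : (ρ ≫ φ).hom.Smooth := by
    have : Smooth (Spec.map (ρ ≫ φ)) := hρS ▸ inferInstance
    exact (HasRingHomProperty.Spec_iff (P := @Smooth)).mp this
  let := φ.hom.toAlgebra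
  let := ρ.hom.toAlgebra
  let := (ρ ≫ φ).hom.toAlgebra
  exact ⟨R, S, inferInstance, inferInstance, inferInstance, inferInstance, inferInstance, j, i,
    .of_algebraMap_eq' rfl, h1, h2, hj, hi, h, hx⟩

lemma isSmoothAt_of_formallySmooth_stalkMap {X Y : Scheme.{u}} {f : X ⟶ Y} {R S : Type u}
    [CommRing R] [CommRing S] [Algebra R S] {j : Spec (.of R) ⟶ Y} {i : Spec (.of S) ⟶ X}
    [IsOpenImmersion j] [IsOpenImmersion i]
    (h : i ≫ f = Spec.map (CommRingCat.ofHom (algebraMap R S)) ≫ j) (q : Ideal S) [q.IsPrime]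
    (hq : (f.stalkMap (i (specPoint q))).hom.FormallySmooth) : Algebra.IsSmoothAt R q := by
  rw [stalkMap_iff_localRingHom RingHom.FormallySmooth.respectsIso h q] at hq
  let := Localization.AtPrime.algebraOfLiesOver (q.under R) q
  have : Algebra.FormallySmooth (Localization.AtPrime (q.under R)) (Localization.AtPrime q) := hq
  exact Algebra.FormallySmooth.iff_restrictScalars.mpr this

variable {K : Type u} [Field K] {X Y : Scheme.{u}} (f : X ⟶ Y) (g : Y ⟶ Spec (.of K)) [Smooth g]
  [Smooth (f ≫ g)] {m n : ℕ} (hn : ∀ y : Y, ringKrullDim (Y.presheaf.stalk y) ≤ n)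
  (H : ∀ x : X, ringKrullDim (X.presheaf.stalk x) < m → (f.stalkMap x).hom.FormallySmooth)

include H in
omit [Smooth g] [Smooth (f ≫ g)] in
lemma forall_isSmoothAt_of_chart {R S : Type u}
    [CommRing R] [CommRing S] [Algebra R S] {j : Spec (.of R) ⟶ Y} {i : Spec (.of S) ⟶ X}
    [IsOpenImmersion j] [IsOpenImmersion i]
    (h : i ≫ f = Spec.map (CommRingCat.ofHom (algebraMap R S)) ≫ j) (q : Ideal S) [q.IsPrime]
    (hlt : q.height < m) : Algebra.IsSmoothAt R q := by
  refine isSmoothAt_of_formallySmooth_stalkMap h q (H _ ?_)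
  rw [ringKrullDim_stalk_eq_height i]
  exact_mod_cast hlt

include g hn H in
/-- A morphism of smooth schemes that is smooth in codimension less than the dimension of the
target is flat. -/
theorem flat_of_forall_ringKrullDim_lt (hnm : n ≤ m) : Flat f := by
  rw [Flat.iff_flat_stalkMap]
  intro x
  obtain ⟨R, S, _, _, _, _, _, j, i, _, _, _, _, _, h, q, rfl⟩ := exists_smooth_chart f g x
  obtain ⟨q, _, rfl⟩ := exists_eq_specPoint q
  have := Algebra.Smooth.isRegularRing K R
  have := Algebra.Smooth.isRegularRing K S
  have : Algebra.FinitePresentation R S := .of_restrict_scalars_finitePresentation K R S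
  have hflat : Module.Flat R S := by
    refine Module.Flat.of_forall_height_lt (m := m) (fun p hp ↦ ?_) fun q hq hlt ↦ ?_
    · have := hn (j (specPoint p))
      rw [ringKrullDim_stalk_eq_height j] at this
      have h1 : p.height ≤ n := by exact_mod_cast this
      exact h1.trans (by exact_mod_cast hnm)
    · have := forall_isSmoothAt_of_chart f H h q hlt
      exact Algebra.IsSmoothAt.flat_localization R q
  rw [stalkMap_iff_localRingHom RingHom.Flat.respectsIso h q]
  exact RingHom.Flat.localRingHom (RingHom.flat_algebraMap_iff.mpr hflat) _ _ rfl

end AlgebraicGeometry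

lemma isDomain_and_isIntegrallyClosed_localization {T : Type u} [CommRing T] [IsNoetherianRing T]
    (hci : ∀ (P : Ideal T) [P.IsPrime], IsLocalCompleteIntersection (Localization.AtPrime P))
    (hR : ∀ (P : Ideal T) [P.IsPrime], ringKrullDim (Localization.AtPrime P) ≤ 1 →
      IsRegularLocalRing (Localization.AtPrime P)) (P : Ideal T) [P.IsPrime] :
    IsDomain (Localization.AtPrime P) ∧ IsIntegrallyClosed (Localization.AtPrime P) := by
  have he : ∀ (Q : Ideal (Localization.AtPrime P)) [Q.IsPrime],
      Nonempty (Localization.AtPrime (Q.under T) ≃+* Localization.AtPrime Q) := fun Q _ ↦ by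
    have := IsLocalization.isLocalization_isLocalization_atPrime_isLocalization P.primeCompl
      (Localization.AtPrime Q) Q
    exact ⟨(IsLocalization.algEquiv (Q.under T).primeCompl (Localization.AtPrime (Q.under T))
      (Localization.AtPrime Q)).toRingEquiv⟩
  refine isDomain_and_isIntegrallyClosed_of_regular_codim_one (fun Q _ ↦ ?_) fun Q _ hQ ↦ ?_
  · exact (hci (Q.under T)).of_ringEquiv (he Q).some
  · have := hR (Q.under T) (by rwa [ringKrullDim_eq_of_ringEquiv (he Q).some])
    exact .of_ringEquiv (he Q).some

namespace AlgebraicGeometry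

/-- Charts of the base change to a field of a morphism between smooth schemes over a field. -/
lemma exists_chart_of_isPullback {K : Type u} [Field K] {X Y : Scheme.{u}} (f : X ⟶ Y)
    (g : Y ⟶ Spec (.of K)) [Smooth g] [Smooth (f ≫ g)] {L : Type u} [Field L] {Z : Scheme.{u}}
    {a : Z ⟶ X} {b : Z ⟶ Spec (.of L)} {l : Spec (.of L) ⟶ Y} (hZ : IsPullback a b f l) (z : Z) :
    ∃ (R S : Type u) (_ : CommRing R) (_ : CommRing S) (_ : Algebra R S) (_ : Algebra K R)
      (_ : Algebra K S) (j : Spec (.of R) ⟶ Y) (i : Spec (.of S) ⟶ X) (_ : Algebra R L)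
      (_ : Algebra K L) (P : Ideal (L ⊗[R] S)) (_ : P.IsPrime),
      IsScalarTower K R S ∧ Algebra.Smooth K R ∧ Algebra.Smooth K S ∧ IsOpenImmersion j ∧
      IsOpenImmersion i ∧ i ≫ f = Spec.map (CommRingCat.ofHom (algebraMap R S)) ≫ j ∧
      IsScalarTower K R L ∧ Nonempty (Z.presheaf.stalk z ≃+* Localization.AtPrime P) := by
  obtain ⟨R, S, _, _, _, _, _, j, i, hT, hR, hS, _, _, h, s, hs⟩ := exists_smooth_chart f g (a z)
  -- `Spec L` has a single point, so `l` factors through any chart of the target that meets its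
  -- image.
  have hrange : Set.range l ⊆ Set.range j := by
    rintro _ ⟨t, rfl⟩
    have ht : t = b z := Subsingleton.elim _ _
    rw [ht, ← Scheme.Hom.comp_apply, ← hZ.w, Scheme.Hom.comp_apply, ← hs, ← Scheme.Hom.comp_apply,
      h, Scheme.Hom.comp_apply]
    exact ⟨_, rfl⟩
  obtain ⟨ρ, hρ⟩ := Spec.map_surjective (IsOpenImmersion.lift j l hrange)
  have hl : l = Spec.map ρ ≫ j := by rw [hρ, IsOpenImmersion.lift_fac]
  let := ρ.hom.toAlgebra
  let : Algebra K L := (ρ.hom.comp (algebraMap K R)).toAlgebra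
  have : IsScalarTower K R L := .of_algebraMap_eq' rfl
  have hW := isPullback_SpecMap_of_isPushout _ _ _ _ (CommRingCat.isPushout_tensorProduct R L S)
  have hW' : IsPullback (Spec.map (CommRingCat.ofHom
      (Algebra.TensorProduct.includeRight : S →ₐ[R] L ⊗[R] S).toRingHom))
      (Spec.map (CommRingCat.ofHom (Algebra.TensorProduct.includeLeftRingHom : L →+* L ⊗[R] S)))
      (i ≫ f) l := by
    rw [h, hl]
    exact .of_isLimit (Limits.PullbackCone.isLimitOfCompMono _ _ j _ hW.flip.isLimit)
  have hW'' := IsPullback.of_bot' hW' hZ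
  obtain ⟨w, -, hw⟩ := exists_preimage_of_isPullback hW'' s z hs
  have : IsOpenImmersion (hZ.lift _ _ _) := MorphismProperty.of_isPullback hW'' ‹_›
  obtain ⟨P, _, rfl⟩ := exists_eq_specPoint w
  refine ⟨R, S, _, _, _, _, _, j, i, _, _, P, ‹_›, hT, hR, hS, ‹_›, ‹_›, h, ‹_›, ?_⟩
  rw [← hw]
  exact ⟨stalkEquivLocalization _ P⟩

lemma flat_of_chart {X Y : Scheme.{u}} (f : X ⟶ Y) [Flat f] {R S : Type u} [CommRing R]
    [CommRing S] [Algebra R S] {j : Spec (.of R) ⟶ Y} {i : Spec (.of S) ⟶ X} [IsOpenImmersion j]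
    [IsOpenImmersion i] (h : i ≫ f = Spec.map (CommRingCat.ofHom (algebraMap R S)) ≫ j) :
    Module.Flat R S := by
  let φ := Spec.map (CommRingCat.ofHom (algebraMap R S))
  have h1 : Flat (φ ≫ j) := h ▸ inferInstance
  have hpb : IsPullback (𝟙 _) φ (φ ≫ j) (𝟙 _ ≫ j) :=
    .of_isLimit (Limits.PullbackCone.isLimitOfCompMono φ (𝟙 _) j _
      (IsPullback.id_horiz φ).isLimit)
  have h2 : Flat φ := MorphismProperty.of_isPullback hpb h1
  rw [← RingHom.flat_algebraMap_iff]
  exact (HasRingHomProperty.Spec_iff (P := @Flat)).mp h2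

section

variable {K : Type u} [Field K] {X Y : Scheme.{u}} (f : X ⟶ Y) (g : Y ⟶ Spec (.of K)) [Smooth g]
  [Smooth (f ≫ g)] {m n : ℕ} (hn : ∀ y : Y, ringKrullDim (Y.presheaf.stalk y) ≤ n)
  (H : ∀ x : X, ringKrullDim (X.presheaf.stalk x) < m → (f.stalkMap x).hom.FormallySmooth)
  {L : Type u} [Field L] {Z : Scheme.{u}} {a : Z ⟶ X} {b : Z ⟶ Spec (.of L)}
  {l : Spec (.of L) ⟶ Y} (hZ : IsPullback a b f l)

include hn H in
omit [Smooth g] [Smooth (f ≫ g)] in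
lemma isRegularLocalRing_of_chart {R S : Type u} [CommRing R] [CommRing S] [Algebra R S]
    [IsNoetherianRing R] [Algebra.FinitePresentation R S] [Algebra R L]
    {j : Spec (.of R) ⟶ Y} {i : Spec (.of S) ⟶ X} [IsOpenImmersion j] [IsOpenImmersion i]
    (h : i ≫ f = Spec.map (CommRingCat.ofHom (algebraMap R S)) ≫ j) {k : ℕ} (hk : n + k < m)
    (P : Ideal (L ⊗[R] S)) [P.IsPrime] (hP : ringKrullDim (Localization.AtPrime P) ≤ k) :
    IsRegularLocalRing (Localization.AtPrime P) := by
  refine isRegularLocalRing_localization_tensorProduct (n := n) (m := m) (fun p _ ↦ ?_)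
    (fun q _ hlt ↦ forall_isSmoothAt_of_chart f H h q hlt) P ?_
  · have := hn (j (specPoint p))
    rw [ringKrullDim_stalk_eq_height j] at this
    exact_mod_cast this
  · rw [IsLocalization.AtPrime.ringKrullDim_eq_height P] at hP
    have hP' : P.height ≤ k := by exact_mod_cast hP
    exact (add_le_add_right hP' _).trans_lt (by exact_mod_cast hk)

include g hn H hZ

theorem isRegularInCodim_of_isPullback {k : ℕ} (hk : n + k < m) : AlgConv.IsRegularInCodim Z k := by
  intro z hz
  obtain ⟨R, S, _, _, _, _, _, j, i, _, _, P, _, _, _, _, _, _, h, _, ⟨e⟩⟩ :=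
    exists_chart_of_isPullback f g hZ z
  have : IsNoetherianRing R := Algebra.FiniteType.isNoetherianRing K R
  have : Algebra.FinitePresentation R S := .of_restrict_scalars_finitePresentation K R S
  rw [ringKrullDim_eq_of_ringEquiv e] at hz
  have := isRegularLocalRing_of_chart f hn H h hk P hz
  exact .of_ringEquiv e.symm

variable [Flat f]

theorem isReduced_of_isPullback (hk : n < m) : IsReduced Z := by
  have (z : Z) : _root_.IsReduced (Z.presheaf.stalk z) := by
    obtain ⟨R, S, _, _, _, _, _, j, i, _, _, P, _, _, _, _, _, _, h, _, ⟨e⟩⟩ :=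
      exists_chart_of_isPullback f g hZ z
    have : IsNoetherianRing R := Algebra.FiniteType.isNoetherianRing K R
    have : Algebra.FinitePresentation R S := .of_restrict_scalars_finitePresentation K R S
    have : IsNoetherianRing (L ⊗[R] S) := Algebra.FiniteType.isNoetherianRing L _
    have := flat_of_chart f h
    have : _root_.IsReduced (L ⊗[R] S) := isReduced_of_regular_codim_zero
      (fun P _ ↦ isLocalCompleteIntersection_localization_tensorProduct K P)
      fun P _ hP ↦ isRegularLocalRing_of_chart f hn H h (k := 0) hk P (by simpa using hP)
    have : _root_.IsReduced (Localization.AtPrime P) := inferInstance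
    exact isReduced_of_injective e e.injective
  exact isReduced_of_isReduced_stalk Z

theorem isNormalScheme_of_isPullback (hk : n + 1 < m) : AlgConv.IsNormalScheme Z := by
  intro z
  obtain ⟨R, S, _, _, _, _, _, j, i, _, _, P, _, _, _, _, _, _, h, _, ⟨e⟩⟩ :=
    exists_chart_of_isPullback f g hZ z
  have : IsNoetherianRing R := Algebra.FiniteType.isNoetherianRing K R
  have : Algebra.FinitePresentation R S := .of_restrict_scalars_finitePresentation K R S
  have : IsNoetherianRing (L ⊗[R] S) := Algebra.FiniteType.isNoetherianRing L _
  have := flat_of_chart f h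
  obtain ⟨h1, h2⟩ := isDomain_and_isIntegrallyClosed_localization
    (fun P _ ↦ isLocalCompleteIntersection_localization_tensorProduct K P)
    (fun P _ hP ↦ isRegularLocalRing_of_chart f hn H h (k := 1) hk P (by simpa using hP)) P
  exact ⟨e.toMulEquiv.isDomain _, .of_equiv e.symm⟩

end

end AlgebraicGeometry

end Charts

/-! ### Pointwise smoothness, and smoothness of reduced group schemes over perfect fields. -/

namespace AlgebraicGeometry

theorem formallySmooth_stalkMap_of_smooth {X Y : Scheme.{u}} (f : X ⟶ Y) [Smooth f] (x : X) :
    (f.stalkMap x).hom.FormallySmooth := by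
  have : x ∈ f.smoothLocus := by rw [f.smoothLocus_eq_top]; trivial
  exact this

theorem formallySmooth_stalkMap_comp {X Y Z : Scheme.{u}} (f : X ⟶ Y) (g : Y ⟶ Z) (x : X)
    (hg : (g.stalkMap (f x)).hom.FormallySmooth) (hf : (f.stalkMap x).hom.FormallySmooth) :
    ((f ≫ g).stalkMap x).hom.FormallySmooth := by
  rw [Scheme.Hom.stalkMap_comp]
  exact RingHom.FormallySmooth.comp hg hf

theorem smooth_ι_smoothLocus_comp {X Y : Scheme.{u}} (f : X ⟶ Y) [LocallyOfFinitePresentation f] :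
    Smooth (f.smoothLocus.ι ≫ f) := by
  rw [← Scheme.Hom.smoothLocus_eq_top_iff, ← Scheme.Hom.preimage_smoothLocus_eq]
  simp

theorem formallySmooth_stalkMap_of_isPullback {X Y Z W : Scheme.{u}} {a : Z ⟶ X} {b : Z ⟶ W}
    {f : X ⟶ Y} {g : W ⟶ Y} [LocallyOfFinitePresentation f] (h : IsPullback a b f g) (z : Z)
    (hz : (f.stalkMap (a z)).hom.FormallySmooth) : (b.stalkMap z).hom.FormallySmooth := by
  have hb : LocallyOfFinitePresentation b := MorphismProperty.of_isPullback h ‹_›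
  have hs := smooth_ι_smoothLocus_comp f
  have hp := (isPullback_morphismRestrict a f.smoothLocus).flip.paste_horiz h.flip
  have hs' : Smooth ((a ⁻¹ᵁ f.smoothLocus).ι ≫ b) := MorphismProperty.of_isPullback hp.flip hs
  rw [← Scheme.Hom.smoothLocus_eq_top_iff, ← Scheme.Hom.preimage_smoothLocus_eq] at hs'
  have : (⟨z, hz⟩ : (a ⁻¹ᵁ f.smoothLocus : Z.Opens)) ∈ (a ⁻¹ᵁ f.smoothLocus).ι ⁻¹ᵁ b.smoothLocus := by
    rw [hs']; trivial
  exact this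

/-- Closed points are rational here, so a translation carries any closed point to a smooth one. A
nonempty non-smooth locus, being closed, would contain a closed point. -/
theorem smooth_of_grpObj_of_nonempty_smoothLocus {K : Type u} [Field K] [IsAlgClosed K]
    {G : Scheme.{u}} (f : G ⟶ Spec (.of K)) [LocallyOfFinitePresentation f] [GrpObj (Over.mk f)]
    (hne : (f.smoothLocus : Set G).Nonempty) : Smooth f := by
  have := LocallyOfFiniteType.jacobsonSpace f
  rw [← Scheme.Hom.smoothLocus_eq_top_iff, ← TopologicalSpace.Opens.coe_eq_univ,
    ← not_ne_iff, ← Set.nonempty_compl]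
  intro H
  obtain ⟨x, hx, hxc⟩ :=
    nonempty_inter_closedPoints H f.smoothLocus.2.isClosed_compl.isLocallyClosed
  obtain ⟨y, hy, hyc⟩ := nonempty_inter_closedPoints hne f.smoothLocus.2.isLocallyClosed
  let x' : 𝟙_ _ ⟶ Over.mk f := Over.homMk _ ((pointEquivClosedPoint f).symm ⟨x, hxc⟩).2
  let y' : 𝟙_ _ ⟶ Over.mk f := Over.homMk _ ((pointEquivClosedPoint f).symm ⟨y, hyc⟩).2
  let α := (GrpObj.mulRight (A := Over.mk f) x').symm ≪≫
    (GrpObj.mulRight (A := Over.mk f) y')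
  have hα : x' ≫ α.hom = y' := by
    dsimp only [Iso.trans_hom, Iso.symm_hom, α]
    rw [← Category.assoc, ← Iso.eq_comp_inv]
    simp [comp_lift_assoc]
  have hα' : α.hom.left x = y := by
    have h1 : x'.left (IsLocalRing.closedPoint K) = x := pointOfClosedPoint_apply f x hxc _
    have h2 : y'.left (IsLocalRing.closedPoint K) = y := pointOfClosedPoint_apply f y hyc _
    have h3 := congr(($hα).left (IsLocalRing.closedPoint K))
    rw [h2] at h3
    rw [← h3, ← h1]
    rfl
  have hw : α.hom.left ≫ f = f := Over.w α.hom
  apply hx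
  change (f.stalkMap x).hom.FormallySmooth
  have : ((α.hom.left ≫ f).stalkMap x).hom.FormallySmooth := by
    refine formallySmooth_stalkMap_comp _ _ _ ?_ ?_
    · rw [hα']; exact hy
    · have : IsIso α.hom.left := inferInstanceAs (IsIso ((Over.forget _).map α.hom))
      exact formallySmooth_stalkMap_of_smooth _ _
  rwa [hw] at this

/-- Over a perfect field a reduced scheme has a dense smooth locus; translation applies over the
algebraic closure, and smoothness descends. -/
theorem smooth_of_grpObj_of_isReduced {K : Type u} [Field K] [PerfectField K]
    {G : Scheme.{u}} (f : G ⟶ Spec (.of K)) [LocallyOfFiniteType f] [GrpObj (Over.mk f)]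
    [IsReduced G] : Smooth f := by
  have hf : LocallyOfFinitePresentation f :=
    LocallyOfFinitePresentation.iff_locallyOfFiniteType.mpr ‹_›
  let Ω : Type u := AlgebraicClosure K
  let g : Spec (.of Ω) ⟶ Spec (.of K) := Spec.map (CommRingCat.ofHom <| algebraMap K Ω)
  apply MorphismProperty.of_pullback_snd_of_descendsAlong
    (Q := @Surjective ⊓ @Flat ⊓ @QuasiCompact) (g := g)
  · exact ⟨⟨inferInstance, inferInstance⟩, inferInstance⟩
  · let : GrpObj (Over.mk (Limits.pullback.snd f g)) := Over.grpObjMkPullbackSnd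
    have : Nonempty G := ⟨η[Over.mk f].1 (IsLocalRing.closedPoint _)⟩
    have h := f.dense_smoothLocus_of_perfectField
    obtain ⟨x, hx⟩ := h.nonempty
    have hpb := IsPullback.of_hasPullback f g
    obtain ⟨z, rfl⟩ := (Limits.pullback.fst f g).surjective x
    exact smooth_of_grpObj_of_nonempty_smoothLocus _
      ⟨z, formallySmooth_stalkMap_of_isPullback hpb z hx⟩

end AlgebraicGeometry

/-! ### Smoothness of one factor passes to the convolution. -/

namespace AlgConv

variable {K : Type u} [Field K] {G X Y : Over (Spec (.of K))}

theorem isPullback_fst_snd (X Y : Over (Spec (.of K))) :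
    IsPullback (fst X Y).left (snd X Y).left X.hom Y.hom :=
  IsPullback.of_hasPullback _ _

theorem isPullback_comp_fst_snd {Z : Over (Spec (.of K))} (e : Z ⟶ X ⊗ Y) (_ : IsIso e) :
    IsPullback (e ≫ fst X Y).left (e ≫ snd X Y).left X.hom Y.hom := by
  refine IsPullback.of_iso (isPullback_fst_snd X Y) ((Over.forget _).mapIso (asIso e)).symm
    (Iso.refl _) (Iso.refl _) (Iso.refl _) ?_ ?_ ?_ ?_
  · exact (Category.comp_id _).trans
      congr(($(show fst X Y = inv e ≫ e ≫ fst X Y by simp)).left)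
  · exact (Category.comp_id _).trans
      congr(($(show snd X Y = inv e ≫ e ≫ snd X Y by simp)).left)
  · simp
  · simp

theorem isPullback_whiskerRight_left (φ : X ⟶ G) (Y : Over (Spec (.of K))) :
    IsPullback (fst X Y).left (φ ▷ Y).left φ.left (fst G Y).left := by
  refine IsPullback.of_bot (v₂₁ := (snd G Y).left) (v₂₂ := G.hom) (h₃₁ := Y.hom) ?_ ?_
    (isPullback_fst_snd G Y)
  · rw [Over.w φ, ← Over.comp_left, whiskerRight_snd]
    exact isPullback_fst_snd X Y
  · rw [← Over.comp_left, ← Over.comp_left, whiskerRight_fst]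

theorem isPullback_whiskerLeft_left (Y : Over (Spec (.of K))) (φ : X ⟶ G) :
    IsPullback (snd Y X).left (Y ◁ φ).left φ.left (snd Y G).left := by
  refine IsPullback.of_bot (v₂₁ := (fst Y G).left) (v₂₂ := G.hom) (h₃₁ := Y.hom) ?_ ?_
    (isPullback_fst_snd Y G).flip
  · rw [Over.w φ, ← Over.comp_left, whiskerLeft_fst]
    exact (isPullback_fst_snd Y X).flip
  · rw [← Over.comp_left, ← Over.comp_left, whiskerLeft_snd]

variable [GrpObj G]

/-- The square expressing that `(x, g) ↦ φ x * g` and `(x, g) ↦ x` identify `X × G` with the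
product of `G` and `X`. -/
theorem isPullback_whiskerRight_mul (φ : X ⟶ G) :
    IsPullback (φ ▷ G ≫ μ[G]).left (fst X G).left G.hom X.hom := by
  have hm : φ ▷ G ≫ μ[G] = (fst X G ≫ φ) * snd X G := by
    rw [Hom.mul_def]; congr 1
  let e : X ⊗ G ≅ G ⊗ X :=
    { hom := lift ((fst X G ≫ φ) * snd X G) (fst X G)
      inv := lift (snd G X) ((snd G X ≫ φ)⁻¹ * fst G X)
      hom_inv_id := by ext1 <;> simp [MonObj.comp_mul, GrpObj.comp_inv]
      inv_hom_id := by ext1 <;> simp [MonObj.comp_mul] }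
  have := isPullback_comp_fst_snd e.hom e.isIso_hom
  rwa [lift_fst, lift_snd, ← hm] at this

/-- The square expressing that `(g, y) ↦ g * ψ y` and `(g, y) ↦ y` identify `G × Y` with the
product of `G` and `Y`. -/
theorem isPullback_whiskerLeft_mul (ψ : Y ⟶ G) :
    IsPullback (G ◁ ψ ≫ μ[G]).left (snd G Y).left G.hom Y.hom := by
  have hm : G ◁ ψ ≫ μ[G] = fst G Y * (snd G Y ≫ ψ) := by
    rw [Hom.mul_def]; congr 1
  let e : G ⊗ Y ≅ G ⊗ Y :=
    { hom := lift (fst G Y * (snd G Y ≫ ψ)) (snd G Y)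
      inv := lift (fst G Y * (snd G Y ≫ ψ)⁻¹) (snd G Y)
      hom_inv_id := by ext1 <;> simp [MonObj.comp_mul, GrpObj.comp_inv]
      inv_hom_id := by ext1 <;> simp [MonObj.comp_mul] }
  have := isPullback_comp_fst_snd e.hom e.isIso_hom
  rwa [lift_fst, lift_snd, ← hm] at this

theorem locallyOfFinitePresentation_left (φ : X ⟶ Y) [LocallyOfFiniteType X.hom]
    [LocallyOfFiniteType Y.hom] : LocallyOfFinitePresentation φ.left := by
  have : LocallyOfFiniteType (φ.left ≫ Y.hom) := by rw [Over.w φ]; assumption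
  have := LocallyOfFiniteType.isLocallyNoetherian Y.hom
  exact LocallyOfFinitePresentation.iff_locallyOfFiniteType.mpr
    (locallyOfFiniteType_of_comp φ.left Y.hom)

variable [LocallyOfFiniteType G.hom] (φ : X ⟶ G) (ψ : Y ⟶ G)

/-- Factor the convolution as `φ × id` followed by `(g, y) ↦ g * ψ y`. The second map is a base
change of `Y` over `K`, hence smooth whatever `ψ` is. -/
theorem formallySmooth_stalkMap_conv_of_fst [Smooth Y.hom] [LocallyOfFiniteType X.hom]
    (z : (X ⊗ Y).left) (hz : (φ.left.stalkMap ((fst X Y).left z)).hom.FormallySmooth) :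
    ((conv φ ψ).left.stalkMap z).hom.FormallySmooth := by
  have h : conv φ ψ = φ ▷ Y ≫ (G ◁ ψ ≫ μ[G]) := by
    rw [conv, MonoidalCategory.tensorHom_def, Category.assoc]
  have := locallyOfFinitePresentation_left φ
  rw [h, Over.comp_left]
  refine formallySmooth_stalkMap_comp _ _ _ ?_
    (formallySmooth_stalkMap_of_isPullback (isPullback_whiskerRight_left φ Y) z hz)
  have : Smooth (G ◁ ψ ≫ μ[G]).left :=
    MorphismProperty.of_isPullback (isPullback_whiskerLeft_mul ψ).flip ‹_›
  exact formallySmooth_stalkMap_of_smooth _ _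

theorem formallySmooth_stalkMap_conv_of_snd [Smooth X.hom] [LocallyOfFiniteType Y.hom]
    (z : (X ⊗ Y).left) (hz : (ψ.left.stalkMap ((snd X Y).left z)).hom.FormallySmooth) :
    ((conv φ ψ).left.stalkMap z).hom.FormallySmooth := by
  have h : conv φ ψ = X ◁ ψ ≫ (φ ▷ G ≫ μ[G]) := by
    rw [conv, MonoidalCategory.tensorHom_def', Category.assoc]
  have := locallyOfFinitePresentation_left ψ
  rw [h, Over.comp_left]
  refine formallySmooth_stalkMap_comp _ _ _ ?_
    (formallySmooth_stalkMap_of_isPullback (isPullback_whiskerLeft_left X ψ) z hz)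
  have : Smooth (φ ▷ G ≫ μ[G]).left :=
    MorphismProperty.of_isPullback (isPullback_whiskerRight_mul φ).flip ‹_›
  exact formallySmooth_stalkMap_of_smooth _ _

end AlgConv

/-! ### Heights of primes in tensor products over a field. -/

open scoped TensorProduct

section HeightTensorProduct

/-- Here `T'` is the fibre ring `T / pT`; heights add along a flat map by going down. -/
theorem Ideal.height_comap_eq_add_of_flat {A T T' : Type*} [CommRing A] [CommRing T] [CommRing T']
    [IsNoetherianRing A] [IsNoetherianRing T] {f : A →+* T} (hf : f.Flat) {π : T →+* T'}
    (hπ : Function.Surjective π) (p : Ideal A) [p.IsPrime] (hker : RingHom.ker π = p.map f)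
    (Q : Ideal T') [Q.IsPrime] (hp : (Q.comap π).comap f = p) :
    (Q.comap π).height = p.height + Q.height := by
  let := f.toAlgebra
  have : Module.Flat A T := hf
  have : (Q.comap π).LiesOver p := ⟨hp.symm⟩
  rw [Ideal.height_eq_height_add_of_liesOver_of_hasGoingDown p (Q.comap π)]
  congr 1
  let e : T ⧸ p.map (algebraMap A T) ≃+* T' :=
    (Ideal.quotEquivOfEq hker.symm).trans (RingHom.quotientKerEquivOfSurjective hπ)
  rw [← RingEquiv.height_comap e Q]
  congr 1
  have hle : p.map (algebraMap A T) ≤ Q.comap π := by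
    rw [RingHom.algebraMap_toAlgebra, ← hker]
    exact Ideal.comap_mono bot_le
  ext x
  obtain ⟨x, rfl⟩ := Ideal.Quotient.mk_surjective x
  rw [Ideal.mem_quotient_iff_mem hle]
  rfl

theorem RingHom.Flat.height_comap_le {D T : Type*} [CommRing D] [CommRing T] [IsNoetherianRing D]
    [IsNoetherianRing T] {f : D →+* T} (hf : f.Flat) (Q : Ideal T) [Q.IsPrime] :
    (Q.comap f).height ≤ Q.height := by
  let := f.toAlgebra
  have : Module.Flat D T := hf
  rw [Ideal.height_eq_height_add_of_liesOver_of_hasGoingDown (Q.under D) Q]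
  exact le_self_add

/-- Flat maps preserve nonzerodivisors, and a minimal prime contains none. -/
theorem RingHom.Flat.comap_eq_bot_of_mem_minimalPrimes {D T : Type*} [CommRing D] [IsDomain D]
    [CommRing T] {f : D →+* T} (hf : f.Flat) {Q : Ideal T} (hQ : Q ∈ minimalPrimes T) :
    Q.comap f = ⊥ := by
  let := f.toAlgebra
  have : Module.Flat D T := hf
  rw [eq_bot_iff]
  intro x hx
  by_contra h0
  refine Set.disjoint_left.mp (Ideal.disjoint_nonZeroDivisors_of_mem_minimalPrimes hQ) hx ?_
  have hreg : IsSMulRegular T (algebraMap D T x) :=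
    IsSMulRegular.of_flat (IsSMulRegular.of_ne_zero h0)
  exact mem_nonZeroDivisors_iff_right.mpr fun t ht ↦
    hreg (by
      change f x • t = f x • 0
      rw [smul_zero, smul_eq_mul, _root_.mul_comm]
      exact ht)

variable {K A B : Type*} [Field K] [CommRing A] [CommRing B] [Algebra K A] [Algebra K B]

theorem Algebra.TensorProduct.flat_includeLeft :
    (Algebra.TensorProduct.includeLeftRingHom : A →+* A ⊗[K] B).Flat :=
  RingHom.flat_algebraMap_iff.mpr (inferInstance : Module.Flat A (A ⊗[K] B))

theorem Algebra.TensorProduct.flat_includeRight :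
    (Algebra.TensorProduct.includeRight : B →ₐ[K] A ⊗[K] B).toRingHom.Flat := by
  have h := RingHom.Flat.comp (flat_includeLeft (K := K) (A := B) (B := A))
    (.of_bijective (Algebra.TensorProduct.comm K B A).toRingEquiv.bijective)
  exact h

theorem Algebra.TensorProduct.surjective_map_quotientMk_id (p : Ideal A) :
    Function.Surjective (Algebra.TensorProduct.map (Ideal.Quotient.mkₐ K p)
      (AlgHom.id K B)).toRingHom :=
  _root_.TensorProduct.map_surjective (Ideal.Quotient.mkₐ_surjective K p) Function.surjective_id

theorem Algebra.TensorProduct.ker_map_quotientMk_id (p : Ideal A) :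
    RingHom.ker (Algebra.TensorProduct.map (Ideal.Quotient.mkₐ K p) (AlgHom.id K B)).toRingHom =
      p.map (Algebra.TensorProduct.includeLeftRingHom : A →+* A ⊗[K] B) := by
  have hp : RingHom.ker (Ideal.Quotient.mkₐ K p) = p := Ideal.mk_ker
  refine (Algebra.TensorProduct.rTensor_ker (S := K) (C := B) _
    (Ideal.Quotient.mkₐ_surjective K p)).trans ?_
  rw [hp]
  rfl

theorem Algebra.TensorProduct.surjective_map_id_quotientMk (q : Ideal B) :
    Function.Surjective (Algebra.TensorProduct.map (AlgHom.id K A)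
      (Ideal.Quotient.mkₐ K q)).toRingHom :=
  _root_.TensorProduct.map_surjective Function.surjective_id (Ideal.Quotient.mkₐ_surjective K q)

theorem Algebra.TensorProduct.ker_map_id_quotientMk (q : Ideal B) :
    RingHom.ker (Algebra.TensorProduct.map (AlgHom.id K A) (Ideal.Quotient.mkₐ K q)).toRingHom =
      q.map (Algebra.TensorProduct.includeRight : B →ₐ[K] A ⊗[K] B).toRingHom := by
  have hq : RingHom.ker (Ideal.Quotient.mkₐ K q) = q := Ideal.mk_ker
  refine (Algebra.TensorProduct.lTensor_ker (A := A) _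
    (Ideal.Quotient.mkₐ_surjective K q)).trans ?_
  rw [hq]
  rfl

variable [Algebra.FiniteType K A] [Algebra.FiniteType K B]

/-- With `p` the contraction to `A`, flatness over `A` gives `height P = height p + height Q`, where
`Q` is the image of `P` in `(A ⧸ p) ⊗ B`. This ring is flat over `B`, so `Q` is at least as high as
its contraction there. -/
theorem Ideal.height_comap_add_height_comap_le (P : Ideal (A ⊗[K] B)) [P.IsPrime] :
    (P.comap (Algebra.TensorProduct.includeLeftRingHom : A →+* A ⊗[K] B)).height +
      (P.comap (Algebra.TensorProduct.includeRight : B →ₐ[K] A ⊗[K] B)).height ≤ P.height := by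
  set p := P.comap (Algebra.TensorProduct.includeLeftRingHom : A →+* A ⊗[K] B)
  have : IsNoetherianRing A := Algebra.FiniteType.isNoetherianRing K A
  have : IsNoetherianRing B := Algebra.FiniteType.isNoetherianRing K B
  have : IsNoetherianRing (A ⊗[K] B) := Algebra.FiniteType.isNoetherianRing A _
  have : IsNoetherianRing ((A ⧸ p) ⊗[K] B) := Algebra.FiniteType.isNoetherianRing (A ⧸ p) _
  let π := (Algebra.TensorProduct.map (Ideal.Quotient.mkₐ K p) (AlgHom.id K B)).toRingHom
  have hπ : Function.Surjective π := Algebra.TensorProduct.surjective_map_quotientMk_id p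
  have hker : RingHom.ker π = _ := Algebra.TensorProduct.ker_map_quotientMk_id p
  have hle : RingHom.ker π ≤ P := by
    rw [hker]; exact Ideal.map_comap_le
  let Q := P.map π
  have hQ : Q.IsPrime := Ideal.map_isPrime_of_surjective hπ hle
  have hQP : Q.comap π = P := (Ideal.comap_map_of_surjective π hπ P).trans (sup_eq_left.mpr hle)
  have h1 := Ideal.height_comap_eq_add_of_flat Algebra.TensorProduct.flat_includeLeft hπ p hker Q
    (by rw [hQP])
  rw [hQP] at h1
  rw [h1]
  refine add_le_add le_rfl ?_
  refine le_trans (le_of_eq ?_) ((Algebra.TensorProduct.flat_includeRight (K := K) (A := A ⧸ p)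
    (B := B)).height_comap_le Q)
  congr 1
  conv_lhs => rw [← hQP]
  ext x
  simp [π]

/-- Take a minimal prime of `(A ⧸ p) ⊗ (B ⧸ q)`. By flatness it contracts to zero on both sides, and
pulling it back in two steps adds the heights of `q` and `p`. -/
theorem Ideal.exists_isPrime_height_le_add (p : Ideal A) [p.IsPrime] (q : Ideal B) [q.IsPrime] :
    ∃ (P : Ideal (A ⊗[K] B)) (_ : P.IsPrime),
      P.comap (Algebra.TensorProduct.includeLeftRingHom : A →+* A ⊗[K] B) = p ∧
      P.comap (Algebra.TensorProduct.includeRight : B →ₐ[K] A ⊗[K] B) = q ∧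
      P.height ≤ p.height + q.height := by
  have : IsNoetherianRing A := Algebra.FiniteType.isNoetherianRing K A
  have : IsNoetherianRing B := Algebra.FiniteType.isNoetherianRing K B
  have : IsNoetherianRing (A ⊗[K] B) := Algebra.FiniteType.isNoetherianRing A _
  have : IsNoetherianRing ((A ⧸ p) ⊗[K] B) := Algebra.FiniteType.isNoetherianRing (A ⧸ p) _
  let π := (Algebra.TensorProduct.map (Ideal.Quotient.mkₐ K p) (AlgHom.id K B)).toRingHom
  let ρ := (Algebra.TensorProduct.map (AlgHom.id K (A ⧸ p)) (Ideal.Quotient.mkₐ K q)).toRingHom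
  obtain ⟨Q, hQm⟩ := Ideal.nonempty_minimalPrimes
    (bot_ne_top : (⊥ : Ideal ((A ⧸ p) ⊗[K] (B ⧸ q))) ≠ ⊤)
  have hQ : Q.IsPrime := hQm.1.1
  have hl := (Algebra.TensorProduct.flat_includeLeft (K := K) (A := A ⧸ p)
    (B := B ⧸ q)).comap_eq_bot_of_mem_minimalPrimes hQm
  have hr := (Algebra.TensorProduct.flat_includeRight (K := K) (A := A ⧸ p)
    (B := B ⧸ q)).comap_eq_bot_of_mem_minimalPrimes hQm
  let P₁ := Q.comap ρ
  let P := P₁.comap π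
  have hPl : P.comap (Algebra.TensorProduct.includeLeftRingHom : A →+* A ⊗[K] B) = p := by
    conv_rhs => rw [← Ideal.mk_ker (I := p), RingHom.ker, ← hl, Ideal.comap_comap]
    ext x
    simp [P, P₁, π, ρ]
  have hP₁r : P₁.comap (Algebra.TensorProduct.includeRight :
      B →ₐ[K] (A ⧸ p) ⊗[K] B).toRingHom = q := by
    conv_rhs => rw [← Ideal.mk_ker (I := q), RingHom.ker, ← hr, Ideal.comap_comap]
    ext x
    simp [P₁, ρ]
  refine ⟨P, inferInstance, hPl, ?_, ?_⟩
  · rw [← hP₁r]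
    ext x
    simp [P, π]
  · have h1 := Ideal.height_comap_eq_add_of_flat Algebra.TensorProduct.flat_includeLeft
      (Algebra.TensorProduct.surjective_map_quotientMk_id p) p
      (Algebra.TensorProduct.ker_map_quotientMk_id p) P₁ hPl
    have h2 := Ideal.height_comap_eq_add_of_flat Algebra.TensorProduct.flat_includeRight
      (Algebra.TensorProduct.surjective_map_id_quotientMk q) q
      (Algebra.TensorProduct.ker_map_id_quotientMk q) Q hP₁r
    rw [Ideal.height_eq_zero_iff.mpr hQm, add_zero] at h2
    exact (h1.trans congr(p.height + $h2)).le

end HeightTensorProduct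

/-! ### Codimension of points in products of schemes. -/

namespace AlgConv

variable {K : Type u} [Field K]

theorem exists_affine_chart_of_locallyOfFiniteType {X : Scheme.{u}} (f : X ⟶ Spec (.of K))
    [LocallyOfFiniteType f] (x : X) :
    ∃ (A : Type u) (_ : CommRing A) (_ : Algebra K A) (a : Spec (.of A) ⟶ X),
      Algebra.FiniteType K A ∧ IsOpenImmersion a ∧ x ∈ Set.range a ∧
      a ≫ f = Spec.map (CommRingCat.ofHom (algebraMap K A)) := by
  obtain ⟨A, a, ha, hxa, -⟩ := Scheme.exists_affine_mem_range_and_range_subset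
    (show x ∈ (⊤ : X.Opens) from trivial)
  obtain ⟨ρ, hρ⟩ := Spec.map_surjective (a ≫ f)
  have h1 : ρ.hom.FiniteType := by
    have : LocallyOfFiniteType (Spec.map ρ) := hρ ▸ inferInstance
    exact (HasRingHomProperty.Spec_iff (P := @LocallyOfFiniteType)).mp this
  let := ρ.hom.toAlgebra
  exact ⟨A, inferInstance, inferInstance, a, h1, ha, hxa, hρ.symm⟩

theorem exists_chart_tensorObj {X Y : Over (Spec (.of K))} {A B : Type u} [CommRing A] [CommRing B]
    [Algebra K A] [Algebra K B] (a : Spec (.of A) ⟶ X.left) (b : Spec (.of B) ⟶ Y.left)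
    [IsOpenImmersion a] [IsOpenImmersion b]
    (ha : a ≫ X.hom = Spec.map (CommRingCat.ofHom (algebraMap K A)))
    (hb : b ≫ Y.hom = Spec.map (CommRingCat.ofHom (algebraMap K B))) :
    ∃ c : Spec (.of (A ⊗[K] B)) ⟶ (X ⊗ Y).left, IsOpenImmersion c ∧
      c ≫ (fst X Y).left = Spec.map (CommRingCat.ofHom
        (Algebra.TensorProduct.includeLeftRingHom : A →+* A ⊗[K] B)) ≫ a ∧
      c ≫ (snd X Y).left = Spec.map (CommRingCat.ofHom
        (Algebra.TensorProduct.includeRight : B →ₐ[K] A ⊗[K] B).toRingHom) ≫ b ∧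
      Set.range c = (fst X Y).left ⁻¹' Set.range a ∩ (snd X Y).left ⁻¹' Set.range b := by
  have hW := isPullback_SpecMap_of_isPushout _ _ _ _ (CommRingCat.isPushout_tensorProduct K A B)
  let m := Limits.pullback.map _ _ X.hom Y.hom a b (𝟙 _) ((Category.comp_id _).trans ha.symm)
    ((Category.comp_id _).trans hb.symm)
  have hm1 : m ≫ Limits.pullback.fst X.hom Y.hom = Limits.pullback.fst _ _ ≫ a :=
    Limits.pullback.lift_fst _ _ _
  have hm2 : m ≫ Limits.pullback.snd X.hom Y.hom = Limits.pullback.snd _ _ ≫ b :=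
    Limits.pullback.lift_snd _ _ _
  refine ⟨hW.isoPullback.hom ≫ m, inferInstance, ?_, ?_, ?_⟩
  · rw [Over.fst_left, Category.assoc, hm1, hW.isoPullback_hom_fst_assoc]
  · rw [Over.snd_left, Category.assoc, hm2, hW.isoPullback_hom_snd_assoc]
  · have := Scheme.Pullback.range_map _ _ X.hom Y.hom a b (𝟙 _)
      ((Category.comp_id _).trans ha.symm) ((Category.comp_id _).trans hb.symm)
    exact (hW.isoPullback.hom.surjective.range_comp m).trans this

theorem ringKrullDim_stalk_add_le {X Y : Over (Spec (.of K))} [LocallyOfFiniteType X.hom]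
    [LocallyOfFiniteType Y.hom] (z : (X ⊗ Y).left) :
    ringKrullDim (X.left.presheaf.stalk ((fst X Y).left z)) +
      ringKrullDim (Y.left.presheaf.stalk ((snd X Y).left z)) ≤
      ringKrullDim ((X ⊗ Y).left.presheaf.stalk z) := by
  obtain ⟨A, _, _, a, _, _, hxa, ha⟩ := exists_affine_chart_of_locallyOfFiniteType X.hom
    ((fst X Y).left z)
  obtain ⟨B, _, _, b, _, _, hyb, hb⟩ := exists_affine_chart_of_locallyOfFiniteType Y.hom
    ((snd X Y).left z)
  obtain ⟨c, hc, hc1, hc2, hr⟩ := exists_chart_tensorObj a b ha hb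
  obtain ⟨t, rfl⟩ : z ∈ Set.range c := by rw [hr]; exact ⟨hxa, hyb⟩
  obtain ⟨P, _, rfl⟩ := exists_eq_specPoint t
  have h1 : (fst X Y).left (c (specPoint P)) = a (specPoint (P.comap
      (Algebra.TensorProduct.includeLeftRingHom : A →+* A ⊗[K] B))) :=
    congr($hc1 (specPoint P))
  have h2 : (snd X Y).left (c (specPoint P)) = b (specPoint (P.comap
      (Algebra.TensorProduct.includeRight : B →ₐ[K] A ⊗[K] B))) :=
    congr($hc2 (specPoint P))
  rw [h1, h2, ringKrullDim_stalk_eq_height, ringKrullDim_stalk_eq_height,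
    ringKrullDim_stalk_eq_height]
  exact_mod_cast P.height_comap_add_height_comap_le

theorem exists_ringKrullDim_stalk_le_add {X Y : Over (Spec (.of K))} [LocallyOfFiniteType X.hom]
    [LocallyOfFiniteType Y.hom] (x : X.left) (y : Y.left) :
    ∃ z : (X ⊗ Y).left, (fst X Y).left z = x ∧ (snd X Y).left z = y ∧
      ringKrullDim ((X ⊗ Y).left.presheaf.stalk z) ≤
        ringKrullDim (X.left.presheaf.stalk x) + ringKrullDim (Y.left.presheaf.stalk y) := by
  obtain ⟨A, _, _, a, _, _, ⟨p, rfl⟩, ha⟩ := exists_affine_chart_of_locallyOfFiniteType X.hom x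
  obtain ⟨B, _, _, b, _, _, ⟨q, rfl⟩, hb⟩ := exists_affine_chart_of_locallyOfFiniteType Y.hom y
  obtain ⟨c, hc, hc1, hc2, -⟩ := exists_chart_tensorObj a b ha hb
  obtain ⟨p, _, rfl⟩ := exists_eq_specPoint p
  obtain ⟨q, _, rfl⟩ := exists_eq_specPoint q
  obtain ⟨P, _, rfl, rfl, hP⟩ := Ideal.exists_isPrime_height_le_add (K := K) p q
  refine ⟨c (specPoint P), congr($hc1 (specPoint P)), congr($hc2 (specPoint P)), ?_⟩
  rw [ringKrullDim_stalk_eq_height, ringKrullDim_stalk_eq_height, ringKrullDim_stalk_eq_height]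
  exact_mod_cast hP

end AlgConv

/-! ### Generic smoothness and the codimension estimate for convolutions. -/

namespace AlgConv

variable {K : Type u} [Field K] {X Y G : Over (Spec (.of K))}

theorem ringKrullDim_stalk_le_topologicalKrullDim {X : Scheme.{u}} (x : X) :
    ringKrullDim (X.presheaf.stalk x) ≤ topologicalKrullDim X := by
  obtain ⟨R, j, hj, ⟨p, rfl⟩, -⟩ := Scheme.exists_affine_mem_range_and_range_subset
    (show x ∈ (⊤ : X.Opens) from trivial)
  obtain ⟨p, _, rfl⟩ := exists_eq_specPoint p
  rw [ringKrullDim_stalk_eq_height]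
  have h1 : topologicalKrullDim (Spec (.of R)) = ringKrullDim R :=
    PrimeSpectrum.topologicalKrullDim_eq_ringKrullDim R
  exact (Ideal.height_le_ringKrullDim_of_ne_top (Ideal.IsPrime.ne_top ‹_›)).trans
    (h1 ▸ j.isOpenEmbedding.isInducing.topologicalKrullDim_le)

theorem eq_of_specializes_of_ringKrullDim_stalk_eq_zero {X : Scheme.{u}} {x y : X} (h : y ⤳ x)
    (hx : ringKrullDim (X.presheaf.stalk x) = 0) : y = x := by
  rw [ringKrullDim_stalk_eq_coheight] at hx
  have hmax : IsMax x := Order.coheight_eq_zero.mp (by exact_mod_cast hx)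
  exact (h.antisymm (hmax h)).eq

/-- The projection `X_K̄ ⟶ X`. -/
noncomputable def closureFst (X : Over (Spec (.of K))) :
    ((Over.pullback (specClosure K)).obj X).left ⟶ X.left :=
  Limits.pullback.fst X.hom (specClosure K)

theorem isPullback_closureFst (X : Over (Spec (.of K))) :
    IsPullback (closureFst X) ((Over.pullback (specClosure K)).obj X).hom X.hom (specClosure K) :=
  IsPullback.of_hasPullback _ _

instance (X : Over (Spec (.of K))) : Surjective (closureFst X) := by
  have : Surjective (specClosure K) := inferInstanceAs (Surjective (Spec.map _))
  exact MorphismProperty.of_isPullback (isPullback_closureFst X).flip this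

theorem map_left_closureFst (φ : X ⟶ Y) :
    ((Over.pullback (specClosure K)).map φ).left ≫ closureFst Y = closureFst X ≫ φ.left :=
  Limits.pullback.lift_fst _ _ _

/-- Choose `ξ` as the generic point of a component over the algebraic closure through a lift of `x`.
When `x` has codimension zero, its specialization to `x` is an equality. -/
theorem StronglyDominant.exists_closure_eq_univ {φ : X ⟶ G} (hφ : StronglyDominant φ) (x : X.left) :
    ∃ ξ : ((Over.pullback (specClosure K)).obj X).left, closureFst X ξ ⤳ x ∧
      closure {((Over.pullback (specClosure K)).map φ).left ξ} = Set.univ := by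
  obtain ⟨x', rfl⟩ := (closureFst X).surjective x
  have hZ := irreducibleComponent_mem_irreducibleComponents x'
  have hξ := isIrreducible_irreducibleComponent.isGenericPoint_genericPoint
    (isClosed_irreducibleComponent (x := x'))
  refine ⟨_, (hξ.specializes mem_irreducibleComponent).map (closureFst X).continuous, ?_⟩
  have h := hφ _ hZ
  rw [← dense_iff_closure_eq, ← dense_closure]
  refine h.mono ?_
  conv_lhs => rw [← hξ.def]
  rw [← Set.image_singleton]
  exact image_closure_subset_closure_image
    ((Over.pullback (specClosure K)).map φ).left.continuous

theorem StronglyDominant.irreducibleSpace {φ : X ⟶ G} (hφ : StronglyDominant φ) [Nonempty X.left] :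
    IrreducibleSpace ((Over.pullback (specClosure K)).obj G).left := by
  obtain ⟨ξ, -, hξ⟩ := hφ.exists_closure_eq_univ (Classical.arbitrary X.left)
  rw [irreducibleSpace_def, Set.top_eq_univ, ← hξ]
  exact isIrreducible_singleton.closure

theorem StronglyDominant.closure_apply_eq_univ {φ : X ⟶ G} (hφ : StronglyDominant φ) {x : X.left}
    (hx : ringKrullDim (X.left.presheaf.stalk x) = 0) : closure {φ.left x} = Set.univ := by
  obtain ⟨ξ, hξx, hξ⟩ := hφ.exists_closure_eq_univ x
  have h1 := eq_of_specializes_of_ringKrullDim_stalk_eq_zero hξx hx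
  have h2 : closureFst G (((Over.pullback (specClosure K)).map φ).left ξ) = φ.left x := by
    rw [← h1]
    exact congr($(map_left_closureFst φ) ξ)
  rw [← dense_iff_closure_eq] at hξ ⊢
  rw [← h2, ← Set.image_singleton]
  exact (closureFst G).surjective.denseRange.dense_image (closureFst G).continuous hξ

/-- Both stalks are fields: `x` is generic on a reduced scheme, and so is its image by dominance. In
characteristic 0 the lower field is perfect. -/
theorem StronglyDominant.formallySmooth_stalkMap [CharZero K] {φ : X ⟶ G}
    (hφ : StronglyDominant φ) [IsReduced X.left] [IsReduced G.left] [LocallyOfFiniteType X.hom]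
    {x : X.left} (hx : ringKrullDim (X.left.presheaf.stalk x) = 0) :
    (φ.left.stalkMap x).hom.FormallySmooth := by
  have : LocallyOfFiniteType (φ.left ≫ G.hom) := by rw [Over.w φ]; assumption
  have : LocallyOfFiniteType φ.left := locallyOfFiniteType_of_comp φ.left G.hom
  have h1 : IsField (G.left.presheaf.stalk (φ.left x)) :=
    isField_stalk_of_closure_mem_irreducibleComponents _ _ (by
      have h := hφ.closure_apply_eq_univ hx
      have : IrreducibleSpace G.left := by
        rw [irreducibleSpace_def, Set.top_eq_univ, ← h]
        exact isIrreducible_singleton.closure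
      rw [h, irreducibleComponents_eq_singleton]
      rfl)
  have h2 : IsField (X.left.presheaf.stalk x) := by
    have : Ring.KrullDimLE 0 (X.left.presheaf.stalk x) :=
      Ring.krullDimLE_iff.mpr (by rw [hx]; rfl)
    exact Ring.KrullDimLE.isField_of_isReduced
  have hft := LocallyOfFiniteType.stalkMap φ.left x
  let F := G.left.presheaf.stalk (φ.left x)
  let r : K →+* F := (G.left.presheaf.germ ⊤ (φ.left x) trivial).hom.comp
    ((G.hom.appTop).hom.comp (Scheme.ΓSpecIso (.of K)).inv.hom)
  have : Nontrivial F := h1.nontrivial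
  have : CharZero F := charZero_of_injective_ringHom r.injective
  algebraize [(φ.left.stalkMap x).hom]
  let := h1.toField
  let := h2.toField
  exact Algebra.FormallySmooth.of_perfectField

variable [GrpObj G]

theorem locallyOfFiniteType_prodFam {m : ℕ} (X : Fin m → Over (Spec (.of K)))
    (hX : ∀ i, LocallyOfFiniteType (X i).hom) : LocallyOfFiniteType (prodFam m X).hom := by
  induction m with
  | zero => exact inferInstanceAs (LocallyOfFiniteType (𝟙 _))
  | succ m ih =>
    have h0 := hX 0
    have := ih (fun i ↦ X i.succ) fun i ↦ hX _
    exact inferInstanceAs (LocallyOfFiniteType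
      (Limits.pullback.fst (X 0).hom (prodFam m fun i ↦ X i.succ).hom ≫ (X 0).hom))

theorem smooth_prodFam {m : ℕ} (X : Fin m → Over (Spec (.of K)))
    (hX : ∀ i, Smooth (X i).hom) : Smooth (prodFam m X).hom := by
  induction m with
  | zero => exact inferInstanceAs (Smooth (𝟙 _))
  | succ m ih =>
    have h0 := hX 0
    have := ih (fun i ↦ X i.succ) fun i ↦ hX _
    exact inferInstanceAs (Smooth
      (Limits.pullback.fst (X 0).hom (prodFam m fun i ↦ X i.succ).hom ≫ (X 0).hom))

/-- A convolution of `m` strongly dominant morphisms is smooth at all points of codimension less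
than `m`. -/
theorem formallySmooth_stalkMap_convFam [CharZero K] [LocallyOfFiniteType G.hom] [IsReduced G.left]
    {m : ℕ} {X : Fin m → Over (Spec (.of K))} (φ : (i : Fin m) → (X i ⟶ G))
    (hX : ∀ i, IsSmoothVariety (X i)) (hφ : ∀ i, StronglyDominant (φ i))
    (z : (prodFam m X).left)
    (hz : ringKrullDim ((prodFam m X).left.presheaf.stalk z) < m) :
    ((convFam m φ).left.stalkMap z).hom.FormallySmooth := by
  induction m with
  | zero =>
    exact absurd hz (not_lt.mpr (by simpa using ringKrullDim_nonneg_of_nontrivial))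
  | succ m ih =>
    let Y := prodFam m (fun i ↦ X i.succ)
    have h0 := (hX 0).smooth
    have h0' := (hX 0).isReduced
    have : Smooth Y.hom := smooth_prodFam _ fun i ↦ (hX i.succ).smooth
    have hadd := (ringKrullDim_stalk_add_le (X := X 0) (Y := Y) z).trans_lt hz
    -- Either the first projection is generic, or it uses up at least one codimension and leaves
    -- fewer than `m` for the remaining `m` factors.
    by_cases hx : ringKrullDim ((X 0).left.presheaf.stalk ((fst (X 0) Y).left z)) = 0
    · exact formallySmooth_stalkMap_conv_of_fst (φ 0) _ z ((hφ 0).formallySmooth_stalkMap hx)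
    · refine formallySmooth_stalkMap_conv_of_snd (φ 0) _ z
        (ih (fun i ↦ φ i.succ) (fun i ↦ hX _) (fun i ↦ hφ _) _ ?_)
      rw [ringKrullDim_stalk_eq_coheight] at hx ⊢
      rw [ringKrullDim_stalk_eq_coheight, ringKrullDim_stalk_eq_coheight] at hadd
      norm_cast at hadd hx ⊢
      have h2 := (add_le_add_left (Order.one_le_iff_ne_zero.mpr hx) _).trans_lt hadd
      rw [_root_.add_comm, Nat.cast_add, Nat.cast_one] at h2
      exact lt_of_add_lt_add_right h2

end AlgConv

/-! ### Surjectivity of the convolution of two morphisms. -/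

namespace AlgConv

variable {K : Type u} [Field K] {X Y G : Over (Spec (.of K))}

theorem exists_geometric_point [LocallyOfFiniteType G.hom] {g : G.left} (hg : IsClosed {g}) :
    ∃ l : Spec (.of (AlgebraicClosure K)) ⟶ G.left, l ≫ G.hom = specClosure K ∧ ∀ t, l t = g := by
  let G' := (Over.pullback (specClosure K)).obj G
  have : LocallyOfFiniteType G'.hom := MorphismProperty.of_isPullback (isPullback_closureFst G) ‹_›
  have := LocallyOfFiniteType.jacobsonSpace G'.hom
  obtain ⟨g', hg', hc⟩ := nonempty_inter_closedPoints
    ((Set.singleton_nonempty g).preimage (closureFst G).surjective)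
    (hg.preimage (closureFst G).continuous).isLocallyClosed
  replace hc : IsClosed {g'} := hc
  refine ⟨pointOfClosedPoint G'.hom g' hc ≫ closureFst G, ?_, fun t ↦ ?_⟩
  · rw [Category.assoc, (isPullback_closureFst G).w, ← Category.assoc]
    exact (congr($(pointOfClosedPoint_comp G'.hom g' hc) ≫ specClosure K)).trans (Category.id_comp _)
  · rw [Scheme.Hom.comp_apply, pointOfClosedPoint_apply]
    exact hg'

variable [GrpObj G]

/-- Over a geometric point above `g`, each projection identifies the fibre of multiplication with
`G` over the algebraic closure. This is irreducible, so the preimages of `U` and `V` meet. -/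
theorem exists_mul_eq_of_isOpen [LocallyOfFiniteType G.hom]
    [IrreducibleSpace ((Over.pullback (specClosure K)).obj G).left] {U V : Set G.left}
    (hU : IsOpen U) (hV : IsOpen V) (hU' : U.Nonempty) (hV' : V.Nonempty) {g : G.left}
    (hg : IsClosed {g}) :
    ∃ t : (G ⊗ G).left, (fst G G).left t ∈ U ∧ (snd G G).left t ∈ V ∧ μ[G].left t = g := by
  obtain ⟨l, hl, hlg⟩ := exists_geometric_point hg
  have hF := IsPullback.of_hasPullback μ[G].left l
  have hs : Surjective (specClosure K) := inferInstanceAs (Surjective (Spec.map _))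
  have h1 := (isPullback_whiskerRight_mul (𝟙 G)).flip
  have h2 := (isPullback_whiskerLeft_mul (𝟙 G)).flip
  rw [id_whiskerRight, Category.id_comp] at h1
  rw [whiskerLeft_id, Category.id_comp] at h2
  have hF1 := hF.paste_horiz h1
  have hF2 := hF.paste_horiz h2
  rw [hl] at hF1 hF2
  let F := Limits.pullback μ[G].left l
  let a : F ⟶ (G ⊗ G).left := Limits.pullback.fst μ[G].left l
  have hs1 : Surjective (a ≫ (fst G G).left) := MorphismProperty.of_isPullback hF1.flip hs
  have hs2 : Surjective (a ≫ (snd G G).left) := MorphismProperty.of_isPullback hF2.flip hs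
  let e := hF1.isoIsPullback _ _ (isPullback_closureFst G)
  have : IrreducibleSpace F := e.hom.homeomorph.irreducibleSpace_iff.mpr ‹_›
  obtain ⟨w, hwU, hwV⟩ := nonempty_preirreducible_inter
    (hU.preimage (a ≫ (fst G G).left).continuous) (hV.preimage (a ≫ (snd G G).left).continuous)
    (hU'.preimage (a ≫ (fst G G).left).surjective) (hV'.preimage (a ≫ (snd G G).left).surjective)
  exact ⟨a w, hwU, hwV, congr($hF.w w).trans (hlg _)⟩

theorem exists_ringKrullDim_stalk_eq_zero (X : Scheme.{u}) [IsReduced X] [Nonempty X] :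
    ∃ x : X, ringKrullDim (X.presheaf.stalk x) = 0 := by
  let x := Classical.arbitrary X
  have hξ := isIrreducible_irreducibleComponent.isGenericPoint_genericPoint
    (isClosed_irreducibleComponent (x := x))
  exact ⟨_, ringKrullDim_eq_zero_of_isField
    (isField_stalk_of_closure_mem_irreducibleComponents X _
      (hξ.def ▸ irreducibleComponent_mem_irreducibleComponents x))⟩

theorem isOpen_image_smoothLocus {X Y : Scheme.{u}} (f : X ⟶ Y) [LocallyOfFinitePresentation f] :
    IsOpen (f '' (f.smoothLocus : Set X)) := by
  have := smooth_ι_smoothLocus_comp f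
  have h := (f.smoothLocus.ι ≫ f).isOpenMap.isOpen_range
  rwa [show Set.range (f.smoothLocus.ι ≫ f) = f '' Set.range f.smoothLocus.ι from
    Set.range_comp f f.smoothLocus.ι, Scheme.Opens.range_ι] at h

/-- Already the smooth locus of the convolution surjects. Its image is open, so a missing point
could be taken closed, and closed points are handled by `exists_mul_eq_of_isOpen`. -/
theorem surjective_conv [CharZero K] [LocallyOfFiniteType G.hom] [IsReduced G.left]
    {φ : X ⟶ G} {ψ : Y ⟶ G} (hX : IsSmoothVariety X) (hY : IsSmoothVariety Y)
    (hφ : StronglyDominant φ) (hψ : StronglyDominant ψ) : Surjective (conv φ ψ).left := by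
  have := hX.smooth
  have := hY.smooth
  have := hX.isReduced
  have := hY.isReduced
  have := hX.nonempty
  have := hY.nonempty
  have := locallyOfFinitePresentation_left φ
  have := locallyOfFinitePresentation_left ψ
  have hXY : LocallyOfFiniteType (X ⊗ Y).hom := inferInstanceAs
    (LocallyOfFiniteType (Limits.pullback.fst X.hom Y.hom ≫ X.hom))
  have := locallyOfFinitePresentation_left (conv φ ψ)
  have := hφ.irreducibleSpace
  have := LocallyOfFiniteType.jacobsonSpace G.hom
  obtain ⟨x₀, hx₀⟩ := exists_ringKrullDim_stalk_eq_zero X.left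
  obtain ⟨y₀, hy₀⟩ := exists_ringKrullDim_stalk_eq_zero Y.left
  have key : (conv φ ψ).left '' ((conv φ ψ).left.smoothLocus : Set (X ⊗ Y).left) = Set.univ := by
    rw [← Set.compl_empty_iff, ← Set.not_nonempty_iff_eq_empty]
    intro hne
    obtain ⟨g, hg, hgc⟩ := nonempty_inter_closedPoints hne
      (isOpen_image_smoothLocus (conv φ ψ).left).isClosed_compl.isLocallyClosed
    obtain ⟨t, ⟨x, hx, hxt⟩, ⟨y, hy, hyt⟩, ht⟩ := exists_mul_eq_of_isOpen
      (isOpen_image_smoothLocus φ.left) (isOpen_image_smoothLocus ψ.left)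
      ⟨_, x₀, hφ.formallySmooth_stalkMap hx₀, rfl⟩ ⟨_, y₀, hψ.formallySmooth_stalkMap hy₀, rfl⟩ hgc
    -- The point `t` of `G × G` lifts to `X × Y` one coordinate at a time, keeping the first
    -- projection in the smooth locus of `φ`.
    obtain ⟨z₁, rfl, rfl⟩ := exists_preimage_of_isPullback (isPullback_whiskerRight_left φ G) x t hxt
    have hz₁ : (snd G G).left ((φ ▷ G).left z₁) = (snd X G).left z₁ :=
      congr(($(show φ ▷ G ≫ snd G G = snd X G by simp)).left z₁)
    rw [hz₁] at hyt
    obtain ⟨z, rfl, rfl⟩ := exists_preimage_of_isPullback (isPullback_whiskerLeft_left X ψ) y z₁ hyt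
    have hz : (fst X G).left ((X ◁ ψ).left z) = (fst X Y).left z :=
      congr(($(show X ◁ ψ ≫ fst X G = fst X Y by simp)).left z)
    rw [hz] at hx
    refine hg ⟨z, formallySmooth_stalkMap_conv_of_fst φ ψ z hx, ?_⟩
    rw [← ht, conv, MonoidalCategory.tensorHom_def']
    rfl
  refine ⟨fun g ↦ ?_⟩
  obtain ⟨z, -, hz⟩ : g ∈ _ '' _ := key ▸ Set.mem_univ g
  exact ⟨z, hz⟩

end AlgConv

/-! ### Flatness of convolutions and the geometry of their fibres. -/

namespace AlgConv

variable {K : Type u} [Field K] [CharZero K] {G : Over (Spec (.of K))} [GrpObj G]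

theorem IsConnectedAlgebraicGroup.smooth (hG : IsConnectedAlgebraicGroup G) : Smooth G.hom := by
  have := hG.isReduced
  have := hG.locallyOfFiniteType
  have : GrpObj (Over.mk G.hom) := ‹GrpObj G›
  exact smooth_of_grpObj_of_isReduced G.hom

theorem exists_topologicalKrullDim_eq {X : Scheme.{u}} [Nonempty X] {m : ℕ}
    (h : topologicalKrullDim X ≤ m) : ∃ n : ℕ, topologicalKrullDim X = n := by
  have h0 : 0 ≤ topologicalKrullDim X :=
    have : Nonempty (TopologicalSpace.IrreducibleCloseds X) :=
      ⟨⟨closure {Classical.arbitrary X}, isIrreducible_singleton.closure, isClosed_closure⟩⟩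
    Order.krullDim_nonneg
  generalize topologicalKrullDim X = d at h h0
  induction d with
  | bot => simp at h0
  | coe d =>
    induction d with
    | top => exact absurd h (by exact_mod_cast (ENat.natCast_lt_top m).not_ge)
    | coe d => exact ⟨d, rfl⟩

variable {m : ℕ} {X : Fin m → Over (Spec (.of K))} {φ : (i : Fin m) → (X i ⟶ G)}
  (hX : ∀ i, IsSmoothVariety (X i)) (hG : IsConnectedAlgebraicGroup G)
  (hφ : ∀ i, StronglyDominant (φ i)) {n : ℕ} (hn : topologicalKrullDim G.left ≤ n)

include hX hG hφ hn

theorem flat_convFam (hnm : n ≤ m) : Flat (convFam m φ).left := by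
  have := hG.smooth
  have := hG.isReduced
  have hs := smooth_prodFam X fun i ↦ (hX i).smooth
  rw [← Over.w (convFam m φ)] at hs
  exact flat_of_forall_ringKrullDim_lt _ G.hom
    (fun y ↦ (ringKrullDim_stalk_le_topologicalKrullDim y).trans hn)
    (formallySmooth_stalkMap_convFam φ hX hφ) hnm

variable {L : Type u} [Field L] {Z : Scheme.{u}} {a : Z ⟶ (prodFam m X).left}
  {b : Z ⟶ Spec (.of L)} {l : Spec (.of L) ⟶ G.left} (hZ : IsPullback a b (convFam m φ).left l)

include hZ

theorem isReduced_of_isPullback_convFam (hnm : n < m) : IsReduced Z := by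
  have := hG.smooth
  have := hG.isReduced
  have := flat_convFam hX hG hφ hn hnm.le
  have hs := smooth_prodFam X fun i ↦ (hX i).smooth
  rw [← Over.w (convFam m φ)] at hs
  exact isReduced_of_isPullback _ G.hom
    (fun y ↦ (ringKrullDim_stalk_le_topologicalKrullDim y).trans hn)
    (formallySmooth_stalkMap_convFam φ hX hφ) hZ hnm

theorem isNormalScheme_of_isPullback_convFam (hnm : n + 1 < m) : IsNormalScheme Z := by
  have := hG.smooth
  have := hG.isReduced
  have := flat_convFam hX hG hφ hn (by lia)
  have hs := smooth_prodFam X fun i ↦ (hX i).smooth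
  rw [← Over.w (convFam m φ)] at hs
  exact isNormalScheme_of_isPullback _ G.hom
    (fun y ↦ (ringKrullDim_stalk_le_topologicalKrullDim y).trans hn)
    (formallySmooth_stalkMap_convFam φ hX hφ) hZ hnm

theorem isRegularInCodim_of_isPullback_convFam {k : ℕ} (hnm : n + k < m) :
    IsRegularInCodim Z k := by
  have := hG.smooth
  have := hG.isReduced
  have hs := smooth_prodFam X fun i ↦ (hX i).smooth
  rw [← Over.w (convFam m φ)] at hs
  exact isRegularInCodim_of_isPullback _ G.hom
    (fun y ↦ (ringKrullDim_stalk_le_topologicalKrullDim y).trans hn)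
    (formallySmooth_stalkMap_convFam φ hX hφ) hZ hnm

omit hZ

/-- Geometric normality concerns base changes to all fields over the residue fields, whence the
arbitrary field-valued point `l` in the preceding theorems. -/
theorem isNormalMorphism_convFam (hnm : n + 1 < m) : IsNormalMorphism (convFam m φ).left :=
  ⟨flat_convFam hX hG hφ hn (by lia), geometrically_iff_forall_fiberToSpecResidueField.mp
    fun _ _ _ _ _ _ hZ ↦ isNormalScheme_of_isPullback_convFam hX hG hφ hn hZ hnm⟩

end AlgConv

/-! ### A dimension obstruction to regularity of fibres. -/

section FlatLocal

open IsLocalRing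

variable {A B C : Type u} [CommRing A] [CommRing B] [CommRing C] [IsLocalRing A] [IsLocalRing B]
  [IsNoetherianRing A]

/-- The dimension formula for flat local maps, with `C` a quotient of the closed fibre. -/
theorem RingHom.Flat.ringKrullDim_add_le [IsLocalRing C] [IsNoetherianRing B] {f : B →+* A}
    [IsLocalHom f] (hf : f.Flat) {π : A →+* C} (hπ : Function.Surjective π)
    (hπf : ∀ b ∈ maximalIdeal B, π (f b) = 0) :
    ringKrullDim B + ringKrullDim C ≤ ringKrullDim A := by
  let := f.toAlgebra
  have : Module.Flat B A := hf
  have : (maximalIdeal A).LiesOver (maximalIdeal B) := 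
    ⟨(((local_hom_TFAE f).out 0 4).mp ‹IsLocalHom f› :
      (maximalIdeal A).comap f = maximalIdeal B).symm⟩
  let I := (maximalIdeal B).map (algebraMap B A)
  have hI : I ≤ RingHom.ker π := Ideal.map_le_iff_le_comap.mpr fun b hb ↦ hπf b hb
  have hI' : I ≠ ⊤ := fun h ↦ RingHom.ker_ne_top π (top_le_iff.mp (h ▸ hI))
  have : Nontrivial (A ⧸ I) := Ideal.Quotient.nontrivial_iff.mpr hI'
  have : IsLocalRing (A ⧸ I) := .of_surjective' _ Ideal.Quotient.mk_surjective
  have hC : ringKrullDim C ≤ ringKrullDim (A ⧸ I) :=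
    ringKrullDim_le_of_surjective (Ideal.Quotient.lift I π hI)
      (Ideal.Quotient.lift_surjective_of_surjective I hI hπ)
  have hmap : (maximalIdeal A).map (Ideal.Quotient.mk I) = maximalIdeal (A ⧸ I) :=
    IsLocalRing.map_maximalIdeal_of_surjective _ Ideal.Quotient.mk_surjective
  have h := Ideal.height_eq_height_add_of_liesOver_of_hasGoingDown (maximalIdeal B) (maximalIdeal A)
  rw [← maximalIdeal_height_eq_ringKrullDim (R := A), h, WithBot.coe_add]
  refine add_le_add maximalIdeal_height_eq_ringKrullDim.ge (hC.trans ?_)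
  rw [← maximalIdeal_height_eq_ringKrullDim, ← hmap]

/-- Killing elements of the square of the maximal ideal does not change the embedding dimension.
That of `C` is its dimension, and that of `A` bounds `dim A`. -/
theorem ringKrullDim_le_of_ker_le_sq [IsRegularLocalRing C] {π : A →+* C}
    (hπ : Function.Surjective π) (hker : RingHom.ker π ≤ maximalIdeal A ^ 2) :
    ringKrullDim A ≤ ringKrullDim C := by
  obtain ⟨d, v, hv, hd⟩ := IsRegularLocalRing.exists_fin_generators C
  choose w hw using fun i ↦ hπ (v i)
  let J := Ideal.span (Set.range w)
  have : IsLocalHom π := hπ.isLocalHom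
  have hJ : J.map π = maximalIdeal C := by
    rw [Ideal.map_span, ← Set.range_comp, ← hv]
    exact congr_arg _ (congr_arg _ (funext hw))
  -- Nakayama: lifts of generators for `C` generate the maximal ideal of `A` modulo its square.
  have hle : maximalIdeal A ≤ J := by
    refine Submodule.le_of_le_smul_of_le_jacobson_bot (I := maximalIdeal A)
      (IsNoetherian.noetherian _) (maximalIdeal_le_jacobson _) fun x hx ↦ ?_
    have hx' : π x ∈ J.map π := by
      rw [hJ]
      exact fun h ↦ hx ((isUnit_map_iff π x).mp h)
    obtain ⟨j, hj, hjx⟩ := (Ideal.mem_map_iff_of_surjective π hπ).mp hx'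
    have : x - j ∈ maximalIdeal A ^ 2 := hker (by simp [RingHom.mem_ker, hjx])
    rw [← add_sub_cancel j x]
    refine add_mem (Submodule.mem_sup_left hj) (Submodule.mem_sup_right ?_)
    rwa [smul_eq_mul, ← sq]
  have hJm : J ≤ maximalIdeal A := by
    rw [Ideal.span_le]
    rintro _ ⟨i, rfl⟩
    have : v i ∈ maximalIdeal C := hv ▸ Ideal.subset_span ⟨i, rfl⟩
    exact fun h ↦ this (hw i ▸ h.map π)
  have hspan : (maximalIdeal A).spanFinrank ≤ d := by
    rw [le_antisymm hle hJm]
    refine (Submodule.spanFinrank_span_le_ncard_of_finite (Set.finite_range w)).trans ?_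
    rw [← Set.image_univ]
    simpa using Set.ncard_image_le (f := w) Set.finite_univ
  rw [← hd]
  exact (ringKrullDim_le_spanFinrank_maximalIdeal A).trans (by exact_mod_cast hspan)

/-- Flatness gives `n + dim C ≤ dim A`, hence `dim C ≤ k`. Regularity of `C` would give `dim A ≤ dim
C`, contradicting `0 < n`. -/
theorem not_isRegularLocalRing_of_flat [IsLocalRing C] [IsNoetherianRing B] {f : B →+* A}
    [IsLocalHom f] (hf : f.Flat) {π : A →+* C} (hπ : Function.Surjective π)
    (hπf : ∀ b ∈ maximalIdeal B, π (f b) = 0) (hker : RingHom.ker π ≤ maximalIdeal A ^ 2)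
    {n k : ℕ} (hn : 0 < n) (hB : n ≤ ringKrullDim B) (hA : ringKrullDim A ≤ (n + k : ℕ)) :
    ringKrullDim C ≤ k ∧ ¬ IsRegularLocalRing C := by
  have h := hf.ringKrullDim_add_le hπ hπf
  have h1 := (add_le_add_left hB (ringKrullDim C)).trans h
  have : IsNoetherianRing C := isNoetherianRing_of_surjective A C π hπ
  obtain ⟨c, hc⟩ : ∃ c : ℕ, ringKrullDim C = c := by
    obtain ⟨hbot, htop⟩ := finiteRingKrullDim_iff_ne_bot_and_top.mp
      (inferInstance : FiniteRingKrullDim C)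
    obtain ⟨c, hc⟩ := WithBot.ne_bot_iff_exists.mp hbot
    rw [← hc] at htop
    obtain ⟨c, rfl⟩ := ENat.ne_top_iff_exists.mp fun h ↦ htop congr(↑$h)
    exact ⟨c, hc.symm⟩
  rw [hc] at h1 ⊢
  refine ⟨?_, fun hC ↦ ?_⟩
  · have := h1.trans hA
    norm_cast at this ⊢
    lia
  · have h2 := h1.trans (ringKrullDim_le_of_ker_le_sq hπ hker)
    rw [hc] at h2
    norm_cast at h2
    lia

end FlatLocal

/-! ### Local rings of scheme-theoretic fibres. -/

namespace AlgebraicGeometry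

variable {X Y Z : Scheme.{u}} {f : X ⟶ Y} {y : Y} {a : Z ⟶ X} {b : Z ⟶ Spec (Y.residueField y)}

theorem isField_stalk_Spec {k : Type u} [Field k] (x : Spec (.of k)) :
    IsField ((Spec (.of k)).presheaf.stalk x) := by
  obtain ⟨p, _, rfl⟩ := exists_eq_specPoint x
  refine (stalkEquivLocalization (𝟙 (Spec (.of k))) p).toMulEquiv.isField ?_
  exact (RingEquiv.ofBijective _ (Field.localization_map_bijective (Kₘ := Localization.AtPrime p)
    (M := p.primeCompl) (by simp))).symm.toMulEquiv.isField (Field.toIsField k)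

/-- The map factors through the stalk of the spectrum of the residue field, which is a field, and
non-units go to zero there. -/
theorem stalkMap_eq_zero_of_isPullback (hZ : IsPullback a b f (Y.fromSpecResidueField y)) (q : Z)
    (s : Y.presheaf.stalk (f (a q))) (hs : s ∈ IsLocalRing.maximalIdeal _) :
    a.stalkMap q (f.stalkMap (a q) s) = 0 := by
  let T := Spec (Y.residueField y)
  let g : T ⟶ Y := Y.fromSpecResidueField y
  have key : ∀ h : Z ⟶ Y, h = b ≫ g → ∀ s ∈ IsLocalRing.maximalIdeal (Y.presheaf.stalk (h q)),
      h.stalkMap q s = 0 := by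
    rintro _ rfl s hs
    rw [Scheme.Hom.stalkMap_comp]
    have hT : IsField (T.presheaf.stalk (b q)) := isField_stalk_Spec _
    have (s : Y.presheaf.stalk (g (b q))) (hs : s ∈ IsLocalRing.maximalIdeal _) :
        g.stalkMap (b q) s = 0 := by
      by_contra h0
      obtain ⟨t, ht⟩ := hT.mul_inv_cancel h0
      exact hs ((isUnit_map_iff (g.stalkMap (b q)).hom s).mp (IsUnit.of_mul_eq_one t ht))
    exact (congr_arg (b.stalkMap q) (this s hs)).trans (map_zero _)
  have := key (a ≫ f) hZ.w s hs
  rwa [Scheme.Hom.stalkMap_comp] at this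

theorem exists_SpecMap_comp_fromSpecStalk_eq {R : CommRingCat.{u}} [IsLocalRing R]
    (w : Spec R ⟶ Z) {q : Z} (hq : w (IsLocalRing.closedPoint R) = q) :
    ∃ ψ : Z.presheaf.stalk q ⟶ R, Spec.map ψ ≫ Z.fromSpecStalk q = w := by
  subst hq
  exact ⟨_, Scheme.Spec_stalkClosedPointTo_fromSpecStalk w⟩

/-- Universal property of the fibre: since the maximal ideal at `y` dies in the quotient by `I`, the
spectrum of this quotient maps to the fibre. The quotient map therefore factors through the stalk of
the fibre. -/
theorem ker_stalkMap_le_of_isPullback (hZ : IsPullback a b f (Y.fromSpecResidueField y)) (q : Z)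
    (I : Ideal (X.presheaf.stalk (a q))) (hI : I ≠ ⊤)
    (hfI : ∀ s ∈ IsLocalRing.maximalIdeal (Y.presheaf.stalk (f (a q))), f.stalkMap (a q) s ∈ I) :
    RingHom.ker (a.stalkMap q).hom ≤ I := by
  obtain rfl : f (a q) = y := by
    have := congr($hZ.w q)
    rwa [Scheme.Hom.comp_apply, Scheme.Hom.comp_apply, Scheme.fromSpecResidueField_apply] at this
  let O := X.presheaf.stalk (a q)
  let φ : Spec (.of (O ⧸ I)) ⟶ X :=
    Spec.map (CommRingCat.ofHom (Ideal.Quotient.mk I)) ≫ X.fromSpecStalk (a q)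
  let r : IsLocalRing.ResidueField (Y.presheaf.stalk (f (a q))) →+* O ⧸ I :=
    Ideal.Quotient.lift _ ((Ideal.Quotient.mk I).comp (f.stalkMap (a q)).hom) fun s hs ↦
      Ideal.Quotient.eq_zero_iff_mem.mpr (hfI s hs)
  have hr : φ ≫ f = Spec.map (CommRingCat.ofHom r : Y.residueField (f (a q)) ⟶ .of (O ⧸ I)) ≫
      Y.fromSpecResidueField (f (a q)) := by
    rw [Category.assoc, ← Scheme.SpecMap_stalkMap_fromSpecStalk, Scheme.fromSpecResidueField,
      ← Spec.map_comp_assoc]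
    refine Eq.trans ?_ (Spec.map_comp_assoc (Y.residue (f (a q))) (CommRingCat.ofHom r) _)
    rfl
  let w : Spec (.of (O ⧸ I)) ⟶ Z := hZ.lift φ _ hr
  have hwa : w ≫ a = φ := hZ.lift_fst _ _ _
  have : Nontrivial (O ⧸ I) := Ideal.Quotient.nontrivial_iff.mpr hI
  have : IsLocalRing (O ⧸ I) := .of_surjective' _ Ideal.Quotient.mk_surjective
  have : IsPreimmersion a := MorphismProperty.of_isPullback hZ.flip inferInstance
  let c : Spec (.of (O ⧸ I)) := IsLocalRing.closedPoint (O ⧸ I)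
  have hwq : w c = q := by
    refine a.isEmbedding.injective ?_
    rw [← Scheme.Hom.comp_apply, hwa]
    have : IsLocalHom (CommRingCat.ofHom (Ideal.Quotient.mk I)).hom :=
      Ideal.Quotient.mk_surjective.isLocalHom
    rw [Scheme.Hom.comp_apply]
    refine Eq.trans ?_ Scheme.fromSpecStalk_closedPoint
    exact congr_arg _ (Spec_closedPoint (f := CommRingCat.ofHom (Ideal.Quotient.mk I)))
  obtain ⟨ψ, hψ⟩ := exists_SpecMap_comp_fromSpecStalk_eq w hwq
  have h : CommRingCat.ofHom (Ideal.Quotient.mk I) = a.stalkMap q ≫ ψ := by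
    apply Spec.map_injective
    rw [← cancel_mono (X.fromSpecStalk (a q)), Spec.map_comp, Category.assoc,
      Scheme.SpecMap_stalkMap_fromSpecStalk, reassoc_of% hψ, hwa]
  intro s hs
  rw [← Ideal.Quotient.eq_zero_iff_mem]
  exact congr($h s).trans ((congr_arg ψ hs).trans (map_zero ψ.hom))

end AlgebraicGeometry

/-! ### Affine space as an additive group. -/

namespace AlgConv

section AffineGroup

variable {K : Type u} [Field K] (σ : Type u)

/-- Affine space over a field, as an object over the spectrum of that field. -/
noncomputable def affineSpace (K : Type u) [Field K] (σ : Type u) : Over (Spec (.of K)) :=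
  Over.mk (𝔸(σ; Spec (.of K)) ↘ Spec (.of K))

variable {σ} {T T' : Over (Spec (.of K))}

/-- The coordinate functions of a morphism to affine space. -/
noncomputable def coords (f : T ⟶ affineSpace K σ) (i : σ) : Γ(T.left, ⊤) :=
  f.left.appTop (AffineSpace.coord (Spec (.of K)) i)

/-- The morphism to affine space with given coordinate functions. -/
noncomputable def ofCoords (v : σ → Γ(T.left, ⊤)) : T ⟶ affineSpace K σ :=
  Over.homMk (AffineSpace.homOfVector T.hom v) (AffineSpace.homOfVector_over _ _)

theorem coords_ofCoords (v : σ → Γ(T.left, ⊤)) (i : σ) : coords (ofCoords v) i = v i :=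
  AffineSpace.homOfVector_appTop_coord _ _ _

theorem coords_comp (g : T' ⟶ T) (f : T ⟶ affineSpace K σ) (i : σ) :
    coords (g ≫ f) i = g.left.appTop (coords f i) := rfl

theorem hom_ext_coords {f g : T ⟶ affineSpace K σ} (h : ∀ i, coords f i = coords g i) : f = g :=
  Over.OverMorphism.ext (AffineSpace.hom_ext ((Over.w f).trans (Over.w g).symm) h)

theorem coords_comp_ofCoords (g : T' ⟶ T) (v : σ → Γ(T.left, ⊤)) (i : σ) :
    coords (g ≫ ofCoords v) i = g.left.appTop (v i) :=
  (coords_comp _ _ _).trans (congr_arg _ (coords_ofCoords v i))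

theorem coords_comp_add (h : T' ⟶ T) (f g : T ⟶ affineSpace K σ) (i : σ) :
    coords (h ≫ ofCoords (coords f + coords g)) i = coords (h ≫ f) i + coords (h ≫ g) i :=
  (coords_comp_ofCoords _ _ _).trans (map_add h.left.appTop.hom _ _)

theorem coords_comp_neg (h : T' ⟶ T) (f : T ⟶ affineSpace K σ) (i : σ) :
    coords (h ≫ ofCoords (-coords f)) i = -coords (h ≫ f) i :=
  (coords_comp_ofCoords _ _ _).trans (map_neg h.left.appTop.hom _)

theorem coords_comp_zero (h : T' ⟶ T) (i : σ) :
    coords (h ≫ (ofCoords 0 : T ⟶ affineSpace K σ)) i = 0 :=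
  (coords_comp_ofCoords _ _ _).trans (map_zero h.left.appTop.hom)

/-- The additive group structure on affine space. -/
noncomputable instance : GrpObj (affineSpace K σ) where
  one := ofCoords 0
  mul := ofCoords (coords (fst _ _) + coords (snd _ _))
  inv := ofCoords (-coords (𝟙 _))
  one_mul := hom_ext_coords fun i ↦ by
    rw [coords_comp_add, whiskerRight_fst, whiskerRight_snd, coords_comp_zero, zero_add,
      leftUnitor_hom]
  mul_one := hom_ext_coords fun i ↦ by
    rw [coords_comp_add, whiskerLeft_fst, whiskerLeft_snd, coords_comp_zero, add_zero,
      rightUnitor_hom]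
  mul_assoc := hom_ext_coords fun i ↦ by
    rw [coords_comp_add, whiskerRight_fst, whiskerRight_snd, coords_comp_add, ← Category.assoc,
      coords_comp_add, Category.assoc, whiskerLeft_fst, Category.assoc, whiskerLeft_snd,
      ← Category.assoc, coords_comp_add, associator_hom_fst, Category.assoc, Category.assoc, associator_hom_snd_fst,
      associator_hom_snd_snd, _root_.add_assoc]
  left_inv := hom_ext_coords fun i ↦ by
    rw [coords_comp_add, lift_fst, lift_snd, ← Category.id_comp (ofCoords _), coords_comp_neg,
      Category.comp_id, neg_add_cancel, coords_comp_zero]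
  right_inv := hom_ext_coords fun i ↦ by
    rw [coords_comp_add, lift_fst, lift_snd, ← Category.id_comp (ofCoords _), coords_comp_neg,
      Category.comp_id, add_neg_cancel, coords_comp_zero]

theorem coords_one (i : σ) : coords η[affineSpace K σ] i = 0 := coords_ofCoords _ _

theorem coords_conv (f : T ⟶ affineSpace K σ) (g : T' ⟶ affineSpace K σ) (i : σ) :
    coords (conv f g) i = (fst T T').left.appTop (coords f i) +
      (snd T T').left.appTop (coords g i) := by
  rw [← coords_comp, ← coords_comp]
  refine (coords_comp_add _ _ _ _).trans ?_
  rw [tensorHom_fst, tensorHom_snd]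

variable (K) (σ)

theorem isConnectedAlgebraicGroup_affineSpace [Finite σ] :
    IsConnectedAlgebraicGroup (affineSpace K σ) where
  nonempty := inferInstanceAs (Nonempty 𝔸(σ; Spec (.of K)))
  isReduced := inferInstanceAs (IsReduced 𝔸(σ; Spec (.of K)))
  isSeparated := inferInstanceAs (IsSeparated (𝔸(σ; Spec (.of K)) ↘ Spec (.of K)))
  locallyOfFiniteType := inferInstanceAs (LocallyOfFiniteType (𝔸(σ; Spec (.of K)) ↘ Spec (.of K)))
  quasiCompact := inferInstanceAs (QuasiCompact (𝔸(σ; Spec (.of K)) ↘ Spec (.of K)))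
  connected := inferInstanceAs (ConnectedSpace 𝔸(σ; Spec (.of K)))

theorem topologicalKrullDim_affineSpace [Finite σ] :
    topologicalKrullDim (affineSpace K σ).left = Nat.card σ := by
  have h := (Scheme.homeoOfIso (AffineSpace.SpecIso σ (.of K))).isHomeomorph.topologicalKrullDim_eq
  refine h.trans ?_
  refine (PrimeSpectrum.topologicalKrullDim_eq_ringKrullDim (MvPolynomial σ K)).trans ?_
  rw [MvPolynomial.ringKrullDim_of_isNoetherianRing, ringKrullDim_eq_zero_of_field, zero_add]

end AffineGroup
end AlgConv

/-! ### The example for sharpness: a strongly dominant map vanishing doubly on a hyperplane. -/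

namespace AlgConv

section SquareMap

open Classical in
/-- The endomorphism `x ↦ (x₀² x_i)_i` of affine space, where `x₀` is the coordinate at `i₀` and
the factor `x_{i₀}` is omitted. -/
noncomputable def sqMap (K : Type u) [Field K] {σ : Type u} (i₀ : σ) :
    affineSpace K σ ⟶ affineSpace K σ :=
  ofCoords fun i ↦ coords (𝟙 (affineSpace K σ)) i₀ ^ 2 *
    Function.update (coords (𝟙 (affineSpace K σ))) i₀ 1 i

variable {K : Type u} [Field K] {σ : Type u} (i₀ : σ) {T : Over (Spec (.of K))}

open Classical in
theorem coords_comp_sqMap (f : T ⟶ affineSpace K σ) (i : σ) :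
    coords (f ≫ sqMap K i₀) i = coords f i₀ ^ 2 * Function.update (coords f) i₀ 1 i := by
  refine (coords_comp_ofCoords _ _ _).trans ?_
  refine (map_mul f.left.appTop.hom _ _).trans ?_
  rw [map_pow]
  congr 1
  by_cases h : i = i₀
  · subst h
    rw [Function.update_self, Function.update_self, map_one]
  · rw [Function.update_of_ne h, Function.update_of_ne h]
    rfl

theorem nonempty_basicOpen_coord :
    (((affineSpace K σ).left.basicOpen (coords (𝟙 (affineSpace K σ)) i₀) :
      (affineSpace K σ).left.Opens) : Set (affineSpace K σ).left).Nonempty := by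
  let f : 𝟙_ (Over (Spec (.of K))) ⟶ affineSpace K σ := ofCoords 1
  let x : Spec (.of K) := Classical.arbitrary _
  refine ⟨f.left x, ?_⟩
  have h : f.left ⁻¹ᵁ (affineSpace K σ).left.basicOpen (coords (𝟙 (affineSpace K σ)) i₀) = ⊤ := by
    rw [Scheme.preimage_basicOpen_top]
    refine (congr_arg _ ((coords_comp f (𝟙 _) i₀).symm.trans ?_)).trans (Scheme.basicOpen_one _)
    rw [Category.comp_id]
    exact coords_ofCoords _ _
  exact h.ge (trivial : x ∈ (⊤ : (Spec (.of K)).Opens))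

open Classical in
theorem exists_comp_sqMap_eq {L : Type u} [Field L] [IsAlgClosed L]
    (p : Spec (.of L) ⟶ Spec (.of K)) (b : Over.mk p ⟶ affineSpace K σ) (hb : coords b i₀ ≠ 0) :
    ∃ a, a ≫ sqMap K i₀ = b := by
  let e : Γ(Spec (.of L), ⊤) ≃+* L := (Scheme.ΓSpecIso (.of L)).commRingCatIsoToRingEquiv
  obtain ⟨z, hz⟩ := IsAlgClosed.exists_pow_nat_eq (e (coords b i₀)) (n := 2) (by simp)
  have hb' : e (coords b i₀) ≠ 0 := (map_ne_zero_iff e e.injective).mpr hb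
  -- The preimage of `b` is `x₀ = √b₀` and `x_i = b_i / b₀`, because `x₀² = b₀`.
  refine ⟨ofCoords (T := Over.mk p) fun i ↦ e.symm
    (if i = i₀ then z else e (coords b i) / e (coords b i₀)), hom_ext_coords fun i ↦ ?_⟩
  rw [coords_comp_sqMap, coords_ofCoords, if_pos rfl]
  apply e.injective
  refine (map_mul e _ _).trans ?_
  rw [map_pow, e.apply_symm_apply, hz]
  by_cases h : i = i₀
  · subst h
    rw [Function.update_self, map_one, _root_.mul_one]
  · rw [Function.update_of_ne h, coords_ofCoords, if_neg h, e.apply_symm_apply]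
    field_simp

/-- Affine space is geometrically irreducible, so it suffices that the image contains the nonempty
open set where the coordinate at `i₀` is nonzero. Points there are lifted over an algebraic closure
of their residue field. -/
theorem stronglyDominant_sqMap : StronglyDominant (sqMap K i₀) := by
  intro Z hZ
  let A := affineSpace K σ
  let A' := ((Over.pullback (specClosure K)).obj A)
  have : IrreducibleSpace A'.left := by
    have h : GeometricallyIrreducible A.hom :=
      inferInstanceAs (GeometricallyIrreducible (𝔸(σ; Spec (.of K)) ↘ Spec (.of K)))
    exact h.geometrically_irreducibleSpace _ _ _ (isPullback_closureFst A)
  obtain rfl : Z = Set.univ := by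
    rw [irreducibleComponents_eq_singleton] at hZ
    exact hZ
  let U := closureFst A ⁻¹ᵁ A.left.basicOpen (coords (𝟙 A) i₀)
  have hU : (U : Set A'.left).Nonempty := by
    obtain ⟨x, hx⟩ := nonempty_basicOpen_coord (K := K) i₀
    obtain ⟨y, rfl⟩ := (closureFst A).surjective x
    exact ⟨y, hx⟩
  refine (U.isOpen.dense hU).mono fun y hy ↦ ?_
  let κ := A'.left.residueField y
  let L := AlgebraicClosure κ
  let g : Spec (.of L) ⟶ A'.left :=
    Spec.map (CommRingCat.ofHom (algebraMap κ L)) ≫ A'.left.fromSpecResidueField y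
  let x : Spec (.of L) := Classical.arbitrary _
  have hg : g x = y := by
    rw [Scheme.Hom.comp_apply, Scheme.fromSpecResidueField_apply]
  let p : Spec (.of L) ⟶ Spec (.of K) := g ≫ A'.hom ≫ specClosure K
  have hp : (g ≫ closureFst A) ≫ A.hom = p := by
    rw [Category.assoc, (isPullback_closureFst A).w]
  let b : Over.mk p ⟶ A := Over.homMk (g ≫ closureFst A) hp
  have hb : coords b i₀ ≠ 0 := by
    intro h0
    have h1 : x ∈ (g ≫ closureFst A) ⁻¹ᵁ A.left.basicOpen (coords (𝟙 A) i₀) := by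
      change g x ∈ U
      rwa [hg]
    rw [Scheme.preimage_basicOpen_top] at h1
    have h2 : (g ≫ closureFst A).appTop (coords (𝟙 A) i₀) = 0 := h0
    rw [h2, Scheme.basicOpen_zero] at h1
    exact h1
  obtain ⟨a, ha⟩ := exists_comp_sqMap_eq i₀ p b hb
  have haw : a.left ≫ A.hom = (g ≫ A'.hom) ≫ specClosure K := by
    rw [Over.w a, Category.assoc]; rfl
  -- The preimage is only a morphism over `K`; pairing it with the structure map of `g` makes it one
  -- over the algebraic closure.
  let a' := (isPullback_closureFst A).lift a.left (g ≫ A'.hom) haw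
  have ha' : a' ≫ ((Over.pullback (specClosure K)).map (sqMap K i₀)).left = g := by
    apply (isPullback_closureFst A).hom_ext
    · rw [Category.assoc, map_left_closureFst, (isPullback_closureFst A).lift_fst_assoc]
      exact congr_arg CommaMorphism.left ha
    · rw [Category.assoc, Over.w, (isPullback_closureFst A).lift_snd]
  exact ⟨a' x, trivial, by rw [← Scheme.Hom.comp_apply, ha', hg]⟩

end SquareMap

end AlgConv

/-! ### The origin of affine space and germs of coordinate functions. -/

/-- Induction on the variables: a maximal ideal of a polynomial ring contracts to a maximal ideal,
by the Jacobson property, and has height one more. -/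
theorem MvPolynomial.height_eq_card_of_isMaximal {k : Type*} [Field k] {τ : Type*} [Finite τ]
    (P : Ideal (MvPolynomial τ k)) [P.IsMaximal] : P.height = Nat.card τ := by
  revert P
  induction τ using Finite.induction_empty_option with
  | of_equiv e H =>
    intro P _
    let e' := (renameEquiv k e).toRingEquiv
    have : (P.comap e').IsMaximal := Ideal.comap_isMaximal_of_surjective _ e'.surjective
    rw [← RingEquiv.height_comap e', H, Nat.card_congr e]
  | h_empty =>
    intro P _
    have h := Ideal.height_le_ringKrullDim_of_ne_top (I := P) (Ideal.IsPrime.ne_top inferInstance)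
    rw [ringKrullDim_of_isNoetherianRing, ringKrullDim_eq_zero_of_field, zero_add] at h
    rw [Nat.card_of_isEmpty] at h ⊢
    exact le_antisymm (by exact_mod_cast h) zero_le
  | @h_option α _ IH =>
    intro P _
    let e' := (optionEquivLeft k α).symm.toRingEquiv
    have : (P.comap e').IsMaximal := Ideal.comap_isMaximal_of_surjective _ e'.surjective
    let p := (P.comap e').comap Polynomial.C
    have : p.IsMaximal := Polynomial.isMaximal_comap_C_of_isJacobsonRing _
    have : (P.comap e').LiesOver p := ⟨rfl⟩
    rw [← RingEquiv.height_comap e', Polynomial.height_eq_height_add_one p, IH]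
    simp

theorem MvPolynomial.ker_constantCoeff {k : Type*} [CommRing k] {τ : Type*} :
    RingHom.ker (constantCoeff : MvPolynomial τ k →+* k) = Ideal.span (Set.range X) := by
  refine le_antisymm (fun f hf ↦ ?_) ?_
  · rw [← Set.image_univ, mem_ideal_span_X_image]
    intro m hm
    by_contra! h
    obtain rfl : m = 0 := Finsupp.ext fun i ↦ h i trivial
    exact mem_support_iff.mp hm hf
  · rw [Ideal.span_le]
    rintro _ ⟨i, rfl⟩
    exact constantCoeff_X (σ := τ) (R := k) i

theorem MvPolynomial.eq_ker_constantCoeff {k : Type*} [Field k] {τ : Type*}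
    {P : Ideal (MvPolynomial τ k)} (hP' : P ≠ ⊤) (hP : ∀ i, X i ∈ P) :
    P = RingHom.ker constantCoeff := by
  have : (RingHom.ker (constantCoeff : MvPolynomial τ k →+* k)).IsMaximal :=
    RingHom.ker_isMaximal_of_surjective _ fun c ↦ ⟨C c, constantCoeff_C τ c⟩
  refine (this.eq_of_le hP' ?_).symm
  rw [ker_constantCoeff, Ideal.span_le]
  rintro _ ⟨i, rfl⟩
  exact hP i

namespace AlgConv

section Germs

variable {X Y : Scheme.{u}}

theorem germ_appTop_mem_pow (f : X ⟶ Y) (x : X) (s : Γ(Y, ⊤)) {k : ℕ}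
    (hs : Y.presheaf.germ ⊤ (f x) trivial s ∈ IsLocalRing.maximalIdeal (Y.presheaf.stalk (f x)) ^ k) :
    X.presheaf.germ ⊤ x trivial (f.appTop s) ∈
      IsLocalRing.maximalIdeal (X.presheaf.stalk x) ^ k := by
  have h := Ideal.mem_map_of_mem (f.stalkMap x).hom hs
  rw [Ideal.map_pow] at h
  have hle : (IsLocalRing.maximalIdeal _).map (f.stalkMap x).hom ≤ IsLocalRing.maximalIdeal _ :=
    ((IsLocalRing.local_hom_TFAE (f.stalkMap x).hom).out 0 2).mp
      (inferInstance : IsLocalHom (f.stalkMap x).hom)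
  have h' := Ideal.pow_right_mono hle k h
  exact Eq.mp (congr_arg (· ∈ _) (Scheme.Hom.germ_stalkMap_apply f ⊤ x trivial s)) h'

theorem germ_specPoint_mem_maximalIdeal_iff {R : Type u} [CommRing R] (j : Spec (.of R) ⟶ X)
    (p : Ideal R) [p.IsPrime] (s : Γ(X, ⊤)) (r : R)
    (h : j.appTop s = (Scheme.ΓSpecIso (.of R)).inv r) :
    X.presheaf.germ ⊤ (j (specPoint p)) trivial s ∈ IsLocalRing.maximalIdeal _ ↔ r ∈ p := by
  rw [IsLocalRing.mem_maximalIdeal, mem_nonunits_iff, ← Scheme.mem_basicOpen_top]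
  have h1 : j (specPoint p) ∈ X.basicOpen s ↔ specPoint p ∈ j ⁻¹ᵁ (X.basicOpen s) := Iff.rfl
  rw [h1, Scheme.preimage_basicOpen_top, h, basicOpen_eq_of_affine]
  exact not_not

theorem stalkEquivLocalization_germ {R : Type u} [CommRing R] (j : Spec (.of R) ⟶ X)
    [IsOpenImmersion j] (p : Ideal R) [p.IsPrime] (s : Γ(X, ⊤)) (r : R)
    (h : j.appTop s = (Scheme.ΓSpecIso (.of R)).inv r) :
    stalkEquivLocalization j p (X.presheaf.germ ⊤ (j (specPoint p)) trivial s) =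
      algebraMap R (Localization.AtPrime p) r := by
  have h1 : j.stalkMap (specPoint p) (X.presheaf.germ ⊤ (j (specPoint p)) trivial s) =
      (Spec (.of R)).presheaf.germ ⊤ (specPoint p) trivial ((Scheme.ΓSpecIso (.of R)).inv r) :=
    (Scheme.Hom.germ_stalkMap_apply j ⊤ (specPoint p) trivial s).trans
      (congr_arg ((Spec (.of R)).presheaf.germ ⊤ (specPoint p) trivial) h)
  have h2 := congr($(Spec.algebraMap_stalkIso_inv (R := .of R) (x := specPoint p)) r)
  refine (congr_arg (Spec.stalkIso (.of R) (specPoint p)).hom (h1.trans h2.symm)).trans ?_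
  exact (Spec.stalkIso (.of R) (specPoint p)).inv_hom_id_apply (algebraMap R _ r)

theorem maximalIdeal_eq_span_germ {R : Type u} [CommRing R] (j : Spec (.of R) ⟶ X)
    [IsOpenImmersion j] (p : Ideal R) [p.IsPrime] {τ : Type*} (s : τ → Γ(X, ⊤))
    (r : τ → R) (hp : p = Ideal.span (Set.range r))
    (h : ∀ i, j.appTop (s i) = (Scheme.ΓSpecIso (.of R)).inv (r i)) :
    IsLocalRing.maximalIdeal (X.presheaf.stalk (j (specPoint p))) =
      Ideal.span (Set.range fun i ↦ X.presheaf.germ ⊤ (j (specPoint p)) trivial (s i)) := by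
  let e := stalkEquivLocalization j p
  have he (i) : e.symm (algebraMap R _ (r i)) =
      X.presheaf.germ ⊤ (j (specPoint p)) trivial (s i) := by
    rw [RingEquiv.symm_apply_eq]
    exact (stalkEquivLocalization_germ j p _ _ (h i)).symm
  have h1 : Ideal.span (Set.range fun i ↦ algebraMap R (Localization.AtPrime p) (r i)) =
      IsLocalRing.maximalIdeal _ := by
    rw [← Localization.AtPrime.map_eq_maximalIdeal]
    conv_rhs => enter [2]; rw [hp]
    rw [Ideal.map_span, ← Set.range_comp]
    rfl
  have h2 := IsLocalRing.map_maximalIdeal_of_surjective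
    (e.symm : Localization.AtPrime p →+* X.presheaf.stalk (j (specPoint p))) e.symm.surjective
  rw [← h2, ← h1, Ideal.map_span, ← Set.range_comp]
  exact congr_arg _ (congr_arg _ (funext he))

end Germs

/-! ### Points where the convolution powers vanish to second order. -/

section AffineSpace

variable {K : Type u} [Field K] {σ : Type u} [Finite σ]

/-- The coordinates generate a maximal ideal, so their vanishing forces `y` to be the origin. -/
theorem ringKrullDim_stalk_of_germ_coord_mem (y : (affineSpace K σ).left)
    (hy : ∀ i, (affineSpace K σ).left.presheaf.germ ⊤ y trivial (coords (𝟙 _) i) ∈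
      IsLocalRing.maximalIdeal _) :
    ringKrullDim ((affineSpace K σ).left.presheaf.stalk y) = Nat.card σ ∧
      IsLocalRing.maximalIdeal ((affineSpace K σ).left.presheaf.stalk y) =
        Ideal.span (Set.range fun i ↦
          (affineSpace K σ).left.presheaf.germ ⊤ y trivial (coords (𝟙 _) i)) := by
  let j : Spec (.of (MvPolynomial σ K)) ⟶ (affineSpace K σ).left :=
    (AffineSpace.SpecIso σ (.of K)).inv
  have hj (i : σ) : j.appTop (coords (𝟙 (affineSpace K σ)) i) =
      (Scheme.ΓSpecIso (.of (MvPolynomial σ K))).inv (MvPolynomial.X i) :=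
    AffineSpace.SpecIso_inv_appTop_coord _ _
  have : IsOpenImmersion j := inferInstanceAs
    (IsOpenImmersion (AffineSpace.SpecIso σ (.of K)).inv)
  have hsurj : Function.Surjective j := (AffineSpace.SpecIso σ (.of K)).inv.surjective
  obtain ⟨p, rfl⟩ := hsurj y
  obtain ⟨P, _, rfl⟩ := exists_eq_specPoint p
  have hP : P = RingHom.ker MvPolynomial.constantCoeff :=
    MvPolynomial.eq_ker_constantCoeff (Ideal.IsPrime.ne_top ‹_›) fun i ↦
      (germ_specPoint_mem_maximalIdeal_iff j P _ _ (hj i)).mp (hy i)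
  have : P.IsMaximal := hP ▸
    RingHom.ker_isMaximal_of_surjective _ fun c ↦ ⟨.C c, MvPolynomial.constantCoeff_C σ c⟩
  refine ⟨?_, ?_⟩
  · rw [ringKrullDim_stalk_eq_height, MvPolynomial.height_eq_card_of_isMaximal]
    rfl
  · rw [MvPolynomial.ker_constantCoeff] at hP
    exact maximalIdeal_eq_span_germ j P _ _ hP hj

/-- Take a minimal prime over the coordinate; Krull's principal ideal theorem bounds its height. -/
theorem exists_germ_coord_mem (i : σ) : ∃ x : (affineSpace K σ).left,
    ringKrullDim ((affineSpace K σ).left.presheaf.stalk x) ≤ 1 ∧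
      (affineSpace K σ).left.presheaf.germ ⊤ x trivial (coords (𝟙 _) i) ∈
        IsLocalRing.maximalIdeal _ := by
  let j : Spec (.of (MvPolynomial σ K)) ⟶ (affineSpace K σ).left :=
    (AffineSpace.SpecIso σ (.of K)).inv
  have hj : j.appTop (coords (𝟙 (affineSpace K σ)) i) =
      (Scheme.ΓSpecIso (.of (MvPolynomial σ K))).inv (MvPolynomial.X i) :=
    AffineSpace.SpecIso_inv_appTop_coord _ _
  have : IsOpenImmersion j := inferInstanceAs
    (IsOpenImmersion (AffineSpace.SpecIso σ (.of K)).inv)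
  let I : Ideal (MvPolynomial σ K) := Ideal.span {MvPolynomial.X i}
  have hI : I ≠ ⊤ := by
    rw [Ne, Ideal.span_singleton_eq_top]
    intro h
    simpa using h.map (MvPolynomial.constantCoeff (R := K) (σ := σ))
  obtain ⟨P, hP⟩ := Ideal.nonempty_minimalPrimes hI
  have := hP.isPrime
  refine ⟨j (specPoint P), ?_, (germ_specPoint_mem_maximalIdeal_iff j P _ _ hj).mpr
    (hP.1.2 (Ideal.mem_span_singleton_self _))⟩
  rw [ringKrullDim_stalk_eq_height]
  exact_mod_cast Ideal.height_le_one_of_isPrincipal_of_mem_minimalPrimes I P hP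

omit [Finite σ] in
theorem germ_coords_sqMap_mem (i₀ : σ) (x : (affineSpace K σ).left)
    (hx : (affineSpace K σ).left.presheaf.germ ⊤ x trivial (coords (𝟙 _) i₀) ∈
      IsLocalRing.maximalIdeal _) (i : σ) :
    (affineSpace K σ).left.presheaf.germ ⊤ x trivial (coords (sqMap K i₀) i) ∈
      IsLocalRing.maximalIdeal _ ^ 2 := by
  have h := coords_comp_sqMap i₀ (𝟙 (affineSpace K σ)) i
  rw [Category.id_comp] at h
  rw [h, map_mul, map_pow]
  exact Ideal.mul_mem_right _ _ (Ideal.pow_mem_pow hx 2)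

/-- Each factor contributes a point of codimension at most one on the hyperplane at `i₀`.
Coordinates of a convolution are sums of pulled-back coordinates, so membership in the square of the
maximal ideal persists. -/
theorem exists_germ_coords_convPow_mem (i₀ : σ) (d : ℕ) :
    ∃ p : (prodFam d fun _ ↦ affineSpace K σ).left,
      ringKrullDim ((prodFam d fun _ ↦ affineSpace K σ).left.presheaf.stalk p) ≤ d ∧
      ∀ i, (prodFam d fun _ ↦ affineSpace K σ).left.presheaf.germ ⊤ p trivial
        (coords (convPow (sqMap K i₀) d) i) ∈ IsLocalRing.maximalIdeal _ ^ 2 := by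
  induction d with
  | zero =>
    let p : Spec (.of K) := Classical.arbitrary _
    refine ⟨p, (ringKrullDim_eq_zero_of_isField (isField_stalk_Spec p)).le, fun i ↦ ?_⟩
    have h : coords (convPow (sqMap K i₀) 0) i = 0 := coords_one i
    rw [h, map_zero]
    exact zero_mem _
  | succ d ih =>
    obtain ⟨p, hp, hpi⟩ := ih
    obtain ⟨x, hx, hxi⟩ := exists_germ_coord_mem (K := K) i₀
    have : LocallyOfFiniteType (affineSpace K σ).hom :=
      (isConnectedAlgebraicGroup_affineSpace K σ).locallyOfFiniteType
    have : LocallyOfFiniteType (prodFam d fun _ ↦ affineSpace K σ).hom :=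
      locallyOfFiniteType_prodFam _ fun _ ↦ this
    obtain ⟨z, rfl, rfl, hz⟩ := exists_ringKrullDim_stalk_le_add x p
    refine ⟨z, (hz.trans (add_le_add hx hp)).trans_eq ?_, fun i ↦ ?_⟩
    · push_cast
      exact _root_.add_comm _ _
    · have h : coords (convPow (sqMap K i₀) (d + 1)) i =
          (fst (affineSpace K σ) (prodFam d fun _ ↦ affineSpace K σ)).left.appTop
            (coords (sqMap K i₀) i) +
          (snd (affineSpace K σ) (prodFam d fun _ ↦ affineSpace K σ)).left.appTop
            (coords (convPow (sqMap K i₀) d) i) := coords_conv _ _ _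
      rw [h]
      refine (map_add ((prodFam (d + 1) fun _ ↦ affineSpace K σ).left.presheaf.germ
        ⊤ z trivial).hom _ _).symm ▸ add_mem ?_ (germ_appTop_mem_pow _ _ _ (hpi i))
      refine germ_appTop_mem_pow _ _ _ ?_
      exact germ_coords_sqMap_mem i₀ _ hxi i

end AffineSpace


end AlgConv

/-! ### Sharpness of the bounds. -/

theorem isRegularLocalRing_of_isReduced {R : Type*} [CommRing R] [IsLocalRing R]
    [IsNoetherianRing R] [_root_.IsReduced R] (h : ringKrullDim R ≤ 0) : IsRegularLocalRing R := by
  have : Ring.KrullDimLE 0 R := Ring.krullDimLE_iff.mpr h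
  have hm : IsLocalRing.maximalIdeal R = ⊥ := by
    rw [← Ring.KrullDimLE.nilradical_eq_maximalIdeal, nilradical_eq_zero, Submodule.zero_eq_bot]
  have := (IsLocalRing.isField_iff_maximalIdeal_eq.mpr hm).isDomain
  have : IsPrincipalIdealRing R :=
    ((tfae_of_isNoetherianRing_of_isLocalRing_of_isDomain R).out 0 4).mpr
      (hm ▸ (inferInstance : (⊥ : Ideal R).IsPrincipal))
  infer_instance

theorem isRegularLocalRing_of_isIntegrallyClosed {R : Type*} [CommRing R] [IsLocalRing R]
    [IsNoetherianRing R] [IsDomain R] [IsIntegrallyClosed R] (h : ringKrullDim R ≤ 1) :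
    IsRegularLocalRing R := by
  have : Ring.KrullDimLE 1 R := Ring.krullDimLE_iff.mpr h
  have hR : IsIntegrallyClosed R ∧
      ∀ P : Ideal R, P ≠ ⊥ → P.IsPrime → P = IsLocalRing.maximalIdeal R :=
    ⟨inferInstance, fun P hP hP' ↦ IsLocalRing.eq_maximalIdeal (hP'.isMaximal_of_ne_bot hP)⟩
  have : IsPrincipalIdealRing R :=
    ((tfae_of_isNoetherianRing_of_isLocalRing_of_isDomain R).out 0 3).mpr hR
  infer_instance

namespace AlgConv

section Sharpness

variable {K : Type u} [Field K] {σ : Type u} [Finite σ]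

/-- The coordinates vanish at the image of `p`, so that image is the origin, whose maximal ideal
they generate. -/
theorem exists_stalkMap_convPow_mem (i₀ : σ) (d : ℕ) :
    ∃ p : (prodFam d fun _ ↦ affineSpace K σ).left,
      ringKrullDim ((prodFam d fun _ ↦ affineSpace K σ).left.presheaf.stalk p) ≤ d ∧
      ringKrullDim ((affineSpace K σ).left.presheaf.stalk ((convPow (sqMap K i₀) d).left p)) =
        Nat.card σ ∧
      ∀ s ∈ IsLocalRing.maximalIdeal
        ((affineSpace K σ).left.presheaf.stalk ((convPow (sqMap K i₀) d).left p)),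
        (convPow (sqMap K i₀) d).left.stalkMap p s ∈ IsLocalRing.maximalIdeal _ ^ 2 := by
  obtain ⟨p, hp, hpi⟩ := exists_germ_coords_convPow_mem (K := K) i₀ d
  let Φ := (convPow (sqMap K i₀) d).left
  have hΦ (i : σ) : Φ.stalkMap p
      ((affineSpace K σ).left.presheaf.germ ⊤ (Φ p) trivial (coords (𝟙 _) i)) ∈
        IsLocalRing.maximalIdeal _ ^ 2 :=
    Eq.mp (congr_arg (· ∈ _) (Scheme.Hom.germ_stalkMap_apply Φ ⊤ p trivial _).symm) (hpi i)
  obtain ⟨h1, h2⟩ := ringKrullDim_stalk_of_germ_coord_mem (Φ p) fun i h ↦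
    Ideal.pow_le_self two_ne_zero (hΦ i) (h.map (Φ.stalkMap p).hom)
  refine ⟨p, hp, h1, fun s hs ↦ ?_⟩
  have hle : IsLocalRing.maximalIdeal ((affineSpace K σ).left.presheaf.stalk (Φ p)) ≤
      (IsLocalRing.maximalIdeal _ ^ 2).comap (Φ.stalkMap p).hom := by
    rw [h2, Ideal.span_le]
    rintro _ ⟨i, rfl⟩
    exact hΦ i
  exact hle hs

variable (K σ) in
theorem isLocallyNoetherian_affineSpace : IsLocallyNoetherian (affineSpace K σ).left := by
  have := (isConnectedAlgebraicGroup_affineSpace K σ).locallyOfFiniteType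
  exact LocallyOfFiniteType.isLocallyNoetherian (affineSpace K σ).hom

variable (K σ) in
theorem isLocallyNoetherian_prodFam_affineSpace (d : ℕ) :
    IsLocallyNoetherian (prodFam d fun _ ↦ affineSpace K σ).left := by
  have := locallyOfFiniteType_prodFam (m := d) (fun _ ↦ affineSpace K σ) fun _ ↦
    (isConnectedAlgebraicGroup_affineSpace K σ).locallyOfFiniteType
  exact LocallyOfFiniteType.isLocallyNoetherian (prodFam d fun _ ↦ affineSpace K σ).hom

theorem not_flat_convPow_sqMap (i₀ : σ) {d : ℕ} (hd : d < Nat.card σ) :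
    ¬ Flat (convPow (sqMap K i₀) d).left := by
  intro h
  obtain ⟨p, hp, hy, -⟩ := exists_stalkMap_convPow_mem (K := K) i₀ d
  have hf := Flat.stalkMap (convPow (sqMap K i₀) d).left p
  have := isLocallyNoetherian_affineSpace K σ
  have := isLocallyNoetherian_prodFam_affineSpace K σ d
  -- Flatness would give `n ≤ dim 𝒪_p ≤ d`, with `n` the dimension of the group.
  have hle := hf.height_comap_le (IsLocalRing.maximalIdeal _)
  rw [IsLocalRing.maximalIdeal_comap] at hle
  have h1 := (WithBot.coe_le_coe.mpr hle)
  rw [IsLocalRing.maximalIdeal_height_eq_ringKrullDim,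
    IsLocalRing.maximalIdeal_height_eq_ringKrullDim, hy] at h1
  have h2 := h1.trans hp
  norm_cast at h2
  lia

/-- The bad point lies in the fibre over the origin, and the stalk there is a quotient of the stalk
of the product by an ideal inside the square of the maximal ideal. Noetherianity is recorded because
reducedness or normality implies regularity only for Noetherian rings of dimension zero or at most
one. -/
theorem exists_not_isRegularLocalRing_fiber [CharZero K] (i₀ : σ) (k : ℕ) :
    ∃ (y : (affineSpace K σ).left) (q : (convPow (sqMap K i₀) (Nat.card σ + k)).left.fiber y),
      ringKrullDim (((convPow (sqMap K i₀) (Nat.card σ + k)).left.fiber y).presheaf.stalk q) ≤ k ∧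
      IsNoetherianRing
        (((convPow (sqMap K i₀) (Nat.card σ + k)).left.fiber y).presheaf.stalk q) ∧
      ¬ IsRegularLocalRing
        (((convPow (sqMap K i₀) (Nat.card σ + k)).left.fiber y).presheaf.stalk q) := by
  obtain ⟨p, hp, hy, hs⟩ := exists_stalkMap_convPow_mem (K := K) i₀ (Nat.card σ + k)
  have hG := isConnectedAlgebraicGroup_affineSpace K σ
  have hX : IsSmoothVariety (affineSpace K σ) := ⟨hG.toIsVariety, hG.smooth⟩
  have hflat : Flat (convPow (sqMap K i₀) (Nat.card σ + k)).left :=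
    flat_convFam (fun _ ↦ hX) hG (fun _ ↦ stronglyDominant_sqMap i₀)
      (topologicalKrullDim_affineSpace K σ).le (by lia)
  let Φ := (convPow (sqMap K i₀) (Nat.card σ + k)).left
  generalize hy' : Φ p = y
  obtain ⟨q, rfl⟩ : p ∈ Set.range (Φ.fiberι y) := by
    rw [Φ.range_fiberι]
    exact hy'
  have := isLocallyNoetherian_affineSpace K σ
  have := isLocallyNoetherian_prodFam_affineSpace K σ (Nat.card σ + k)
  have hZ : IsPullback (Φ.fiberι y) (Φ.fiberToSpecResidueField y) Φ
    ((affineSpace K σ).left.fromSpecResidueField y) := .of_hasPullback _ _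
  have hπ : Function.Surjective ((Φ.fiberι y).stalkMap q).hom :=
    (Φ.fiberι y).stalkMap_surjective q
  have hker := ker_stalkMap_le_of_isPullback hZ q (IsLocalRing.maximalIdeal _ ^ 2)
    (ne_top_of_le_ne_top (Ideal.IsPrime.ne_top inferInstance) (Ideal.pow_le_self two_ne_zero)) hs
  have hf : (Φ.stalkMap (Φ.fiberι y q)).hom.Flat := Flat.stalkMap Φ _
  have : Nonempty σ := ⟨i₀⟩
  have h := not_isRegularLocalRing_of_flat hf hπ (stalkMap_eq_zero_of_isPullback hZ q) hker
    Nat.card_pos hy.ge hp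
  exact ⟨y, q, h.1, isNoetherianRing_of_surjective _ _ _ hπ, h.2⟩

theorem exists_not_isRegularInCodim_fiber [CharZero K] (i₀ : σ) (k : ℕ) :
    ∃ y, ¬ IsRegularInCodim ((convPow (sqMap K i₀) (Nat.card σ + k)).left.fiber y) k := by
  obtain ⟨y, q, h1, -, h2⟩ := exists_not_isRegularLocalRing_fiber (K := K) i₀ k
  exact ⟨y, fun h ↦ h2 (h q h1)⟩

theorem exists_not_isReduced_fiber [CharZero K] (i₀ : σ) :
    ∃ y, ¬ IsReduced ((convPow (sqMap K i₀) (Nat.card σ)).left.fiber y) := by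
  obtain ⟨y, q, h1, _, h2⟩ := exists_not_isRegularLocalRing_fiber (K := K) i₀ 0
  exact ⟨y, fun h ↦ h2 (isRegularLocalRing_of_isReduced (by exact_mod_cast h1))⟩

theorem exists_not_isNormalScheme_fiber [CharZero K] (i₀ : σ) :
    ∃ y, ¬ IsNormalScheme ((convPow (sqMap K i₀) (Nat.card σ + 1)).left.fiber y) := by
  obtain ⟨y, q, h1, _, h2⟩ := exists_not_isRegularLocalRing_fiber (K := K) i₀ 1
  refine ⟨y, fun h ↦ ?_⟩
  obtain ⟨_, _⟩ := h q
  exact h2 (isRegularLocalRing_of_isIntegrallyClosed (by exact_mod_cast h1))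

end Sharpness

end AlgConv

/-! ### Assembly of both halves. -/

theorem theoremB (K : Type u) [Field K] [CharZero K] :
    (∀ (m : ℕ) (X : Fin m → Over (Spec (.of K))) (G : Over (Spec (.of K))) [GrpObj G]
        (φ : (i : Fin m) → (X i ⟶ G)),
      (∀ i, AlgConv.IsSmoothVariety (X i)) →
      AlgConv.IsConnectedAlgebraicGroup G →
      (∀ i, AlgConv.StronglyDominant (φ i)) →
        (∀ i j, Surjective (AlgConv.conv (φ i) (φ j)).left) ∧
        (topologicalKrullDim G.left ≤ m → Flat (AlgConv.convFam m φ).left) ∧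
        (topologicalKrullDim G.left + 1 ≤ m →
          Flat (AlgConv.convFam m φ).left ∧
          ∀ y, IsReduced ((AlgConv.convFam m φ).left.fiber y)) ∧
        (topologicalKrullDim G.left + 2 ≤ m →
          AlgConv.IsNormalMorphism (AlgConv.convFam m φ).left) ∧
        (∀ k : ℕ, 2 < k → topologicalKrullDim G.left + k ≤ m →
          AlgConv.IsNormalMorphism (AlgConv.convFam m φ).left ∧
          ∀ y, AlgConv.IsRegularInCodim ((AlgConv.convFam m φ).left.fiber y) (k - 1))) ∧
    (∀ n : ℕ, 1 ≤ n →
      ∃ (G : Over (Spec (.of K))) (_ : GrpObj G) (X : Over (Spec (.of K))) (φ : X ⟶ G),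
        AlgConv.IsConnectedAlgebraicGroup G ∧
        topologicalKrullDim G.left = n ∧
        AlgConv.IsSmoothVariety X ∧
        AlgConv.StronglyDominant φ ∧
        (∀ d < n, ¬ Flat (AlgConv.convPow φ d).left) ∧
        (∃ y, ¬ IsReduced ((AlgConv.convPow φ n).left.fiber y)) ∧
        (∃ y, ¬ AlgConv.IsNormalScheme ((AlgConv.convPow φ (n + 1)).left.fiber y)) ∧
        (∀ k : ℕ, ∃ y,
          ¬ AlgConv.IsRegularInCodim ((AlgConv.convPow φ (n + k)).left.fiber y) k)) := by
  refine ⟨?_, ?_⟩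
  · intro m X G _ φ hX hG hφ
    have := hG.isReduced
    have := hG.locallyOfFiniteType
    have := hG.nonempty
    -- The bound by `m` makes the dimension of the nonempty scheme `G` a natural number.
    have hdim (k : ℕ) (h : topologicalKrullDim G.left + k ≤ m) :
        ∃ n : ℕ, topologicalKrullDim G.left = n ∧ n + k ≤ m := by
      obtain ⟨n, hn⟩ := AlgConv.exists_topologicalKrullDim_eq
        ((le_add_of_nonneg_right (Nat.cast_nonneg k)).trans h)
      refine ⟨n, hn, ?_⟩
      rw [hn] at h
      exact_mod_cast h
    refine ⟨fun i j ↦ AlgConv.surjective_conv (hX i) (hX j) (hφ i) (hφ j), fun h ↦ ?_, fun h ↦ ?_,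
      fun h ↦ ?_, fun k hk h ↦ ?_⟩
    -- Only an upper bound on the dimension is needed, so `m` itself serves.
    · exact AlgConv.flat_convFam hX hG hφ h le_rfl
    · obtain ⟨n, hn, hnm⟩ := hdim 1 h
      exact ⟨AlgConv.flat_convFam hX hG hφ hn.le (by lia), fun y ↦
        AlgConv.isReduced_of_isPullback_convFam hX hG hφ hn.le (.of_hasPullback _ _) hnm⟩
    · obtain ⟨n, hn, hnm⟩ := hdim 2 h
      exact AlgConv.isNormalMorphism_convFam hX hG hφ hn.le hnm
    · obtain ⟨n, hn, hnm⟩ := hdim k h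
      -- Codimension `k - 1` is what `n + (k - 1) < m` allows; the truncated subtraction is harmless
      -- since `2 < k`.
      exact ⟨AlgConv.isNormalMorphism_convFam hX hG hφ hn.le (by lia), fun y ↦
        AlgConv.isRegularInCodim_of_isPullback_convFam hX hG hφ hn.le (.of_hasPullback _ _)
          (k := k - 1) (by lia)⟩
  · intro n hn
    let σ := ULift.{u} (Fin n)
    let i₀ : σ := ⟨⟨0, hn⟩⟩
    have hσ : Nat.card σ = n := by simp [σ]
    have hG := AlgConv.isConnectedAlgebraicGroup_affineSpace K σ
    have hd := AlgConv.topologicalKrullDim_affineSpace K σ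
    have h0 := AlgConv.exists_not_isReduced_fiber (K := K) i₀
    have h1 := AlgConv.exists_not_isNormalScheme_fiber (K := K) i₀
    have hk := AlgConv.exists_not_isRegularInCodim_fiber (K := K) i₀
    rw [hσ] at hd h0 h1 hk
    exact ⟨AlgConv.affineSpace K σ, inferInstance, AlgConv.affineSpace K σ, AlgConv.sqMap K i₀, hG,
      hd, ⟨hG.toIsVariety, hG.smooth⟩, AlgConv.stronglyDominant_sqMap i₀,
      fun d hd ↦ AlgConv.not_flat_convPow_sqMap i₀ (hσ.symm ▸ hd), h0, h1, hk⟩
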